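/- **Setting.** Let $0<\varepsilon<1$. Let $\mathcal C_2$ be a code of block length $N_2\ge 1$ with $|\mathcal C_2|\ge 1$ codewords, and $\mathcal C_1$ a code of block length $N_1=N_2|\mathcal C_2|$. For $\ell=1,2$ let $\mathrm{Dec}_{\ell}$ be an $L_\ell$-list decoder of $\mathcal C_\ell$ ($L_\ell\ge1$): on every string $y$ it outputs at most $L_\ell$ codewords of $\mathcal C_\ell$, among them every codeword that can be turned into $y$ by at most $N_\ell(1-\varepsilon)$ deletions and at most $N_\ell(1-\varepsilon)$ insertions. Let $\mathrm{Dec}_\ell$ take at most $T_{\mathrm{Dec}_\ell}(N_\ell)$ time on strings of length at most $N_\ell$. Let $I_1$ be the concatenation of all codewords of $\mathcal C_1$, let $I'$ (of length $N_1$) be the concatenation of all codewords of $\mathcal C_2$, and let $I_2$ be $I'$ repeated $|\mathcal C_1|$ times. Let $S$ be a content string $m$ with $|m|\le |I_1|$ indexed symbol by symbol by (the first $|m|$ symbols of) $I=(I_1,I_2)$, let $S'$ be an arbitrary string over triples (content symbol, $\mathcal C_1$-symbol, $\mathcal C_2$-symbol), and let $n=\max(|S|,|S'|)$. Assume $n\ge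 N_1$ (automatic when $|m|=|I_1|$ and $|\mathcal C_1|\ge1$) and $n\ge 3$. Split $S$ and $S'$ into blocks $S(k)$, $S'(i)$ of length $N_1$ and each block into sub-blocks $S(k,k')$, $S'(i,i')$ of length $N_2$ (the last ones may be incomplete). Let $C'_i$ be the $\mathcal C_1$-part of $S'(i)$ and $C''_{i,i'}$ the $\mathcal C_2$-part of $S'(i,i')$. **Algorithm 2.** Put $w=\lfloor 1/\varepsilon\rfloor$. Build the bipartite graph $G$ between the positions of $S$ and those of $S'$ as follows: for each block $S'(i)$, each $j\in \mathrm{Dec}_1(C'_i)$, each block $k\in[j-w,j+w]$, each $i'\in[1,N_1/N_2]$, each $j'\in \mathrm{Dec}_2(C''_{i,i'})$ and each sub-block $k'\in[j'-w,j'+w]$, connect all pairs of positions of $S(k,k')$ and $S'(i,i')$ that hold identical symbols. Return a largest non-crossing matching of $G$, that is, a largest set of edges $(p_1,q_1),\dots,(p_l,q_l)$ of $G$ with $p_1<\dots<p_l$ and $q_1<\dots<q_l$. **Theorem.** Algorithm 2 can be implemented to run in $$O\!\left(\frac{n}{N_1}\,T_{\mathrm{Dec}_1}(N_1)+\frac{n}{N_2}\,T_{\mathrm{Dec}_2}(N_2)+\frac{N_2L_1L_2}{\varepsilon^2}\;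 n\log\log n\right)$$ time, and its graph $G$ has $O\!\left(\frac{N_2L_1L_2}{\varepsilon^2}\,n\right)$ edges, with absolute constants in both bounds. More precisely: there is one fixed word-RAM program, with zero-initialised memory, with words of $O(\log (nL_1L_2))$ bits, and with the two decoders as subroutines (a call costs the running time of the decoder plus $O(1)$), which on every such input $(S,S',N_1,N_2,w)$ halts within this time and outputs a largest non-crossing matching of $G$. Symbols of the strings are single memory cells that are compared in one step. -/

import Mathlib

/-! ## Insertion-deletion codes, list decoders, and the two-layer indexing string

Symbols of all alphabets are encoded as natural numbers. All positions are counted from 0. -/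

/-- A code of block length `N`, with its codewords listed in a fixed order. -/
structure InsDelCode (N : ℕ) where
  size : ℕ
  word : Fin size → Fin N → ℕ
  injective : Function.Injective word

/-- The codeword number `j`, as a string. -/
def InsDelCode.codeword {N : ℕ} (C : InsDelCode N) (j : Fin C.size) : List ℕ :=
  List.ofFn (C.word j)

/-- All codewords written back to back. -/
def InsDelCode.concat {N : ℕ} (C : InsDelCode N) : List ℕ :=
  (List.finRange C.size).flatMap C.codeword

/-- `x` can be turned into `y` by at most `d` deletions and at most `d` insertions:
`z` is what is left of `x` after the deletions. -/
def Reachable (d : ℝ) (x y : List ℕ) : Prop :=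
  ∃ z : List ℕ, z.Sublist x ∧ z.Sublist y ∧
    (x.length : ℝ) - z.length ≤ d ∧ (y.length : ℝ) - z.length ≤ d

/-- A (black-box) decoding procedure for `C`: it maps a string to a list of (numbers of)
codewords, and takes `time y` steps on the string `y`. -/
structure Decoder {N : ℕ} (C : InsDelCode N) where
  out : List ℕ → List (Fin C.size)
  time : List ℕ → ℕ

/-- `D` is an `L`-list decoder of `C` from any `N(1-ε)` deletions and `N(1-ε)` insertions. -/
def Decoder.IsListDecoder {N : ℕ} {C : InsDelCode N} (D : Decoder C) (ε : ℝ) (L : ℕ) : Prop :=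
  ∀ y : List ℕ, (D.out y).length ≤ L ∧
    ∀ j : Fin C.size, Reachable (N * (1 - ε)) (C.codeword j) y → j ∈ D.out y

/-- The two-layer indexing string: the concatenated codewords of `C₁`, indexed symbol by symbol
with `C₁.size` repetitions of the concatenated codewords of `C₂`. -/
def indexString {N₁ N₂ : ℕ} (C₁ : InsDelCode N₁) (C₂ : InsDelCode N₂) : List (ℕ × ℕ) :=
  C₁.concat.zip (List.replicate C₁.size C₂.concat).flatten

/-- A symbol `(m, c₁, c₂)`: content symbol and the two index symbols. -/
abbrev IndexedSym := ℕ × (ℕ × ℕ)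

/-! ## The graph built by the algorithm, and its output -/

/-- The `k < count` with `k ∈ [j - w, j + w]`. -/
def window (count w j : ℕ) : List ℕ :=
  (List.range count).filter fun k => j ≤ k + w ∧ k ≤ j + w

/-- Number of blocks of length `N` (the last one may be shorter) of a string of length `l`. -/
def numBlocks (l N : ℕ) : ℕ := (l + N - 1) / N

/-- Pairs of positions holding identical symbols in the length-`N` substrings of `S` and `S'`
that begin at `p` and `q` (cut off at the ends of the strings). -/
def identicalPairs (S S' : List IndexedSym) (N p q : ℕ) : List (ℕ × ℕ) :=
  ((List.range N).product (List.range N)).filterMap fun ab =>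
    if p + ab.1 < S.length ∧ q + ab.2 < S'.length ∧ S[p + ab.1]? = S'[q + ab.2]? then
      some (p + ab.1, q + ab.2)
    else none

/-- The `C₁` part of block `i` of `S'`. -/
def block₁ (S' : List IndexedSym) (N₁ i : ℕ) : List ℕ :=
  ((S'.drop (i * N₁)).take N₁).map fun x => x.2.1

/-- The `C₂` part of sub-block `i'` of block `i` of `S'`. -/
def block₂ (S' : List IndexedSym) (N₁ N₂ i i' : ℕ) : List ℕ :=
  ((S'.drop (i * N₁ + i' * N₂)).take N₂).map fun x => x.2.2

/-- The edges connected by the nested loops of the algorithm (with repetitions). The edge `(p, q)`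
joins position `p` of `S` to position `q` of `S'`. -/
def edgeList {N₁ N₂ : ℕ} {C₁ : InsDelCode N₁} {C₂ : InsDelCode N₂}
    (D₁ : Decoder C₁) (D₂ : Decoder C₂) (w : ℕ) (S S' : List IndexedSym) : List (ℕ × ℕ) :=
  (List.range (numBlocks S'.length N₁)).flatMap fun i =>
    (D₁.out (block₁ S' N₁ i)).flatMap fun j =>
      (window (numBlocks S.length N₁) w j).flatMap fun k =>
        (List.range (N₁ / N₂)).flatMap fun i' =>
          (D₂.out (block₂ S' N₁ N₂ i i')).flatMap fun j' =>
            (window (N₁ / N₂) w j').flatMap fun k' =>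
              identicalPairs S S' N₂ (k * N₁ + k' * N₂) (i * N₁ + i' * N₂)

/-- The bipartite graph `G` of the algorithm, as its set of edges. -/
def matchingGraph {N₁ N₂ : ℕ} {C₁ : InsDelCode N₁} {C₂ : InsDelCode N₂}
    (D₁ : Decoder C₁) (D₂ : Decoder C₂) (w : ℕ) (S S' : List IndexedSym) : Finset (ℕ × ℕ) :=
  (edgeList D₁ D₂ w S S').toFinset

/-- A non-crossing matching in `G`, listed from left to right. -/
def IsNonCrossing (G : Finset (ℕ × ℕ)) (M : List (ℕ × ℕ)) : Prop :=
  (∀ e ∈ M, e ∈ G) ∧ M.Pairwise fun e f => e.1 < f.1 ∧ e.2 < f.2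

def IsLargestNonCrossing (G : Finset (ℕ × ℕ)) (M : List (ℕ × ℕ)) : Prop :=
  IsNonCrossing G M ∧ ∀ M', IsNonCrossing G M' → M'.length ≤ M.length

/-! ## The machine model: a word RAM with two decoding subroutines

A program is a structured program over registers and finitely many arrays (register and array names
are fixed in the program text). Every operation costs one step, a call of a decoder costs the time of
the decoder on the string it is called on (plus one). Every value that the program stores has to be
smaller than the word bound. -/

structure Store where
  reg : ℕ → ℕ
  arr : ℕ → ℕ → ℕ

inductive Expr where
  | lit (v : ℕ)
  | reg (r : ℕ)
  | read (a : ℕ) (i : Expr)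
  | plus (e f : Expr)
  | minus (e f : Expr)
  | times (e f : Expr)
  | quot (e f : Expr)
  | rem (e f : Expr)
  | less (e f : Expr)
  | equal (e f : Expr)

/-- Value of an expression: `minus` is truncated subtraction, `quot` and `rem` are integer
division, comparisons give 1 or 0. -/
def Expr.eval (s : Store) : Expr → ℕ
  | .lit v => v
  | .reg r => s.reg r
  | .read a i => s.arr a (i.eval s)
  | .plus e f => e.eval s + f.eval s
  | .minus e f => e.eval s - f.eval s
  | .times e f => e.eval s * f.eval s
  | .quot e f => e.eval s / f.eval s
  | .rem e f => e.eval s % f.eval s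
  | .less e f => if e.eval s < f.eval s then 1 else 0
  | .equal e f => if e.eval s = f.eval s then 1 else 0

/-- Number of steps for evaluating an expression: the number of its nodes. -/
def Expr.cost : Expr → ℕ
  | .lit _ => 1
  | .reg _ => 1
  | .read _ i => i.cost + 1
  | .plus e f => e.cost + f.cost + 1
  | .minus e f => e.cost + f.cost + 1
  | .times e f => e.cost + f.cost + 1
  | .quot e f => e.cost + f.cost + 1
  | .rem e f => e.cost + f.cost + 1
  | .less e f => e.cost + f.cost + 1
  | .equal e f => e.cost + f.cost + 1

inductive Cmd where
  /-- do nothing -/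
  | skip
  /-- `r := e` -/
  | assign (r : ℕ) (e : Expr)
  /-- `a[i] := e` -/
  | write (a : ℕ) (i e : Expr)
  | seq (c d : Cmd)
  /-- branch on `e ≠ 0` -/
  | branch (e : Expr) (c d : Cmd)
  /-- repeat `c` while `e ≠ 0` -/
  | loop (e : Expr) (c : Cmd)
  /-- Call the first (`second = false`) or the second (`second = true`) decoder on the `len` cells
  of array `src` that begin at `start`; the resulting list is put at the beginning of array `dst`
  and its length into register `r`. -/
  | decode (second : Bool) (src : ℕ) (start len : Expr) (dst r : ℕ)

/-- The subroutines available to a program: results and running times. -/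
structure Subroutines where
  out : Bool → List ℕ → List ℕ
  time : Bool → List ℕ → ℕ

def Decoder.subroutines {N₁ N₂ : ℕ} {C₁ : InsDelCode N₁} {C₂ : InsDelCode N₂}
    (D₁ : Decoder C₁) (D₂ : Decoder C₂) : Subroutines where
  out b y := if b then (D₂.out y).map Fin.val else (D₁.out y).map Fin.val
  time b y := if b then D₂.time y else D₁.time y

def Store.setReg (s : Store) (r v : ℕ) : Store :=
  { s with reg := Function.update s.reg r v }

def Store.setCell (s : Store) (a i v : ℕ) : Store :=
  { s with arr := Function.update s.arr a (Function.update (s.arr a) i v) }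

/-- Put the list `l` at the beginning of array `a`. -/
def Store.setList (s : Store) (a : ℕ) (l : List ℕ) : Store :=
  { s with arr := Function.update s.arr a fun i => (l[i]?).getD (s.arr a i) }

/-- The string in the `len` cells of array `a` that begin at `start`. -/
def Store.segment (s : Store) (a start len : ℕ) : List ℕ :=
  (List.range len).map fun i => s.arr a (start + i)

/-- `Exec D B P s t s'`: with subroutines `D` and word bound `B`, the program `P` started in the
store `s` halts after exactly `t` steps in the store `s'`. -/
inductive Exec (D : Subroutines) (B : ℕ) : Cmd → Store → ℕ → Store → Prop where
  | skip (s : Store) : Exec D B .skip s 1 s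
  | assign (s : Store) (r : ℕ) (e : Expr) (h : e.eval s < B) :
      Exec D B (.assign r e) s (e.cost + 1) (s.setReg r (e.eval s))
  | write (s : Store) (a : ℕ) (i e : Expr) (hi : i.eval s < B) (h : e.eval s < B) :
      Exec D B (.write a i e) s (i.cost + e.cost + 1) (s.setCell a (i.eval s) (e.eval s))
  | seq {c d : Cmd} {s s₁ s₂ : Store} {t₁ t₂ : ℕ} (h₁ : Exec D B c s t₁ s₁)
      (h₂ : Exec D B d s₁ t₂ s₂) : Exec D B (.seq c d) s (t₁ + t₂) s₂
  | branch_true {e : Expr} {c d : Cmd} {s s₁ : Store} {t : ℕ} (h : e.eval s ≠ 0)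
      (h₁ : Exec D B c s t s₁) : Exec D B (.branch e c d) s (e.cost + t + 1) s₁
  | branch_false {e : Expr} {c d : Cmd} {s s₁ : Store} {t : ℕ} (h : e.eval s = 0)
      (h₁ : Exec D B d s t s₁) : Exec D B (.branch e c d) s (e.cost + t + 1) s₁
  | loop_true {e : Expr} {c : Cmd} {s s₁ s₂ : Store} {t₁ t₂ : ℕ} (h : e.eval s ≠ 0)
      (h₁ : Exec D B c s t₁ s₁) (h₂ : Exec D B (.loop e c) s₁ t₂ s₂) :
      Exec D B (.loop e c) s (e.cost + t₁ + t₂ + 1) s₂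
  | loop_false {e : Expr} {c : Cmd} {s : Store} (h : e.eval s = 0) :
      Exec D B (.loop e c) s (e.cost + 1) s
  | decode (s : Store) (b : Bool) (src : ℕ) (start len : Expr) (dst r : ℕ) (y : List ℕ)
      (hy : y = s.segment src (start.eval s) (len.eval s)) :
      Exec D B (.decode b src start len dst r) s (start.cost + len.cost + D.time b y + 1)
        ((s.setList dst (D.out b y)).setReg r (D.out b y).length)

/-- The input `(S, S', N₁, N₂, w)`: registers 0 to 4 hold the two lengths and the three
parameters, arrays 0, 1, 2 and 3, 4, 5 hold the three components of the symbols of the two strings,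
everything else is 0. -/
def inputStore (S S' : List IndexedSym) (N₁ N₂ w : ℕ) : Store where
  reg
    | 0 => S.length
    | 1 => S'.length
    | 2 => N₁
    | 3 => N₂
    | 4 => w
    | _ => 0
  arr a p :=
    match a with
    | 0 => (S.getD p (0, 0, 0)).1
    | 1 => (S.getD p (0, 0, 0)).2.1
    | 2 => (S.getD p (0, 0, 0)).2.2
    | 3 => (S'.getD p (0, 0, 0)).1
    | 4 => (S'.getD p (0, 0, 0)).2.1
    | 5 => (S'.getD p (0, 0, 0)).2.2
    | _ => 0

/-- The output: a list of pairs, its length in register 0, the pairs in arrays 6 and 7. -/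
def Store.output (s : Store) : List (ℕ × ℕ) :=
  (List.range (s.reg 0)).map fun i => (s.arr 6 i, s.arr 7 i)

/-!
The program sweeps over the positions `q` of the second string from left to right. Since the
decoders are called once for each block and once for each sub-block, the neighbours of `q` in the
graph (its *row*) can be enumerated directly by the nested loops of the algorithm, in time
proportional to `L₁ * (2 * w + 1) * L₂ * (2 * w + 1) * N₂`. As `1 ≤ w ≤ 1 / ε`, this is at most
`9 * N₂ * L₁ * L₂ / ε ^ 2`. Summing over the rows gives the bound for the number of edges, for which
the edge list has to be reordered by the positions of the second string (`mem_matchingGraph`).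

A largest non-crossing matching is a longest chain of edges that increases in both coordinates. As
in the algorithm of Hunt and Szymanski, the *threshold* `T k` is the least `p` such that the edges
seen so far contain a chain of length `k` whose first coordinates are at most `p`. The thresholds
increase with `k`. A new edge `(p, q)` can only lower the threshold for the least `f` with
`p ≤ T f` (or add a new threshold, if there is no such `f`), by extending the chain for `f - 1`.
All these `f` are determined before a row changes any threshold, because edges of the same row must not
follow each other. That the thresholds remain optimal is `ThresholdsOptimal.add_row`. Chains are
kept as linked records, which are never overwritten (`Thresholds`, `readChain`), so a matching of
largest size can be read off in the end (`wp_writeMatching`).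

The number `f` is found by a successor query in a van Emde Boas tree that holds the thresholds, in
time `O(log (log n))`. This is also the time of an insertion or a deletion. The tree used here
stores neither the minimum nor the maximum of a node in its children, so that each operation makes
only one recursive call, as its last step (`vebStep_insert`, `vebStep_delete`); a successor query
goes down and then up again (`wp_vebSucc`). The empty tree is represented by zeros, so nothing has
to be initialised but the table of the universe sizes. Its height is the least `lam` with
`S.length ≤ 2 ^ 2 ^ lam`, hence `O(log (log n))` (`exists_height_le`).

Running times and the correctness of programs are derived with weakest preconditions (`WP`,
`wp_for`).
-/

/-! ### Weakest preconditions for the word RAM -/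

infixr:60 " ;; " => Cmd.seq

/-- Total correctness with time: `c`, started in `s`, halts after some number `t` of steps in some
store `s'` with `Q t s'`. -/
def WP (D : Subroutines) (B : ℕ) (c : Cmd) (s : Store) (Q : ℕ → Store → Prop) : Prop :=
  ∃ t s', Exec D B c s t s' ∧ Q t s'

section Rules

variable {D : Subroutines} {B : ℕ} {s : Store} {Q : ℕ → Store → Prop}

theorem WP.mono {c : Cmd} {Q' : ℕ → Store → Prop} (h : WP D B c s Q)
    (hQ : ∀ t s', Q t s' → Q' t s') : WP D B c s Q' :=
  let ⟨t, s', he, hq⟩ := h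
  ⟨t, s', he, hQ t s' hq⟩

theorem wp_skip : WP D B .skip s Q ↔ Q 1 s :=
  ⟨fun ⟨_, _, h, hq⟩ => by cases h; exact hq, fun h => ⟨_, _, .skip s, h⟩⟩

theorem wp_assign {r : ℕ} {e : Expr} :
    WP D B (.assign r e) s Q ↔ e.eval s < B ∧ Q (e.cost + 1) (s.setReg r (e.eval s)) :=
  ⟨fun ⟨_, _, h, hq⟩ => by cases h with | assign _ _ _ hb => exact ⟨hb, hq⟩,
    fun h => ⟨_, _, .assign s r e h.1, h.2⟩⟩

theorem wp_write {a : ℕ} {i e : Expr} :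
    WP D B (.write a i e) s Q ↔ i.eval s < B ∧ e.eval s < B ∧
      Q (i.cost + e.cost + 1) (s.setCell a (i.eval s) (e.eval s)) :=
  ⟨fun ⟨_, _, h, hq⟩ => by cases h with | write _ _ _ _ hi hb => exact ⟨hi, hb, hq⟩,
    fun h => ⟨_, _, .write s a i e h.1 h.2.1, h.2.2⟩⟩

theorem wp_seq {c d : Cmd} :
    WP D B (c ;; d) s Q ↔
      WP D B c s fun t₁ s₁ => WP D B d s₁ fun t₂ s₂ => Q (t₁ + t₂) s₂ := by
  constructor
  · rintro ⟨_, _, h, hq⟩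
    cases h with
    | seq h₁ h₂ => exact ⟨_, _, h₁, _, _, h₂, hq⟩
  · rintro ⟨_, _, h₁, _, _, h₂, hq⟩
    exact ⟨_, _, .seq h₁ h₂, hq⟩

theorem wp_branch {e : Expr} {c d : Cmd} :
    WP D B (.branch e c d) s Q ↔
      (e.eval s ≠ 0 → WP D B c s fun t s' => Q (e.cost + t + 1) s') ∧
      (e.eval s = 0 → WP D B d s fun t s' => Q (e.cost + t + 1) s') := by
  constructor
  · rintro ⟨_, _, h, hq⟩
    cases h with
    | branch_true h h₁ => exact ⟨fun _ => ⟨_, _, h₁, hq⟩, fun h' => absurd h' h⟩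
    | branch_false h h₁ => exact ⟨fun h' => absurd h h', fun _ => ⟨_, _, h₁, hq⟩⟩
  · rintro ⟨h₁, h₂⟩
    by_cases h : e.eval s = 0
    · obtain ⟨_, _, he, hq⟩ := h₂ h
      exact ⟨_, _, .branch_false h he, hq⟩
    · obtain ⟨_, _, he, hq⟩ := h₁ h
      exact ⟨_, _, .branch_true h he, hq⟩

theorem wp_loop_true {e : Expr} {c : Cmd} (h : e.eval s ≠ 0)
    (hc : WP D B c s fun t₁ s₁ =>
      WP D B (.loop e c) s₁ fun t₂ s₂ => Q (e.cost + t₁ + t₂ + 1) s₂) :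
    WP D B (.loop e c) s Q := by
  obtain ⟨_, _, h₁, _, _, h₂, hq⟩ := hc
  exact ⟨_, _, .loop_true h h₁ h₂, hq⟩

theorem wp_loop_false {e : Expr} {c : Cmd} (h : e.eval s = 0) (hq : Q (e.cost + 1) s) :
    WP D B (.loop e c) s Q :=
  ⟨_, _, .loop_false h, hq⟩

theorem wp_decode {b : Bool} {src dst r : ℕ} {start len : Expr} (y : List ℕ)
    (hy : y = s.segment src (start.eval s) (len.eval s))
    (hq : Q (start.cost + len.cost + D.time b y + 1)
      ((s.setList dst (D.out b y)).setReg r (D.out b y).length)) :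
    WP D B (.decode b src start len dst r) s Q :=
  ⟨_, _, .decode s b src start len dst r y hy, hq⟩

end Rules

section Store

variable (s : Store)

@[simp] theorem Store.setReg_reg (r v r' : ℕ) :
    (s.setReg r v).reg r' = if r' = r then v else s.reg r' := by
  simp [Store.setReg, Function.update_apply]

@[simp] theorem Store.setReg_arr (r v : ℕ) : (s.setReg r v).arr = s.arr := rfl

@[simp] theorem Store.setCell_reg (a i v : ℕ) : (s.setCell a i v).reg = s.reg := rfl

@[simp] theorem Store.setCell_arr (a i v a' : ℕ) :
    (s.setCell a i v).arr a' = if a' = a then Function.update (s.arr a) i v else s.arr a' := by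
  simp [Store.setCell, Function.update_apply]

@[simp] theorem Store.setList_reg (a : ℕ) (l : List ℕ) : (s.setList a l).reg = s.reg := rfl

@[simp] theorem Store.setList_arr (a : ℕ) (l : List ℕ) (a' : ℕ) :
    (s.setList a l).arr a' = if a' = a then fun i => (l[i]?).getD (s.arr a i) else s.arr a' := by
  simp [Store.setList, Function.update_apply]

end Store

/-- The smaller one of two values, by truncated subtraction. -/
def Expr.min (e f : Expr) : Expr := .minus e (.minus e f)

@[simp] theorem Expr.eval_min (s : Store) (e f : Expr) :
    (Expr.min e f).eval s = Min.min (e.eval s) (f.eval s) := by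
  simp only [Expr.min, Expr.eval]; omega

/-- `for r := lo, …, hi - 1 do c` -/
def Cmd.for (r : ℕ) (lo hi : Expr) (c : Cmd) : Cmd :=
  .assign r lo ;; .loop (.less (.reg r) hi) (c ;; .assign r (.plus (.reg r) (.lit 1)))

/-- The rule for counting loops, with invariant `I x` before round `x`. -/
theorem wp_for {D : Subroutines} {B : ℕ} {s : Store} {r : ℕ} {lo hi : Expr} {c : Cmd} {a b T : ℕ}
    (I : ℕ → Store → Prop) (hlo : lo.eval s = a) (hab : a ≤ b) (hB : b < B)
    (h0 : I a (s.setReg r a))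
    (hI : ∀ x s', I x s' → s'.reg r = x ∧ hi.eval s' = b)
    (hc : ∀ x s', a ≤ x → x < b → I x s' →
      WP D B c s' fun t s'' => t ≤ T ∧ s''.reg r = x ∧ I (x + 1) (s''.setReg r (x + 1))) :
    WP D B (.for r lo hi c) s fun t s' =>
      t ≤ (b - a) * (T + hi.cost + 7) + lo.cost + hi.cost + 4 ∧ I b s' := by
  have key : ∀ k x s', b - x = k → a ≤ x → x ≤ b → I x s' →
      WP D B (.loop (.less (.reg r) hi) (c ;; .assign r (.plus (.reg r) (.lit 1)))) s'
        fun t s'' => t ≤ k * (T + hi.cost + 7) + hi.cost + 3 ∧ I b s'' := by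
    intro k
    induction k with
    | zero =>
      intro x s' hk hax hxb hs
      obtain rfl : x = b := by omega
      refine wp_loop_false ?_ ⟨?_, hs⟩
      · simp [Expr.eval, hI x s' hs]
      · simp only [Expr.cost]; omega
    | succ k ih =>
      intro x s' hk hax hxb hs
      refine wp_loop_true ?_ ?_
      · have : x < b := by omega
        simp [Expr.eval, hI x s' hs, this]
      · rw [wp_seq]
        refine (hc x s' hax (by omega) hs).mono fun t s₁ ⟨ht, hr, hs₁⟩ => ?_
        rw [wp_assign]
        refine ⟨by simp only [Expr.eval, hr]; omega, ?_⟩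
        simp only [Expr.eval, hr]
        refine (ih (x + 1) _ (by omega) (by omega) (by omega) hs₁).mono fun t' s₂ ⟨ht', hs₂⟩ => ?_
        refine ⟨?_, hs₂⟩
        simp only [Expr.cost, Nat.succ_mul]
        omega
  rw [Cmd.for, wp_seq, wp_assign, hlo]
  refine ⟨by omega, (key _ a _ rfl le_rfl hab h0).mono fun t s' ⟨ht, hs'⟩ => ⟨?_, hs'⟩⟩
  omega

/-- Nested counting loops that collect a list: `P acc s` says that `s` has collected `acc`. The loop
body may change registers above the loop register only, and those of them that `P` depends on. -/
theorem wp_for_flatMap {α : Type*} {D : Subroutines} {B : ℕ} {s : Store} {r : ℕ} {lo hi : Expr}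
    {c : Cmd} {a b T : ℕ} (P : List α → Store → Prop) (F : ℕ → List α) {acc₀ : List α}
    (hP : ∀ acc s v, P acc s → P acc (s.setReg r v))
    (hs : P acc₀ s) (hlo : lo.eval s = a) (hab : a ≤ b) (hB : b < B)
    (hhi : ∀ acc s', P acc s' → (∀ r' < r, s'.reg r' = s.reg r') → hi.eval s' = b)
    (hc : ∀ x acc s', a ≤ x → x < b → P acc s' → s'.reg r = x →
      (∀ r' < r, s'.reg r' = s.reg r') → acc ++ F x <+: acc₀ ++ (List.Ico a b).flatMap F →
      WP D B c s' fun t s'' => t ≤ T ∧ P (acc ++ F x) s'' ∧ ∀ r' ≤ r, s''.reg r' = s'.reg r') :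
    WP D B (.for r lo hi c) s fun t s' =>
      t ≤ (b - a) * (T + hi.cost + 7) + lo.cost + hi.cost + 4 ∧
      P (acc₀ ++ (List.Ico a b).flatMap F) s' ∧ ∀ r' < r, s'.reg r' = s.reg r' := by
  refine (wp_for (a := a) (b := b) (T := T) (fun x s' => P (acc₀ ++ (List.Ico a x).flatMap F) s' ∧
    (∀ r' < r, s'.reg r' = s.reg r') ∧ s'.reg r = x ∧ (a ≤ x)) hlo hab hB ?_ ?_ ?_).mono ?_
  · refine ⟨by simpa using hP _ _ _ hs, fun r' h => ?_, by simp, le_rfl⟩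
    rw [Store.setReg_reg, if_neg h.ne]
  · exact fun x s' ⟨h₁, h₂, h₃, _⟩ => ⟨h₃, hhi _ _ h₁ h₂⟩
  · rintro x s' hax hxb ⟨h₁, h₂, h₃, _⟩
    have hpre : acc₀ ++ (List.Ico a x).flatMap F ++ F x <+: acc₀ ++ (List.Ico a b).flatMap F := by
      rw [← List.Ico.append_consecutive hax hxb.le, List.flatMap_append, ← List.append_assoc,
        List.Ico.eq_cons hxb, List.flatMap_cons, ← List.append_assoc]
      exact List.prefix_append _ _
    refine (hc x _ s' hax hxb h₁ h₃ h₂ hpre).mono fun t s'' ⟨ht, hp, hr⟩ =>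
      ⟨ht, by rw [hr r le_rfl, h₃], ?_, fun r' h => ?_, by simp, by omega⟩
    · rw [List.Ico.succ_top hax, List.flatMap_append, ← List.append_assoc]
      simpa using hP _ _ _ hp
    · rw [Store.setReg_reg, if_neg h.ne, hr r' h.le, h₂ r' h]
  · exact fun t s' ⟨ht, h₁, h₂, _⟩ => ⟨ht, h₁, h₂⟩

/-! ### Van Emde Boas trees -/

/-- The universe size of a van Emde Boas tree with `l + 1` levels. -/
def vebSize (l : ℕ) : ℕ := 2 ^ 2 ^ l

theorem vebSize_succ (l : ℕ) : vebSize (l + 1) = vebSize l * vebSize l := by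
  rw [vebSize, vebSize, pow_succ, mul_two, pow_add]

theorem two_le_vebSize (l : ℕ) : 2 ≤ vebSize l := by
  calc 2 = 2 ^ 1 := rfl
    _ ≤ 2 ^ 2 ^ l := Nat.pow_le_pow_right (by norm_num) Nat.one_le_two_pow

theorem vebSize_mono {k l : ℕ} (h : k ≤ l) : vebSize k ≤ vebSize l :=
  Nat.pow_le_pow_right (by norm_num) (Nat.pow_le_pow_right (by norm_num) h)

theorem lt_vebSize (l : ℕ) : l < vebSize l :=
  Nat.lt_two_pow_self.trans Nat.lt_two_pow_self

/-- Number of the `c`-th child of node number `i` on level `l + 1`: the children `c < vebSize l` are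
the clusters, and the last one, `c = vebSize l`, is the summary. -/
def vebChild (l i c : ℕ) : ℕ := i * (vebSize l + 1) + c

/-- Node `j` on level `k` belongs to the subtree of node `i` on level `l`. A node on level `l` is
identified with the `i`-th interval of length `vebSize l - 1`, which is the disjoint union of the
intervals of its `vebSize (l - 1) + 1` children. -/
def VebSub (l i k j : ℕ) : Prop :=
  k ≤ l ∧ i * (vebSize l - 1) ≤ j * (vebSize k - 1) ∧
    (j + 1) * (vebSize k - 1) ≤ (i + 1) * (vebSize l - 1)

theorem VebSub.refl (l i : ℕ) : VebSub l i l i := ⟨le_rfl, le_rfl, le_rfl⟩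

theorem VebSub.trans {l i k j k' j' : ℕ} (h : VebSub l i k j) (h' : VebSub k j k' j') :
    VebSub l i k' j' :=
  ⟨h'.1.trans h.1, h.2.1.trans h'.2.1, h'.2.2.trans h.2.2⟩

theorem vebSub_child {l i c : ℕ} (hc : c ≤ vebSize l) :
    VebSub (l + 1) i l (vebChild l i c) := by
  obtain ⟨v, hv⟩ : ∃ v, vebSize l = v + 1 := ⟨vebSize l - 1, by have := two_le_vebSize l; omega⟩
  have e : vebSize (l + 1) - 1 = (v + 2) * v := by
    rw [vebSize_succ, hv]
    have : (v + 1) * (v + 1) = (v + 2) * v + 1 := by ring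
    omega
  refine ⟨Nat.le_succ l, ?_, ?_⟩ <;> rw [e, vebChild, hv, Nat.add_sub_cancel, ← mul_assoc]
  · exact Nat.mul_le_mul_right v (Nat.le_add_right _ _)
  · gcongr; rw [hv] at hc; linarith

theorem VebSub.inj {l i i' k j : ℕ} (h : VebSub l i k j) (h' : VebSub l i' k j) : i = i' := by
  have hk := two_le_vebSize k
  have hl := two_le_vebSize l
  have aux : ∀ a b, VebSub l a k j → VebSub l b k j → a ≤ b := by
    intro a b ha hb
    have h1 : a * (vebSize l - 1) < (b + 1) * (vebSize l - 1) := by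
      refine ha.2.1.trans_lt (lt_of_lt_of_le ?_ hb.2.2)
      exact Nat.mul_lt_mul_of_pos_right (Nat.lt_succ_self j) (by omega)
    exact Nat.lt_succ_iff.1 (Nat.lt_of_mul_lt_mul_right h1)
  exact le_antisymm (aux _ _ h h') (aux _ _ h' h)

theorem VebSub.lt_vebSize {l k j : ℕ} (h : VebSub l 0 k j) : j < vebSize l := by
  have hk := two_le_vebSize k
  have hl := two_le_vebSize l
  have h2 := h.2.2
  have : (j + 1) * 1 ≤ (j + 1) * (vebSize k - 1) := Nat.mul_le_mul_left _ (by omega)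
  omega

theorem vebSub_child_inj {l i c c' k j : ℕ} (h : VebSub l (vebChild l i c) k j)
    (h' : VebSub l (vebChild l i c') k j) : c = c' := by
  simpa [vebChild] using h.inj h'

/-- The elements of `X` other than the least and the greatest one. -/
def innerPart (X : Set ℕ) : Set ℕ := {x | x ∈ X ∧ (∃ a ∈ X, a < x) ∧ ∃ b ∈ X, x < b}

/-- The lower halves of the elements of `Y` with upper half `h`. -/
def clusterSet (u : ℕ) (Y : Set ℕ) (h : ℕ) : Set ℕ := {l | l < u ∧ h * u + l ∈ Y}

/-- The upper halves of the elements of `Y`. -/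
def summarySet (u : ℕ) (Y : Set ℕ) : Set ℕ := {h | ∃ l < u, h * u + l ∈ Y}

/-- `mn` and `mx` hold the least and the greatest element of `X`, increased by 1, or 0 if `X` is
empty. -/
def VebEnds (mn mx : ℕ) (X : Set ℕ) : Prop :=
  (X = ∅ ∧ mn = 0 ∧ mx = 0) ∨
    ∃ a b, mn = a + 1 ∧ mx = b + 1 ∧ a ∈ X ∧ b ∈ X ∧ ∀ x ∈ X, a ≤ x ∧ x ≤ b

/-- The arrays `f` and `g` (of the increased minima and maxima of the nodes, node `i` on level `l`
having address `i * W + l`) hold a van Emde Boas tree for `X` in the subtree of node `i` on level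
`l`. In this variant neither the minimum nor the maximum of a node is stored in its children; this
makes both insertion and deletion tail-recursive. -/
def VebRep (W : ℕ) (f g : ℕ → ℕ) : ℕ → ℕ → Set ℕ → Prop
  | 0, i, X => (∀ x ∈ X, x < vebSize 0) ∧ VebEnds (f (i * W + 0)) (g (i * W + 0)) X
  | l + 1, i, X => (∀ x ∈ X, x < vebSize (l + 1)) ∧
      VebEnds (f (i * W + (l + 1))) (g (i * W + (l + 1))) X ∧
      (∀ h < vebSize l, VebRep W f g l (vebChild l i h) (clusterSet (vebSize l) (innerPart X) h)) ∧
      VebRep W f g l (vebChild l i (vebSize l)) (summarySet (vebSize l) (innerPart X))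

/-- The arrays `f` and `f'` agree at the nodes for which `p` holds. -/
def VebAgree (W : ℕ) (p : ℕ → ℕ → Prop) (f f' : ℕ → ℕ) : Prop :=
  ∀ k j, k < W → p k j → f' (j * W + k) = f (j * W + k)

section Rep

variable {W : ℕ} {f g f' g' : ℕ → ℕ} {l i : ℕ} {X X' : Set ℕ}

theorem VebRep.lt (h : VebRep W f g l i X) : ∀ x ∈ X, x < vebSize l := by
  cases l <;> exact h.1

theorem VebRep.ends (h : VebRep W f g l i X) :
    VebEnds (f (i * W + l)) (g (i * W + l)) X := by
  cases l
  · exact h.2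
  · exact h.2.1

theorem VebAgree.mono {p q : ℕ → ℕ → Prop} (h : VebAgree W p f f') (hpq : ∀ k j, q k j → p k j) :
    VebAgree W q f f' :=
  fun k j hk hq => h k j hk (hpq k j hq)

theorem VebAgree.trans {p : ℕ → ℕ → Prop} {f'' : ℕ → ℕ} (h : VebAgree W p f f')
    (h' : VebAgree W p f' f'') : VebAgree W p f f'' :=
  fun k j hk hq => (h' k j hk hq).trans (h k j hk hq)

theorem VebAgree.rfl {p : ℕ → ℕ → Prop} : VebAgree W p f f := fun _ _ _ _ => Eq.refl _

theorem vebAddr_inj {k j k' j' : ℕ} (hk : k < W) (hk' : k' < W) (h : j * W + k = j' * W + k') :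
    j = j' ∧ k = k' := by
  have h1 : (j * W + k) % W = (j' * W + k') % W := by rw [h]
  rw [Nat.mul_add_mod', Nat.mod_eq_of_lt hk, Nat.mul_add_mod', Nat.mod_eq_of_lt hk'] at h1
  subst h1
  exact ⟨Nat.eq_of_mul_eq_mul_right (by omega) (Nat.add_right_cancel h), Eq.refl _⟩

theorem VebAgree.update {p : ℕ → ℕ → Prop} {v : ℕ} (hl : l < W) (h : VebAgree W p f f')
    (hp : ¬ p l i) : VebAgree W p f (Function.update f' (i * W + l) v) := by
  intro k j hk hq
  rw [Function.update_of_ne, h k j hk hq]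
  intro e
  obtain ⟨rfl, rfl⟩ := vebAddr_inj hk hl e
  exact hp hq

theorem VebRep.congr (hl : l < W) (h : VebRep W f g l i X)
    (hf : VebAgree W (VebSub l i) f f') (hg : VebAgree W (VebSub l i) g g') :
    VebRep W f' g' l i X := by
  induction l generalizing i X with
  | zero =>
    refine ⟨h.1, ?_⟩
    rw [hf _ _ hl (.refl _ _), hg _ _ hl (.refl _ _)]
    exact h.2
  | succ l ih =>
    refine ⟨h.1, ?_, fun c hc => ?_, ?_⟩
    · rw [hf _ _ hl (.refl _ _), hg _ _ hl (.refl _ _)]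
      exact h.2.1
    · exact ih (by omega) (h.2.2.1 c hc) (hf.mono fun _ _ => (vebSub_child hc.le).trans)
        (hg.mono fun _ _ => (vebSub_child hc.le).trans)
    · exact ih (by omega) h.2.2.2 (hf.mono fun _ _ => (vebSub_child le_rfl).trans)
        (hg.mono fun _ _ => (vebSub_child le_rfl).trans)

theorem VebSub.not_parent {k j c : ℕ} (h : VebSub l (vebChild l i c) k j) :
    ¬(k = l + 1 ∧ j = i) := by
  rintro ⟨rfl, -⟩
  have := h.1
  omega

/-- If the inner part stays the same, then only the ends have to be updated. -/
theorem VebRep.of_inner_eq (hl : l < W) (h : VebRep W f g l i X) (hX : innerPart X' = innerPart X)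
    (hlt : ∀ x ∈ X', x < vebSize l) (he : VebEnds (f' (i * W + l)) (g' (i * W + l)) X')
    (hf : VebAgree W (fun k j => VebSub l i k j ∧ ¬(k = l ∧ j = i)) f f')
    (hg : VebAgree W (fun k j => VebSub l i k j ∧ ¬(k = l ∧ j = i)) g g') :
    VebRep W f' g' l i X' := by
  cases l with
  | zero => exact ⟨hlt, he⟩
  | succ l =>
    have aux : ∀ c ≤ vebSize l, ∀ k j, VebSub l (vebChild l i c) k j →
        VebSub (l + 1) i k j ∧ ¬(k = l + 1 ∧ j = i) :=
      fun c hc _ _ h => ⟨(vebSub_child hc).trans h, h.not_parent⟩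
    refine ⟨hlt, he, fun c hc => ?_, ?_⟩ <;> rw [hX]
    · exact (h.2.2.1 c hc).congr (by omega) (hf.mono (aux c hc.le)) (hg.mono (aux c hc.le))
    · exact h.2.2.2.congr (by omega) (hf.mono (aux _ le_rfl)) (hg.mono (aux _ le_rfl))

/-- The children of node `i` on level `l + 1` hold `Y`. -/
def VebKids (W : ℕ) (f g : ℕ → ℕ) (l i : ℕ) (Y : Set ℕ) : Prop :=
  (∀ h < vebSize l, VebRep W f g l (vebChild l i h) (clusterSet (vebSize l) Y h)) ∧
    VebRep W f g l (vebChild l i (vebSize l)) (summarySet (vebSize l) Y)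

/-- Node `j` on level `k` is a proper descendant of node `i` on level `l + 1`. -/
def VebBelow (l i k j : ℕ) : Prop := ∃ c ≤ vebSize l, VebSub l (vebChild l i c) k j

theorem VebBelow.not_self : ¬VebBelow l i (l + 1) i := by
  rintro ⟨c, -, h⟩
  exact h.not_parent ⟨rfl, rfl⟩

theorem VebBelow.vebSub {k j : ℕ} (h : VebBelow l i k j) : VebSub (l + 1) i k j :=
  let ⟨_, hc, h⟩ := h
  (vebSub_child hc).trans h

theorem VebKids.congr (hl : l + 1 < W) {Y : Set ℕ} (h : VebKids W f g l i Y)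
    (hf : VebAgree W (VebBelow l i) f f') (hg : VebAgree W (VebBelow l i) g g') :
    VebKids W f' g' l i Y :=
  ⟨fun c hc => (h.1 c hc).congr (by omega) (hf.mono fun _ _ h => ⟨c, hc.le, h⟩)
    (hg.mono fun _ _ h => ⟨c, hc.le, h⟩), h.2.congr (by omega)
    (hf.mono fun _ _ h => ⟨_, le_rfl, h⟩) (hg.mono fun _ _ h => ⟨_, le_rfl, h⟩)⟩

/-- A change in a single cluster, and maybe in the summary. -/
theorem VebKids.of_cluster {c : ℕ} {Y Y' : Set ℕ} (hl : l + 1 < W) (h : VebKids W f g l i Y)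
    (hc : ∀ h ≠ c, clusterSet (vebSize l) Y' h = clusterSet (vebSize l) Y h)
    (h₁ : VebRep W f' g' l (vebChild l i c) (clusterSet (vebSize l) Y' c))
    (h₂ : VebRep W f' g' l (vebChild l i (vebSize l)) (summarySet (vebSize l) Y'))
    (hf : ∀ h ≠ c, h ≠ vebSize l → VebAgree W (VebSub l (vebChild l i h)) f f')
    (hg : ∀ h ≠ c, h ≠ vebSize l → VebAgree W (VebSub l (vebChild l i h)) g g') :
    VebKids W f' g' l i Y' := by
  refine ⟨fun h' hh' => ?_, h₂⟩
  by_cases e : h' = c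
  · rw [e]; exact h₁
  · rw [hc h' e]
    exact (h.1 h' hh').congr (by omega) (hf _ e hh'.ne) (hg _ e hh'.ne)

end Rep

/-! ### Effect of insertions and deletions on inner parts, clusters and summaries -/

section Sets

variable {u h : ℕ} {X Y : Set ℕ} {x y a b : ℕ}

theorem innerPart_subset : innerPart X ⊆ X := fun _ h => h.1

theorem mem_innerPart (ha : a ∈ X) (hb : b ∈ X) (hab : ∀ x ∈ X, a ≤ x ∧ x ≤ b) :
    x ∈ innerPart X ↔ x ∈ X ∧ x ≠ a ∧ x ≠ b := by
  constructor
  · rintro ⟨hx, ⟨c, hc, hcx⟩, d, hd, hxd⟩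
    have := hab c hc
    have := hab d hd
    exact ⟨hx, by omega, by omega⟩
  · rintro ⟨hx, h1, h2⟩
    have := hab x hx
    exact ⟨hx, ⟨a, ha, by omega⟩, b, hb, by omega⟩

theorem innerPart_empty : innerPart ∅ = ∅ := by
  ext; simp [innerPart]

theorem innerPart_of_pair (h : ∀ x ∈ X, x = a ∨ x = b) : innerPart X = ∅ := by
  ext x
  simp only [innerPart, Set.mem_ofPred_eq, Set.mem_empty_iff_false, iff_false]
  rintro ⟨hx, ⟨c, hc, hcx⟩, d, hd, hxd⟩
  have := h x hx
  have := h c hc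
  have := h d hd
  omega

theorem mem_clusterSet_div (hu : 0 < u) : y % u ∈ clusterSet u Y (y / u) ↔ y ∈ Y := by
  simp [clusterSet, Nat.mod_lt _ hu, Nat.div_add_mod']

theorem eq_div_mod {l : ℕ} (hl : l < u) (e : h * u + l = y) : h = y / u ∧ l = y % u := by
  subst e
  constructor
  · rw [mul_comm, Nat.mul_add_div (by omega), Nat.div_eq_of_lt hl, add_zero]
  · rw [Nat.mul_add_mod', Nat.mod_eq_of_lt hl]

theorem mem_summarySet_iff : h ∈ summarySet u Y ↔ clusterSet u Y h ≠ ∅ := by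
  rw [← Set.nonempty_iff_ne_empty]; rfl

theorem clusterSet_insert (hu : 0 < u) :
    clusterSet u (insert y Y) (y / u) = insert (y % u) (clusterSet u Y (y / u)) := by
  ext l
  simp only [clusterSet, Set.mem_ofPred_eq, Set.mem_insert_iff]
  constructor
  · rintro ⟨hl, e | hY⟩
    · exact .inl (eq_div_mod hl e).2
    · exact .inr ⟨hl, hY⟩
  · rintro (rfl | hY)
    · exact ⟨Nat.mod_lt _ hu, .inl (Nat.div_add_mod' _ _)⟩
    · exact ⟨hY.1, .inr hY.2⟩

theorem clusterSet_insert_of_ne (hh : h ≠ y / u) :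
    clusterSet u (insert y Y) h = clusterSet u Y h := by
  ext l
  simp only [clusterSet, Set.mem_ofPred_eq, Set.mem_insert_iff]
  exact and_congr_right fun hl => or_iff_right fun e => hh (eq_div_mod hl e).1

theorem summarySet_insert (hu : 0 < u) :
    summarySet u (insert y Y) = insert (y / u) (summarySet u Y) := by
  ext h
  simp only [mem_summarySet_iff, Set.mem_insert_iff]
  by_cases e : h = y / u
  · subst e
    rw [clusterSet_insert hu]
    exact iff_of_true (Set.insert_nonempty _ _).ne_empty (.inl rfl)
  · rw [clusterSet_insert_of_ne e]; simp [e]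

theorem clusterSet_diff :
    clusterSet u (Y \ {y}) (y / u) = clusterSet u Y (y / u) \ {y % u} := by
  ext l
  simp only [clusterSet, Set.mem_ofPred_eq, Set.mem_sdiff, Set.mem_singleton_iff, and_assoc]
  refine and_congr_right fun hl => and_congr_right fun _ => not_congr ?_
  exact ⟨fun e => (eq_div_mod hl e).2, fun e => by rw [e, Nat.div_add_mod']⟩

theorem clusterSet_diff_of_ne (hh : h ≠ y / u) :
    clusterSet u (Y \ {y}) h = clusterSet u Y h := by
  ext l
  simp only [clusterSet, Set.mem_ofPred_eq, Set.mem_sdiff, Set.mem_singleton_iff]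
  exact and_congr_right fun hl => and_iff_left fun e => hh (eq_div_mod hl e).1

theorem summarySet_diff_of_singleton (hs : clusterSet u Y (y / u) = {y % u}) :
    summarySet u (Y \ {y}) = summarySet u Y \ {y / u} := by
  ext h
  simp only [mem_summarySet_iff, Set.mem_sdiff, Set.mem_singleton_iff]
  by_cases e : h = y / u
  · subst e; rw [clusterSet_diff, hs]; simp
  · rw [clusterSet_diff_of_ne e]; simp [e]

theorem summarySet_diff (hs : ∃ l ∈ clusterSet u Y (y / u), l ≠ y % u) :
    summarySet u (Y \ {y}) = summarySet u Y := by
  ext h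
  simp only [mem_summarySet_iff]
  by_cases e : h = y / u
  · subst e
    obtain ⟨l, hl, hne⟩ := hs
    rw [clusterSet_diff, ← Set.nonempty_iff_ne_empty, ← Set.nonempty_iff_ne_empty]
    exact iff_of_true ⟨l, hl, hne⟩ ⟨l, hl⟩
  · rw [clusterSet_diff_of_ne e]

theorem innerPart_insert_of_lt (ha : a ∈ X) (hb : b ∈ X) (hX : ∀ z ∈ X, a ≤ z ∧ z ≤ b)
    (hab : a ≠ b) (hx : x < a) : innerPart (insert x X) = insert a (innerPart X) := by
  ext z
  rw [mem_innerPart (a := x) (b := b) (.inl rfl) (.inr hb), Set.mem_insert_iff, Set.mem_insert_iff,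
    mem_innerPart ha hb hX]
  · by_cases hz : z = a
    · subst hz; simp [ha, hab, hx.ne']
    · refine ⟨fun h => .inr ⟨h.1.resolve_left h.2.1, hz, h.2.2⟩, fun h => ?_⟩
      have h := h.resolve_left hz
      have := hX z h.1
      exact ⟨.inr h.1, by omega, h.2.2⟩
  · rintro z (rfl | hz)
    · have := hX a ha; omega
    · have := hX z hz; omega

theorem innerPart_insert_of_gt (ha : a ∈ X) (hb : b ∈ X) (hX : ∀ z ∈ X, a ≤ z ∧ z ≤ b)
    (hab : a ≠ b) (hx : b < x) : innerPart (insert x X) = insert b (innerPart X) := by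
  ext z
  rw [mem_innerPart (a := a) (b := x) (.inr ha) (.inl rfl), Set.mem_insert_iff, Set.mem_insert_iff,
    mem_innerPart ha hb hX]
  · by_cases hz : z = b
    · subst hz; simp [hb, hab.symm, hx.ne]
    · refine ⟨fun h => .inr ⟨h.1.resolve_left h.2.2, h.2.1, hz⟩, fun h => ?_⟩
      have h := h.resolve_left hz
      have := hX z h.1
      exact ⟨.inr h.1, h.2.1, by omega⟩
  · rintro z (rfl | hz)
    · have := hX a ha; omega
    · have := hX z hz; omega

theorem innerPart_insert_of_between (ha : a ∈ X) (hb : b ∈ X) (hX : ∀ z ∈ X, a ≤ z ∧ z ≤ b)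
    (hax : a < x) (hxb : x < b) : innerPart (insert x X) = insert x (innerPart X) := by
  ext z
  rw [mem_innerPart (a := a) (b := b) (.inr ha) (.inr hb), Set.mem_insert_iff, Set.mem_insert_iff,
    mem_innerPart ha hb hX]
  · by_cases hz : z = x
    · subst hz; simp [hax.ne', hxb.ne]
    · simp [hz]
  · rintro z (rfl | hz)
    · omega
    · exact hX z hz

theorem innerPart_diff_min (ha : a ∈ X) (hb : b ∈ X) (hX : ∀ z ∈ X, a ≤ z ∧ z ≤ b)
    (hy : y ∈ innerPart X) (hmin : ∀ z ∈ innerPart X, y ≤ z) :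
    innerPart (X \ {a}) = innerPart X \ {y} := by
  have hI := fun z => mem_innerPart (x := z) ha hb hX
  obtain ⟨hyX, hya, hyb⟩ := (hI y).1 hy
  have h' : ∀ z ∈ X \ {a}, y ≤ z ∧ z ≤ b := by
    rintro z ⟨hz, hza⟩
    have := hX z hz
    have := hX y hyX
    refine ⟨?_, by omega⟩
    by_cases hzb : z = b
    · omega
    · exact hmin z ((hI z).2 ⟨hz, hza, hzb⟩)
  have := hX y hyX
  ext z
  rw [mem_innerPart (X := X \ {a}) (a := y) (b := b) ⟨hyX, hya⟩ ⟨hb, fun e => ?_⟩ h', Set.mem_sdiff,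
    Set.mem_sdiff, hI]
  · simp only [Set.mem_singleton_iff]; tauto
  · simp only [Set.mem_singleton_iff] at e; omega

theorem innerPart_diff_max (ha : a ∈ X) (hb : b ∈ X) (hX : ∀ z ∈ X, a ≤ z ∧ z ≤ b)
    (hy : y ∈ innerPart X) (hmax : ∀ z ∈ innerPart X, z ≤ y) :
    innerPart (X \ {b}) = innerPart X \ {y} := by
  have hI := fun z => mem_innerPart (x := z) ha hb hX
  obtain ⟨hyX, hya, hyb⟩ := (hI y).1 hy
  have h' : ∀ z ∈ X \ {b}, a ≤ z ∧ z ≤ y := by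
    rintro z ⟨hz, hzb⟩
    have := hX z hz
    have := hX y hyX
    refine ⟨by omega, ?_⟩
    by_cases hza : z = a
    · omega
    · exact hmax z ((hI z).2 ⟨hz, hza, hzb⟩)
  have := hX y hyX
  ext z
  rw [mem_innerPart (X := X \ {b}) (a := a) (b := y) ⟨ha, fun e => ?_⟩ ⟨hyX, hyb⟩ h', Set.mem_sdiff,
    Set.mem_sdiff, hI]
  · simp only [Set.mem_singleton_iff]; tauto
  · simp only [Set.mem_singleton_iff] at e; omega

theorem innerPart_diff_of_mem (ha : a ∈ X) (hb : b ∈ X) (hX : ∀ z ∈ X, a ≤ z ∧ z ≤ b)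
    (hy : y ∈ innerPart X) : innerPart (X \ {y}) = innerPart X \ {y} := by
  have hI := fun z => mem_innerPart (x := z) ha hb hX
  obtain ⟨hyX, hya, hyb⟩ := (hI y).1 hy
  ext z
  rw [mem_innerPart (X := X \ {y}) (a := a) (b := b) ⟨ha, Ne.symm hya⟩ ⟨hb, Ne.symm hyb⟩
    fun z hz => hX z hz.1, Set.mem_sdiff, Set.mem_sdiff, hI]
  tauto

end Sets

section Kids

variable {W l i : ℕ} {f g : ℕ → ℕ} {Y : Set ℕ}

theorem mem_summarySet_div {u y : ℕ} {Y : Set ℕ} (hu : 0 < u) (hy : y ∈ Y) :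
    y / u ∈ summarySet u Y :=
  ⟨y % u, Nat.mod_lt _ hu, by rwa [Nat.div_add_mod']⟩

theorem VebKids.summary_eq_zero_iff (h : VebKids W f g l i Y) :
    f (vebChild l i (vebSize l) * W + l) = 0 ↔ Y = ∅ := by
  have hu := two_le_vebSize l
  obtain ⟨hE, h0, -⟩ | ⟨a, b, ha, -, ⟨c, hc, haY⟩, -⟩ := h.2.ends
  · refine iff_of_true h0 (Set.eq_empty_of_forall_notMem fun y hy => ?_)
    have := mem_summarySet_div (u := vebSize l) (by omega) hy
    rw [hE] at this
    exact this
  · refine iff_of_false (by omega) ?_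
    rintro rfl
    exact haY

/-- The minimum of the children is the minimum of the cluster that the minimum of the summary points
to. -/
theorem VebKids.min (h : VebKids W f g l i Y) (hY : Y ≠ ∅) :
    ∃ a b, f (vebChild l i (vebSize l) * W + l) = a + 1 ∧ f (vebChild l i a * W + l) = b + 1 ∧
      a * vebSize l + b ∈ Y ∧ ∀ y ∈ Y, a * vebSize l + b ≤ y := by
  have hu := two_le_vebSize l
  have hz := mt h.summary_eq_zero_iff.1 hY
  obtain ⟨-, h0, -⟩ | ⟨a, _, ha, -, haS, -, hS⟩ := h.2.ends
  · exact absurd h0 hz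
  have hau := h.2.lt a haS
  obtain ⟨hE, -⟩ | ⟨b, _, hb, -, hbC, -, hC⟩ := (h.1 a hau).ends
  · exact absurd hE (mem_summarySet_iff.1 haS)
  refine ⟨a, b, ha, hb, hbC.2, fun y hy => ?_⟩
  have h1 := (hS _ (mem_summarySet_div (by omega) hy)).1
  have h2 := Nat.div_add_mod' y (vebSize l)
  obtain h1 | h1 := h1.lt_or_eq
  · have := Nat.mul_le_mul_right (vebSize l) (Nat.succ_le_of_lt h1)
    have := hbC.1
    rw [Nat.succ_mul] at *
    omega
  · subst h1
    have := (hC _ ((mem_clusterSet_div (by omega)).2 hy)).1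
    omega

/-- The maximum of the children is the maximum of the cluster that the maximum of the summary points
to. -/
theorem VebKids.max (h : VebKids W f g l i Y) (hY : Y ≠ ∅) :
    ∃ a b, g (vebChild l i (vebSize l) * W + l) = a + 1 ∧ g (vebChild l i a * W + l) = b + 1 ∧
      a * vebSize l + b ∈ Y ∧ ∀ y ∈ Y, y ≤ a * vebSize l + b := by
  have hu := two_le_vebSize l
  have hz := mt h.summary_eq_zero_iff.1 hY
  obtain ⟨-, h0, -⟩ | ⟨_, a, -, ha, -, haS, hS⟩ := h.2.ends
  · exact absurd h0 hz
  have hau := h.2.lt a haS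
  obtain ⟨hE, -⟩ | ⟨_, b, -, hb, -, hbC, hC⟩ := (h.1 a hau).ends
  · exact absurd hE (mem_summarySet_iff.1 haS)
  refine ⟨a, b, ha, hb, hbC.2, fun y hy => ?_⟩
  have h1 := (hS _ (mem_summarySet_div (by omega) hy)).2
  have h2 := Nat.div_add_mod' y (vebSize l)
  obtain h1 | h1 := h1.lt_or_eq
  · have := Nat.mul_le_mul_right (vebSize l) (Nat.succ_le_of_lt h1)
    have := Nat.mod_lt y (by omega : 0 < vebSize l)
    rw [Nat.succ_mul] at *
    omega
  · subst h1
    have := (hC _ ((mem_clusterSet_div (by omega)).2 hy)).2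
    omega

end Kids

/-! ### Insertion into van Emde Boas trees -/

/-- The registers and arrays that the van Emde Boas operations rely on: the level of the root, the
row length of the address space, and the table of the universe sizes. -/
structure VebEnv (B lam : ℕ) (s : Store) : Prop where
  top : s.reg 5 = lam
  width : s.reg 6 = lam + 1
  table : ∀ k ≤ lam, s.arr 8 k = vebSize k
  bound : vebSize lam * (lam + 1) < B

/-- The van Emde Boas operations change temporary registers and the arrays 11 and 12 only. -/
def VebFrame (s s' : Store) : Prop :=
  (∀ r < 40, s'.reg r = s.reg r) ∧ ∀ a, a ≠ 11 → a ≠ 12 → s'.arr a = s.arr a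

theorem VebFrame.trans {s s' s'' : Store} (h : VebFrame s s') (h' : VebFrame s' s'') :
    VebFrame s s'' :=
  ⟨fun r hr => (h'.1 r hr).trans (h.1 r hr), fun a h1 h2 => (h'.2 a h1 h2).trans (h.2 a h1 h2)⟩

theorem VebFrame.refl (s : Store) : VebFrame s s := ⟨fun _ _ => rfl, fun _ _ _ => rfl⟩

theorem VebFrame.setReg {s s' : Store} {r v : ℕ} (h : VebFrame s s') (hr : 40 ≤ r) :
    VebFrame s (s'.setReg r v) :=
  ⟨fun r' hr' => by rw [Store.setReg_reg, if_neg (by omega), h.1 r' hr'], h.2⟩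

theorem VebFrame.setCell {s s' : Store} {a j v : ℕ} (h : VebFrame s s') (ha : a = 11 ∨ a = 12) :
    VebFrame s (s'.setCell a j v) :=
  ⟨h.1, fun a' h1 h2 => by rw [Store.setCell_arr, if_neg (by omega), h.2 a' h1 h2]⟩

theorem VebEnv.of_frame {B lam : ℕ} {s s' : Store} (h : VebEnv B lam s) (hf : VebFrame s s') :
    VebEnv B lam s' :=
  ⟨by rw [hf.1 _ (by norm_num), h.top], by rw [hf.1 _ (by norm_num), h.width],
    fun k hk => by rw [hf.2 8 (by norm_num) (by norm_num), h.table k hk], h.bound⟩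

/-- Move `x` (register 42) down: on level `l - 1`, compute the halves of `x` (registers 48 and 49)
and the number (register 50) and address (register 51) of its cluster. -/
def vebDescend : Cmd :=
  .assign 40 (.minus (.reg 40) (.lit 1)) ;;
  .assign 47 (.read 8 (.reg 40)) ;;
  .assign 48 (.quot (.reg 42) (.reg 47)) ;;
  .assign 49 (.rem (.reg 42) (.reg 47)) ;;
  .assign 50 (.plus (.times (.reg 41) (.plus (.reg 47) (.lit 1))) (.reg 48)) ;;
  .assign 51 (.plus (.times (.reg 50) (.reg 6)) (.reg 40))

/-- Load the address of the current node and its ends into registers 44, 45, 46. -/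
def vebLoad : Cmd :=
  .assign 44 (.plus (.times (.reg 41) (.reg 6)) (.reg 40)) ;;
  .assign 45 (.read 11 (.reg 44)) ;;
  .assign 46 (.read 12 (.reg 44))

theorem wp_vebDescend {D : Subroutines} {B lam l i x : ℕ} {s : Store} {Q : ℕ → Store → Prop}
    (he : VebEnv B lam s) (hl : l + 1 ≤ lam) (hi : VebSub lam 0 (l + 1) i) (h40 : s.reg 40 = l + 1)
    (h41 : s.reg 41 = i) (h42 : s.reg 42 = x) (hx : x < vebSize (l + 1))
    (hQ : ∀ t ≤ 40, ∀ s' : Store, s'.arr = s.arr → (∀ r < 40, s'.reg r = s.reg r) → s'.reg 40 = l →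
      s'.reg 41 = i → s'.reg 42 = x → s'.reg 43 = s.reg 43 → s'.reg 46 = s.reg 46 →
      s'.reg 47 = vebSize l → s'.reg 48 = x / vebSize l → s'.reg 49 = x % vebSize l →
      s'.reg 50 = vebChild l i (x / vebSize l) →
      s'.reg 51 = vebChild l i (x / vebSize l) * (lam + 1) + l → Q t s') :
    WP D B vebDescend s Q := by
  have hu := two_le_vebSize l
  have hul : vebSize l ≤ vebSize lam := vebSize_mono (by omega)
  have hlam : vebSize lam ≤ vebSize lam * (lam + 1) := Nat.le_mul_of_pos_right _ (by omega)
  have hB := he.bound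
  have hd : x / vebSize l < vebSize l := by
    rw [vebSize_succ] at hx
    exact Nat.div_lt_of_lt_mul hx
  have hm : x % vebSize l < vebSize l := Nat.mod_lt _ (by omega)
  have hc := (hi.trans (vebSub_child hd.le)).lt_vebSize
  have haddr : vebChild l i (x / vebSize l) * (lam + 1) + l < B := by
    have := Nat.mul_le_mul_right (lam + 1) (Nat.succ_le_of_lt hc)
    rw [Nat.succ_mul] at this
    omega
  have ht : s.arr 8 l = vebSize l := he.table l (by omega)
  rw [vebChild] at hc haddr
  simp only [vebDescend, wp_seq, wp_assign, Expr.eval, Expr.cost, Store.setReg_reg,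
    Store.setReg_arr, h40, h41, h42, he.width, Nat.add_sub_cancel, ht, reduceIte,
    Nat.reduceEqDiff]
  refine ⟨by omega, by omega, by omega, by omega, by omega, haddr, hQ _ (by norm_num) _ rfl ?_ ?_
    ?_ ?_ ?_ ?_ ?_ ?_ ?_ ?_ ?_⟩ <;> simp [h41, h42, vebChild]
  intro r hr
  split_ifs <;> omega

theorem VebRep.two_le_level {W l i a b x : ℕ} {f g : ℕ → ℕ} {X : Set ℕ} (h : VebRep W f g l i X)
    (ha : a ∈ X) (hb : b ∈ X) (hab : a ≠ b) (hx : x ∉ X) (hxl : x < vebSize l) : l ≠ 0 := by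
  rintro rfl
  have := h.lt a ha
  have := h.lt b hb
  have : x ≠ a := fun e => hx (e ▸ ha)
  have : x ≠ b := fun e => hx (e ▸ hb)
  rw [show vebSize 0 = 2 from rfl] at *
  omega

/-- The recursive part of an insertion: `y` is inserted into the inner part. -/
def vebInsertRec : Cmd :=
  vebDescend ;;
  .branch (.equal (.read 11 (.reg 51)) (.lit 0))
    (.write 11 (.reg 51) (.plus (.reg 49) (.lit 1)) ;;
      .write 12 (.reg 51) (.plus (.reg 49) (.lit 1)) ;;
      .assign 41 (.plus (.times (.reg 41) (.plus (.reg 47) (.lit 1))) (.reg 47)) ;;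
      .assign 42 (.reg 48))
    (.assign 41 (.reg 50) ;; .assign 42 (.reg 49))

/-- The situation `s'` when an operation `op` on node `i` of level `l + 1`, begun in `s`, is to be
completed by a recursive call on a child. The call is safe (`pre` is its precondition), and all
contents `f`, `g` of the arrays that it can result in satisfy `G`. -/
def VebDesc (lam : ℕ) (op : ℕ → Set ℕ → Set ℕ) (pre : ℕ → Set ℕ → Prop) (l i : ℕ) (s s' : Store)
    (G : (ℕ → ℕ) → (ℕ → ℕ) → Prop) : Prop :=
  ∃ i' x X, VebFrame s s' ∧ s'.reg 40 = l ∧ s'.reg 41 = i' ∧ s'.reg 42 = x ∧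
    s'.reg 43 = s.reg 43 ∧ VebSub (l + 1) i l i' ∧ x < vebSize l ∧ pre x X ∧
    VebRep (lam + 1) (s'.arr 11) (s'.arr 12) l i' X ∧
    ∀ f g, VebRep (lam + 1) f g l i' (op x X) →
      VebAgree (lam + 1) (fun k j => ¬VebSub l i' k j) (s'.arr 11) f →
      VebAgree (lam + 1) (fun k j => ¬VebSub l i' k j) (s'.arr 12) g → G f g

/-- What a recursive call for the children of node `i` on level `l + 1` achieves: they hold `Y`, and
nothing else has changed. -/
def VebKidsDone (lam l i : ℕ) (s : Store) (Y : Set ℕ) (f g : ℕ → ℕ) : Prop :=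
  VebKids (lam + 1) f g l i Y ∧
    VebAgree (lam + 1) (fun k j => ¬VebBelow l i k j) (s.arr 11) f ∧
    VebAgree (lam + 1) (fun k j => ¬VebBelow l i k j) (s.arr 12) g

/-- What an operation on node `i` of level `l` achieves: it holds `X`, and nothing else has
changed. -/
def VebDone (lam l i : ℕ) (s : Store) (X : Set ℕ) (f g : ℕ → ℕ) : Prop :=
  VebRep (lam + 1) f g l i X ∧
    VebAgree (lam + 1) (fun k j => ¬VebSub l i k j) (s.arr 11) f ∧
    VebAgree (lam + 1) (fun k j => ¬VebSub l i k j) (s.arr 12) g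

theorem wp_vebInsertRec {D : Subroutines} {B lam l i y : ℕ} {s : Store} {Y : Set ℕ}
    {Q : ℕ → Store → Prop}
    (he : VebEnv B lam s) (hl : l + 1 ≤ lam) (hi : VebSub lam 0 (l + 1) i) (h40 : s.reg 40 = l + 1)
    (h41 : s.reg 41 = i) (h42 : s.reg 42 = y) (hy : y < vebSize (l + 1)) (hyY : y ∉ Y)
    (hK : VebKids (lam + 1) (s.arr 11) (s.arr 12) l i Y)
    (hQ : ∀ t ≤ 70, ∀ s', VebDesc lam insert (fun x X => x ∉ X) l i s s'
      (VebKidsDone lam l i s (insert y Y)) → Q t s') :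
    WP D B vebInsertRec s Q := by
  have hu := two_le_vebSize l
  have hul : vebSize l ≤ vebSize lam := vebSize_mono (by omega)
  have hlam : vebSize lam ≤ vebSize lam * (lam + 1) := Nat.le_mul_of_pos_right _ (by omega)
  have hB := he.bound
  have hd : y / vebSize l < vebSize l := by
    rw [vebSize_succ] at hy
    exact Nat.div_lt_of_lt_mul hy
  have hm : y % vebSize l < vebSize l := Nat.mod_lt _ (by omega)
  have hc := (hi.trans (vebSub_child hd.le)).lt_vebSize
  have hc' := (hi.trans (vebSub_child le_rfl)).lt_vebSize
  have haddr : vebChild l i (y / vebSize l) * (lam + 1) + l < B := by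
    have := Nat.mul_le_mul_right (lam + 1) (Nat.succ_le_of_lt hc)
    rw [Nat.succ_mul] at this
    omega
  rw [vebInsertRec, wp_seq]
  refine wp_vebDescend he hl hi h40 h41 h42 hy fun t ht s₁ a₁ f₁ r40 r41 r42 r43 r46 r47 r48 r49
    r50 r51 => ?_
  have hR := hK.1 _ hd
  have hne : ∀ h ≠ y / vebSize l, ¬VebSub l (vebChild l i h) l (vebChild l i (y / vebSize l)) :=
    fun h hh hs => hh (vebSub_child_inj hs (.refl _ _))
  rw [wp_branch]
  simp only [Expr.eval, Expr.cost, r51, a₁]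
  constructor
  · -- The cluster is empty: it becomes a singleton, and its number is inserted into the summary.
    intro h0
    obtain ⟨hE, -⟩ | ⟨a, b, hfa, -⟩ := hR.ends
    swap
    · simp [hfa] at h0
    simp only [wp_seq, wp_assign, wp_write, Expr.eval, Expr.cost, Store.setReg_reg,
      Store.setCell_reg, r41, r47, r48, r49, r51, Nat.reduceEqDiff, reduceIte]
    have hdS : y / vebSize l ∉ summarySet (vebSize l) Y := by
      rw [mem_summarySet_iff, hE]; simp
    have hn : ∀ {p : ℕ → ℕ → Prop} {v : ℕ} {f : ℕ → ℕ},
        ¬p l (vebChild l i (y / vebSize l)) → VebAgree (lam + 1) p f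
          (Function.update f (vebChild l i (y / vebSize l) * (lam + 1) + l) v) :=
      fun hp => VebAgree.rfl.update (by omega) hp
    refine ⟨haddr, by omega, haddr, by omega, hc'.trans_le (by omega), by omega,
      hQ _ (by omega) _ ⟨vebChild l i (vebSize l), _, summarySet (vebSize l) Y, ⟨?_, ?_⟩, ?_,
      rfl, ?_, ?_, vebSub_child le_rfl, hd, hdS, ?_, fun f g hR' hf hg => ?_⟩⟩
    · intro r hr
      simp only [Store.setReg_reg, Store.setCell_reg]
      rw [if_neg (by omega), if_neg (by omega), f₁ r hr]
    · intro a h11 h12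
      simp [h11, h12, a₁]
    · simp [r40]
    · simp
    · simp [r43]
    · simp only [Store.setReg_arr, Store.setCell_arr, Nat.reduceEqDiff, reduceIte, a₁]
      exact hK.2.congr (by omega) (hn (hne _ hd.ne')) (hn (hne _ hd.ne'))
    · simp only [Store.setReg_arr, Store.setCell_arr, Nat.reduceEqDiff, reduceIte, a₁] at hf hg
      refine ⟨hK.of_cluster (by omega) (fun h hh => clusterSet_insert_of_ne hh) ?_ ?_
        (fun h hh hh' => (hn (hne h hh)).trans (hf.mono fun _ _ h₁ h₂ => ?_))
        (fun h hh hh' => (hn (hne h hh)).trans (hg.mono fun _ _ h₁ h₂ => ?_)), ?_, ?_⟩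
      · have hn' : ¬VebSub l (vebChild l i (vebSize l)) l (vebChild l i (y / vebSize l)) :=
          hne _ hd.ne'
        have hd' : ∀ k j, VebSub l (vebChild l i (y / vebSize l)) k j →
            ¬VebSub l (vebChild l i (vebSize l)) k j :=
          fun _ _ h₁ h₂ => hd.ne (vebSub_child_inj h₁ h₂)
        have hv : f (vebChild l i (y / vebSize l) * (lam + 1) + l) = y % vebSize l + 1 ∧
            g (vebChild l i (y / vebSize l) * (lam + 1) + l) = y % vebSize l + 1 :=
          ⟨(hf _ _ (by omega) hn').trans (by simp), (hg _ _ (by omega) hn').trans (by simp)⟩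
        rw [clusterSet_insert (by omega), hE, insert_empty_eq]
        refine VebRep.of_inner_eq (X := ∅) (by omega) (hE ▸ hR) ?_ (by simpa using hm)
          (.inr ⟨y % vebSize l, y % vebSize l, hv.1, hv.2, rfl, rfl, by simp⟩)
          ((hn fun h => h.2 ⟨rfl, rfl⟩).trans (hf.mono fun _ _ h => hd' _ _ h.1))
          ((hn fun h => h.2 ⟨rfl, rfl⟩).trans (hg.mono fun _ _ h => hd' _ _ h.1))
        rw [innerPart_empty, innerPart_of_pair (a := y % vebSize l) (b := y % vebSize l)]
        simp
      · rw [summarySet_insert (by omega)]; exact hR'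
      · exact hh' (vebSub_child_inj h₁ h₂)
      · exact hh' (vebSub_child_inj h₁ h₂)
      · exact (hn fun h => h ⟨_, hd.le, .refl _ _⟩).trans
          (hf.mono fun _ _ h h' => h ⟨_, le_rfl, h'⟩)
      · exact (hn fun h => h ⟨_, hd.le, .refl _ _⟩).trans
          (hg.mono fun _ _ h h' => h ⟨_, le_rfl, h'⟩)
  · intro h0
    obtain ⟨-, hE, -⟩ | ⟨a, b, hfa, -, ha, -⟩ := hR.ends
    · simp [hE] at h0
    simp only [wp_seq, wp_assign, Expr.eval, Expr.cost, Store.setReg_reg, r49, r50,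
      Nat.reduceEqDiff, reduceIte]
    refine ⟨by omega, by omega, hQ _ (by omega) _ ⟨vebChild l i (y / vebSize l), _,
      clusterSet (vebSize l) Y (y / vebSize l), ⟨?_, ?_⟩, ?_, ?_, ?_, ?_, vebSub_child hd.le, hm,
      fun h => hyY ((mem_clusterSet_div (by omega)).1 h), by simpa [a₁] using hR,
      fun f g hR' hf hg => ?_⟩⟩
    · intro r hr
      simp only [Store.setReg_reg]
      rw [if_neg (by omega), if_neg (by omega), f₁ r hr]
    · intro a _ _
      simp [a₁]
    · simp [r40]
    · simp
    · simp
    · simp [r43]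
    · simp only [Store.setReg_arr, a₁] at hf hg
      have hS : VebAgree (lam + 1) (VebSub l (vebChild l i (vebSize l))) (s.arr 11) f ∧
          VebAgree (lam + 1) (VebSub l (vebChild l i (vebSize l))) (s.arr 12) g :=
        ⟨hf.mono fun _ _ h₁ h₂ => hd.ne' (vebSub_child_inj h₁ h₂),
          hg.mono fun _ _ h₁ h₂ => hd.ne' (vebSub_child_inj h₁ h₂)⟩
      refine ⟨hK.of_cluster (by omega) (fun h hh => clusterSet_insert_of_ne hh) ?_ ?_
        (fun h hh hh' => hf.mono fun _ _ h₁ h₂ => hh (vebSub_child_inj h₁ h₂))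
        (fun h hh hh' => hg.mono fun _ _ h₁ h₂ => hh (vebSub_child_inj h₁ h₂)),
        hf.mono fun _ _ h h' => h ⟨_, hd.le, h'⟩, hg.mono fun _ _ h h' => h ⟨_, hd.le, h'⟩⟩
      · rw [clusterSet_insert (by omega)]; exact hR'
      · rw [summarySet_insert (by omega), Set.insert_eq_of_mem]
        · exact hK.2.congr (by omega) hS.1 hS.2
        · rw [mem_summarySet_iff, ← Set.nonempty_iff_ne_empty]
          exact ⟨a, ha⟩

/-- One level of the insertion of register 42 into node number register 41 on level register 40.
Register 43 is set to 0 when the insertion is complete. -/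
def vebInsertBody : Cmd :=
  vebLoad ;;
  .branch (.equal (.reg 45) (.reg 46))
    (.assign 43 (.lit 0) ;;
      .branch (.equal (.reg 45) (.lit 0))
        (.write 11 (.reg 44) (.plus (.reg 42) (.lit 1)) ;;
          .write 12 (.reg 44) (.plus (.reg 42) (.lit 1)))
        (.branch (.less (.plus (.reg 42) (.lit 1)) (.reg 45))
          (.write 11 (.reg 44) (.plus (.reg 42) (.lit 1)))
          (.write 12 (.reg 44) (.plus (.reg 42) (.lit 1)))))
    (.branch (.less (.plus (.reg 42) (.lit 1)) (.reg 45))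
        (.write 11 (.reg 44) (.plus (.reg 42) (.lit 1)) ;;
          .assign 42 (.minus (.reg 45) (.lit 1)))
        (.branch (.less (.reg 46) (.plus (.reg 42) (.lit 1)))
          (.write 12 (.reg 44) (.plus (.reg 42) (.lit 1)) ;;
            .assign 42 (.minus (.reg 46) (.lit 1)))
          .skip) ;;
      vebInsertRec)

theorem VebRep.kids {W l i : ℕ} {f g : ℕ → ℕ} {X : Set ℕ} (h : VebRep W f g (l + 1) i X) :
    VebKids W f g l i (innerPart X) := h.2.2

theorem VebBelow.not_of_not_vebSub {l i k j : ℕ} (h : ¬VebSub (l + 1) i k j) :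
    ¬VebBelow l i k j :=
  fun h' => h h'.vebSub

theorem wp_vebLoad {D : Subroutines} {B lam l i : ℕ} {s : Store} {Q : ℕ → Store → Prop}
    (he : VebEnv B lam s) (hl : l ≤ lam) (hi : VebSub lam 0 l i) (h40 : s.reg 40 = l)
    (h41 : s.reg 41 = i) (h11 : s.arr 11 (i * (lam + 1) + l) < B)
    (h12 : s.arr 12 (i * (lam + 1) + l) < B)
    (hQ : ∀ s' : Store, s'.arr = s.arr → (∀ r < 44, s'.reg r = s.reg r) →
      s'.reg 44 = i * (lam + 1) + l → s'.reg 45 = s.arr 11 (i * (lam + 1) + l) →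
      s'.reg 46 = s.arr 12 (i * (lam + 1) + l) → Q 12 s') :
    WP D B vebLoad s Q := by
  have haddr : i * (lam + 1) + l < B := by
    have := Nat.mul_le_mul_right (lam + 1) (Nat.succ_le_of_lt hi.lt_vebSize)
    rw [Nat.succ_mul] at this
    have := he.bound
    omega
  simp only [vebLoad, wp_seq, wp_assign, Expr.eval, Expr.cost, Store.setReg_reg,
    Store.setReg_arr, h40, h41, he.width, reduceIte, Nat.reduceEqDiff]
  refine ⟨haddr, h11, h12, hQ _ rfl (fun r hr => ?_) (by simp) (by simp) (by simp)⟩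
  simp only [Store.setReg_reg]
  split_ifs <;> omega

theorem VebEnds.lt_of {mn mx u B : ℕ} {X : Set ℕ} (h : VebEnds mn mx X) (hX : ∀ x ∈ X, x < u)
    (hu : u < B) : mn < B ∧ mx < B := by
  obtain ⟨-, rfl, rfl⟩ | ⟨a, b, rfl, rfl, ha, hb, -⟩ := h
  · omega
  · have := hX a ha
    have := hX b hb
    omega

/-- `body` performs one level of the operation `op`: it completes it, or leaves a recursive call
(and since nothing has to be done after that call, the loop that repeats `body` needs no stack). -/
def VebStep (D : Subroutines) (B lam : ℕ) (body : Cmd) (op : ℕ → Set ℕ → Set ℕ)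
    (pre : ℕ → Set ℕ → Prop) : Prop :=
  ∀ (l i x : ℕ) (s : Store) (X : Set ℕ), VebEnv B lam s → l ≤ lam → VebSub lam 0 l i →
    s.reg 40 = l → s.reg 41 = i → s.reg 42 = x → s.reg 43 = 1 → x < vebSize l → pre x X →
    VebRep (lam + 1) (s.arr 11) (s.arr 12) l i X →
    WP D B body s fun t s' => t ≤ 200 ∧
      ((VebFrame s s' ∧ s'.reg 43 = 0 ∧ VebDone lam l i s (op x X) (s'.arr 11) (s'.arr 12)) ∨
        ∃ l', l = l' + 1 ∧ VebDesc lam op pre l' i s s' (VebDone lam l i s (op x X)))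

theorem VebStep.loop {D : Subroutines} {B lam : ℕ} {body : Cmd} {op : ℕ → Set ℕ → Set ℕ}
    {pre : ℕ → Set ℕ → Prop} (hb : VebStep D B lam body op pre) {l i x : ℕ} {s : Store} {X : Set ℕ}
    (he : VebEnv B lam s) (hl : l ≤ lam) (hi : VebSub lam 0 l i) (h40 : s.reg 40 = l)
    (h41 : s.reg 41 = i) (h42 : s.reg 42 = x) (h43 : s.reg 43 = 1) (hx : x < vebSize l)
    (hp : pre x X) (hR : VebRep (lam + 1) (s.arr 11) (s.arr 12) l i X) :
    WP D B (.loop (.reg 43) body) s fun t s' => t ≤ 210 * (l + 1) ∧ VebFrame s s' ∧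
      VebDone lam l i s (op x X) (s'.arr 11) (s'.arr 12) := by
  induction l generalizing i x s X with
  | zero =>
    refine wp_loop_true (by simp [Expr.eval, h43]) ((hb _ _ _ _ _ he hl hi h40 h41 h42 h43 hx hp
      hR).mono fun t s' ⟨ht, h⟩ => ?_)
    obtain ⟨hf, hr, hd⟩ | ⟨l', h', -⟩ := h
    · refine wp_loop_false (by simp [Expr.eval, hr]) ⟨?_, hf, hd⟩
      simp only [Expr.cost]; omega
    · omega
  | succ l ih =>
    refine wp_loop_true (by simp [Expr.eval, h43]) ((hb _ _ _ _ _ he hl hi h40 h41 h42 h43 hx hp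
      hR).mono fun t s' ⟨ht, h⟩ => ?_)
    obtain ⟨hf, hr, hd⟩ | ⟨l', h', i', x', X', hf, r40, r41, r42, r43, hs, hx', hp', hR', hG⟩ := h
    · refine wp_loop_false (by simp [Expr.eval, hr]) ⟨?_, hf, hd⟩
      simp only [Expr.cost]; omega
    · obtain rfl : l' = l := by omega
      refine (ih (he.of_frame hf) (by omega) (hi.trans hs) r40 r41 r42 (r43.trans h43) hx' hp'
        hR').mono fun t' s'' ⟨ht', hf', hR'', hg₁, hg₂⟩ => ⟨?_, hf.trans hf', hG _ _ hR'' hg₁ hg₂⟩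
      simp only [Expr.cost]; omega

theorem vebStep_insert (D : Subroutines) (B lam : ℕ) :
    VebStep D B lam vebInsertBody insert fun x X => x ∉ X := by
  intro l i x s X he hl hi h40 h41 h42 h43 hx hxX hR
  have hB := he.bound
  have hul : vebSize l ≤ vebSize lam := vebSize_mono hl
  have hlam : vebSize lam ≤ vebSize lam * (lam + 1) := Nat.le_mul_of_pos_right _ (by omega)
  have hE := hR.ends
  obtain ⟨h11, h12⟩ := hE.lt_of hR.lt (by omega : vebSize l < B)
  have haddr : i * (lam + 1) + l < B := by
    have := Nat.mul_le_mul_right (lam + 1) (Nat.succ_le_of_lt hi.lt_vebSize)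
    rw [Nat.succ_mul] at this
    omega
  have hn : ∀ {p : ℕ → ℕ → Prop} (v : ℕ) (f : ℕ → ℕ), ¬p l i →
      VebAgree (lam + 1) p f (Function.update f (i * (lam + 1) + l) v) :=
    fun v f hp => VebAgree.rfl.update (by omega) hp
  rw [vebInsertBody, wp_seq]
  refine wp_vebLoad he hl hi h40 h41 h11 h12 fun s₁ a₁ f₁ r44 r45 r46 => ?_
  have f40 : VebFrame s s₁ := ⟨fun r hr => f₁ r (by omega), fun _ _ _ => by rw [a₁]⟩
  have hlt : ∀ z ∈ insert x X, z < vebSize l := by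
    rintro z (rfl | hz)
    exacts [hx, hR.lt z hz]
  -- If the ends coincide, then no recursive call is needed.
  have small : ∀ (s' : Store), s.arr 11 (i * (lam + 1) + l) = s.arr 12 (i * (lam + 1) + l) →
      VebFrame s s' → VebEnds (s'.arr 11 (i * (lam + 1) + l)) (s'.arr 12 (i * (lam + 1) + l))
        (insert x X) →
      (∀ p : ℕ → ℕ → Prop, ¬p l i → VebAgree (lam + 1) p (s.arr 11) (s'.arr 11) ∧
        VebAgree (lam + 1) p (s.arr 12) (s'.arr 12)) →
      VebDone lam l i s (insert x X) (s'.arr 11) (s'.arr 12) := by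
    intro s' h hf he' hag
    have h1 := hag (fun k j => VebSub l i k j ∧ ¬(k = l ∧ j = i)) (by simp)
    have h2 := hag (fun k j => ¬VebSub l i k j) (not_not.2 (.refl _ _))
    refine ⟨hR.of_inner_eq (by omega) ?_ hlt he' h1.1 h1.2, h2⟩
    obtain ⟨rfl, -⟩ | ⟨a, b, ha, hb, haX, hbX, hab⟩ := hE
    · rw [innerPart_empty, innerPart_of_pair (a := x) (b := x)]
      simp
    · obtain rfl : a = b := by omega
      rw [innerPart_of_pair (a := a) (b := x), innerPart_of_pair (a := a) (b := a)]
      · intro z hz; have := hab z hz; omega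
      · rintro z (rfl | hz)
        · exact .inr rfl
        · have := hab z hz; omega
  -- Otherwise, the recursive call inserts into the inner part: `x`, or an end that `x` replaces.
  have large : ∀ (s' : Store) (y : ℕ),
      s.arr 11 (i * (lam + 1) + l) ≠ s.arr 12 (i * (lam + 1) + l) → VebFrame s s' →
      s'.reg 40 = l → s'.reg 41 = i → s'.reg 42 = y → s'.reg 43 = 1 → y < vebSize l →
      y ∉ innerPart X → innerPart (insert x X) = insert y (innerPart X) →
      VebEnds (s'.arr 11 (i * (lam + 1) + l)) (s'.arr 12 (i * (lam + 1) + l)) (insert x X) →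
      (∀ p : ℕ → ℕ → Prop, ¬p l i → VebAgree (lam + 1) p (s.arr 11) (s'.arr 11) ∧
        VebAgree (lam + 1) p (s.arr 12) (s'.arr 12)) →
      WP D B vebInsertRec s' fun t s'' => t ≤ 70 ∧
        ∃ l', l = l' + 1 ∧ VebDesc lam insert (fun x X => x ∉ X) l' i s s''
          (VebDone lam l i s (insert x X)) := by
    intro s' y hne hf r40 r41 r42 r43 hy hyX hI he' hag
    obtain ⟨-, e1, e2⟩ | ⟨a, b, ha, hb, haX, hbX, hab⟩ := hE
    · omega
    obtain ⟨l, rfl⟩ : ∃ l', l = l' + 1 :=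
      Nat.exists_eq_succ_of_ne_zero (hR.two_le_level haX hbX (by omega) hxX hx)
    have h1 := hag (VebBelow l i) VebBelow.not_self
    refine wp_vebInsertRec (he.of_frame hf) hl hi r40 r41 r42 hy hyX
      (hR.kids.congr (by omega) h1.1 h1.2) fun t ht s'' hs'' => ⟨ht, l, rfl, ?_⟩
    obtain ⟨i', x', X', hf', q40, q41, q42, q43, hs, hx', hp', hR', hG⟩ := hs''
    refine ⟨i', x', X', hf.trans hf', q40, q41, q42, by rw [q43, r43, h43], hs, hx', hp', hR',
      fun f g hR'' hg₁ hg₂ => ?_⟩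
    obtain ⟨hK, k1, k2⟩ := hG f g hR'' hg₁ hg₂
    have h2 := hag (fun k j => ¬VebSub (l + 1) i k j) (not_not.2 (.refl _ _))
    refine ⟨⟨hlt, ?_, hI ▸ hK⟩, h2.1.trans (k1.mono fun _ _ => VebBelow.not_of_not_vebSub),
      h2.2.trans (k2.mono fun _ _ => VebBelow.not_of_not_vebSub)⟩
    rw [k1 _ _ (by omega) VebBelow.not_self, k2 _ _ (by omega) VebBelow.not_self]
    exact he'
  rw [wp_branch]
  simp only [Expr.eval, Expr.cost, r45, r46]
  constructor
  · intro h
    have h : s.arr 11 (i * (lam + 1) + l) = s.arr 12 (i * (lam + 1) + l) := by simpa using h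
    simp only [wp_seq, wp_assign, wp_branch, wp_write, Expr.eval, Expr.cost, Store.setReg_reg,
      Store.setCell_reg, Nat.reduceEqDiff, reduceIte, r44, r45, f₁ 42 (by norm_num), h42]
    refine ⟨by omega, fun h0 => ?_, fun h0 => ⟨fun hx0 => ?_, fun hx0 => ?_⟩⟩
    · refine ⟨haddr, by omega, haddr, by omega, by omega, .inl ?_⟩
      have fr := ((f40.setReg (r := 43) (v := 0) (by norm_num)).setCell (a := 11)
        (j := i * (lam + 1) + l) (v := x + 1) (.inl rfl)).setCell (a := 12)
        (j := i * (lam + 1) + l) (v := x + 1) (.inr rfl)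
      refine ⟨fr, by simp, small _ h fr (.inr ⟨x, x, by simp, by simp, .inl rfl, .inl rfl, ?_⟩)
        fun p hp => by simp [a₁, hn _ _ hp]⟩
      obtain ⟨rfl, -⟩ | ⟨a, b, ha, -⟩ := hE
      · simp
      · simp [ha] at h0
    · have hx0 : x + 1 < s.arr 11 (i * (lam + 1) + l) := by simpa using hx0
      refine ⟨haddr, by omega, by omega, .inl ?_⟩
      have fr := (f40.setReg (r := 43) (v := 0) (by norm_num)).setCell (a := 11)
        (j := i * (lam + 1) + l) (v := x + 1) (.inl rfl)
      obtain ⟨-, h1, -⟩ | ⟨a, b, ha, hb, haX, hbX, hab⟩ := hE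
      · omega
      refine ⟨fr, by simp, small _ h fr (.inr ⟨x, b, by simp, by simp [a₁, hb], .inl rfl, .inr hbX,
        ?_⟩) fun p hp => by simp [a₁, hn _ _ hp, VebAgree.rfl]⟩
      rintro z (rfl | hz)
      · omega
      · have := hab z hz; omega
    · have hx0 : s.arr 11 (i * (lam + 1) + l) ≤ x + 1 := by simpa using hx0
      have h0 : s.arr 11 (i * (lam + 1) + l) ≠ 0 := by simpa using h0
      refine ⟨haddr, by omega, by omega, .inl ?_⟩
      have fr := (f40.setReg (r := 43) (v := 0) (by norm_num)).setCell (a := 12)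
        (j := i * (lam + 1) + l) (v := x + 1) (.inr rfl)
      obtain ⟨-, h1, -⟩ | ⟨a, b, ha, hb, haX, hbX, hab⟩ := hE
      · omega
      refine ⟨fr, by simp, small _ h fr (.inr ⟨a, x, by simp [a₁, ha], by simp, .inr haX, .inl rfl,
        ?_⟩) fun p hp => by simp [a₁, hn _ _ hp, VebAgree.rfl]⟩
      rintro z (rfl | hz)
      · omega
      · have := hab z hz; omega
  · intro h
    have h : s.arr 11 (i * (lam + 1) + l) ≠ s.arr 12 (i * (lam + 1) + l) := by simpa using h
    obtain ⟨-, e1, e2⟩ | ⟨a, b, ha, hb, haX, hbX, hab⟩ := id hE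
    · omega
    have hI := fun z => mem_innerPart (x := z) haX hbX hab
    have hxa : x ≠ a := fun e => hxX (e ▸ haX)
    have hxb : x ≠ b := fun e => hxX (e ▸ hbX)
    have hal := hR.lt a haX
    have hbl := hR.lt b hbX
    have hab' := hab b hbX
    simp only [wp_seq, wp_assign, wp_branch, wp_write, wp_skip, Expr.eval, Expr.cost,
      Store.setCell_reg, r44, r45, r46, f₁ 42 (by norm_num), h42, ha, hb, Nat.add_sub_cancel]
    refine ⟨fun hx0 => ?_, fun hx0 => ⟨fun hx1 => ?_, fun hx1 => ?_⟩⟩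
    · have hx0 : x < a := by simpa using hx0
      refine ⟨haddr, by omega, by omega, (large _ a h
        ((f40.setCell (.inl rfl)).setReg (by norm_num)) (by simp [f₁, h40]) (by simp [f₁, h41])
        (by simp) (by simp [f₁, h43]) hal
        (fun h => ((hI a).1 h).2.1 rfl) (innerPart_insert_of_lt haX hbX hab (by omega) hx0)
        (.inr ⟨x, b, by simp, by simp [a₁, hb], .inl rfl, .inr hbX, ?_⟩)
        fun p hp => by simp [a₁, hn _ _ hp, VebAgree.rfl]).mono fun t s' ⟨ht, hs⟩ =>
        ⟨by omega, .inr hs⟩⟩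
      rintro z (rfl | hz)
      · omega
      · have := hab z hz; omega
    · have hx1 : b < x := by simpa using hx1
      refine ⟨haddr, by omega, by omega, (large _ b h
        ((f40.setCell (.inr rfl)).setReg (by norm_num)) (by simp [f₁, h40]) (by simp [f₁, h41])
        (by simp) (by simp [f₁, h43]) hbl
        (fun h => ((hI b).1 h).2.2 rfl) (innerPart_insert_of_gt haX hbX hab (by omega) hx1)
        (.inr ⟨a, x, by simp [a₁, ha], by simp, .inr haX, .inl rfl, ?_⟩)
        fun p hp => by simp [a₁, hn _ _ hp, VebAgree.rfl]).mono fun t s' ⟨ht, hs⟩ =>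
        ⟨by omega, .inr hs⟩⟩
      rintro z (rfl | hz)
      · have := hab a haX; omega
      · have := hab z hz; omega
    · have hx0 : a ≤ x := by simpa using hx0
      have hx1 : x ≤ b := by simpa using hx1
      refine (large _ x h f40
        (by simp [f₁, h40]) (by simp [f₁, h41]) (by simp [f₁, h42]) (by simp [f₁, h43]) hx
        (fun h => hxX (innerPart_subset h))
        (innerPart_insert_of_between haX hbX hab (by omega) (by omega))
        (.inr ⟨a, b, by simp [a₁, ha], by simp [a₁, hb], .inr haX, .inr hbX, ?_⟩)
        fun p hp => by simp [a₁, VebAgree.rfl]).mono fun t s' ⟨ht, hs⟩ => ⟨by omega, .inr hs⟩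
      rintro z (rfl | hz)
      · omega
      · exact hab z hz

/-! ### Deletion from van Emde Boas trees -/

/-- The recursive part of a deletion: `y` is deleted from the inner part. -/
def vebDeleteRec : Cmd :=
  vebDescend ;;
  .branch (.equal (.read 11 (.reg 51)) (.read 12 (.reg 51)))
    (.write 11 (.reg 51) (.lit 0) ;;
      .write 12 (.reg 51) (.lit 0) ;;
      .assign 41 (.plus (.times (.reg 41) (.plus (.reg 47) (.lit 1))) (.reg 47)) ;;
      .assign 42 (.reg 48))
    (.assign 41 (.reg 50) ;; .assign 42 (.reg 49))

theorem wp_vebDeleteRec {D : Subroutines} {B lam l i y : ℕ} {s : Store} {Y : Set ℕ}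
    {Q : ℕ → Store → Prop}
    (he : VebEnv B lam s) (hl : l + 1 ≤ lam) (hi : VebSub lam 0 (l + 1) i) (h40 : s.reg 40 = l + 1)
    (h41 : s.reg 41 = i) (h42 : s.reg 42 = y) (hy : y < vebSize (l + 1)) (hyY : y ∈ Y)
    (hK : VebKids (lam + 1) (s.arr 11) (s.arr 12) l i Y)
    (hQ : ∀ t ≤ 70, ∀ s', VebDesc lam (fun x X => X \ {x}) (fun x X => x ∈ X) l i s s'
      (VebKidsDone lam l i s (Y \ {y})) → Q t s') :
    WP D B vebDeleteRec s Q := by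
  have hu := two_le_vebSize l
  have hul : vebSize l ≤ vebSize lam := vebSize_mono (by omega)
  have hlam : vebSize lam ≤ vebSize lam * (lam + 1) := Nat.le_mul_of_pos_right _ (by omega)
  have hB := he.bound
  have hd : y / vebSize l < vebSize l := by
    rw [vebSize_succ] at hy
    exact Nat.div_lt_of_lt_mul hy
  have hm : y % vebSize l < vebSize l := Nat.mod_lt _ (by omega)
  have hc := (hi.trans (vebSub_child hd.le)).lt_vebSize
  have hc' := (hi.trans (vebSub_child le_rfl)).lt_vebSize
  have haddr : vebChild l i (y / vebSize l) * (lam + 1) + l < B := by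
    have := Nat.mul_le_mul_right (lam + 1) (Nat.succ_le_of_lt hc)
    rw [Nat.succ_mul] at this
    omega
  rw [vebDeleteRec, wp_seq]
  refine wp_vebDescend he hl hi h40 h41 h42 hy fun t ht s₁ a₁ f₁ r40 r41 r42 r43 r46 r47 r48 r49
    r50 r51 => ?_
  have hR := hK.1 _ hd
  have hne : ∀ h ≠ y / vebSize l, ¬VebSub l (vebChild l i h) l (vebChild l i (y / vebSize l)) :=
    fun h hh hs => hh (vebSub_child_inj hs (.refl _ _))
  have hyC : y % vebSize l ∈ clusterSet (vebSize l) Y (y / vebSize l) :=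
    (mem_clusterSet_div (by omega)).2 hyY
  rw [wp_branch]
  simp only [Expr.eval, Expr.cost, r51, a₁]
  constructor
  · -- The cluster is a singleton: it becomes empty, and its number is deleted from the summary.
    intro h0
    have h0 : s.arr 11 (vebChild l i (y / vebSize l) * (lam + 1) + l) =
      s.arr 12 (vebChild l i (y / vebSize l) * (lam + 1) + l) := by simpa using h0
    have hE : clusterSet (vebSize l) Y (y / vebSize l) = {y % vebSize l} := by
      obtain ⟨hE, -⟩ | ⟨a, b, hfa, hgb, -, -, hab⟩ := hR.ends
      · rw [hE] at hyC; exact hyC.elim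
      · refine Set.eq_singleton_iff_unique_mem.2 ⟨hyC, fun z hz => ?_⟩
        have := hab _ hz
        have := hab _ hyC
        omega
    simp only [wp_seq, wp_assign, wp_write, Expr.eval, Expr.cost, Store.setReg_reg,
      Store.setCell_reg, r41, r47, r48, r51, Nat.reduceEqDiff, reduceIte]
    have hdS : y / vebSize l ∈ summarySet (vebSize l) Y := mem_summarySet_div (by omega) hyY
    have hn : ∀ {p : ℕ → ℕ → Prop} {v : ℕ} {f : ℕ → ℕ},
        ¬p l (vebChild l i (y / vebSize l)) → VebAgree (lam + 1) p f
          (Function.update f (vebChild l i (y / vebSize l) * (lam + 1) + l) v) :=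
      fun hp => VebAgree.rfl.update (by omega) hp
    refine ⟨haddr, by omega, haddr, by omega, hc'.trans_le (by omega), by omega,
      hQ _ (by omega) _ ⟨vebChild l i (vebSize l), _, summarySet (vebSize l) Y, ⟨?_, ?_⟩, ?_,
      rfl, ?_, ?_, vebSub_child le_rfl, hd, hdS, ?_, fun f g hR' hf hg => ?_⟩⟩
    · intro r hr
      simp only [Store.setReg_reg, Store.setCell_reg]
      rw [if_neg (by omega), if_neg (by omega), f₁ r hr]
    · intro a h11 h12
      simp [h11, h12, a₁]
    · simp [r40]
    · simp
    · simp [r43]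
    · simp only [Store.setReg_arr, Store.setCell_arr, Nat.reduceEqDiff, reduceIte, a₁]
      exact hK.2.congr (by omega) (hn (hne _ hd.ne')) (hn (hne _ hd.ne'))
    · simp only [Store.setReg_arr, Store.setCell_arr, Nat.reduceEqDiff, reduceIte, a₁] at hf hg
      refine ⟨hK.of_cluster (by omega) (fun h hh => clusterSet_diff_of_ne hh) ?_ ?_
        (fun h hh hh' => (hn (hne h hh)).trans (hf.mono fun _ _ h₁ h₂ => ?_))
        (fun h hh hh' => (hn (hne h hh)).trans (hg.mono fun _ _ h₁ h₂ => ?_)), ?_, ?_⟩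
      · have hn' : ¬VebSub l (vebChild l i (vebSize l)) l (vebChild l i (y / vebSize l)) :=
          hne _ hd.ne'
        have hd' : ∀ k j, VebSub l (vebChild l i (y / vebSize l)) k j →
            ¬VebSub l (vebChild l i (vebSize l)) k j :=
          fun _ _ h₁ h₂ => hd.ne (vebSub_child_inj h₁ h₂)
        have hv : f (vebChild l i (y / vebSize l) * (lam + 1) + l) = 0 ∧
            g (vebChild l i (y / vebSize l) * (lam + 1) + l) = 0 :=
          ⟨(hf _ _ (by omega) hn').trans (by simp), (hg _ _ (by omega) hn').trans (by simp)⟩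
        rw [clusterSet_diff, hE, sdiff_self]
        refine VebRep.of_inner_eq (by omega) hR ?_ (by simp) (.inl ⟨rfl, hv⟩)
          ((hn fun h => h.2 ⟨rfl, rfl⟩).trans (hf.mono fun _ _ h => hd' _ _ h.1))
          ((hn fun h => h.2 ⟨rfl, rfl⟩).trans (hg.mono fun _ _ h => hd' _ _ h.1))
        rw [hE, innerPart_of_pair (X := {y % vebSize l}) (a := y % vebSize l) (b := y % vebSize l)]
        · exact innerPart_empty
        · simp
      · rw [summarySet_diff_of_singleton hE]; exact hR'
      · exact hh' (vebSub_child_inj h₁ h₂)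
      · exact hh' (vebSub_child_inj h₁ h₂)
      · exact (hn fun h => h ⟨_, hd.le, .refl _ _⟩).trans
          (hf.mono fun _ _ h h' => h ⟨_, le_rfl, h'⟩)
      · exact (hn fun h => h ⟨_, hd.le, .refl _ _⟩).trans
          (hg.mono fun _ _ h h' => h ⟨_, le_rfl, h'⟩)
  · intro h0
    have h0 : s.arr 11 (vebChild l i (y / vebSize l) * (lam + 1) + l) ≠
      s.arr 12 (vebChild l i (y / vebSize l) * (lam + 1) + l) := by simpa using h0
    obtain ⟨-, h1, h2⟩ | ⟨a, b, hfa, hgb, ha, hb, -⟩ := hR.ends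
    · omega
    simp only [wp_seq, wp_assign, Expr.eval, Expr.cost, Store.setReg_reg, r49, r50,
      Nat.reduceEqDiff, reduceIte]
    refine ⟨by omega, by omega, hQ _ (by omega) _ ⟨vebChild l i (y / vebSize l), _,
      clusterSet (vebSize l) Y (y / vebSize l), ⟨?_, ?_⟩, ?_, ?_, ?_, ?_, vebSub_child hd.le, hm,
      hyC, by simpa [a₁] using hR, fun f g hR' hf hg => ?_⟩⟩
    · intro r hr
      simp only [Store.setReg_reg]
      rw [if_neg (by omega), if_neg (by omega), f₁ r hr]
    · intro a _ _
      simp [a₁]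
    · simp [r40]
    · simp
    · simp
    · simp [r43]
    · simp only [Store.setReg_arr, a₁] at hf hg
      have hS : VebAgree (lam + 1) (VebSub l (vebChild l i (vebSize l))) (s.arr 11) f ∧
          VebAgree (lam + 1) (VebSub l (vebChild l i (vebSize l))) (s.arr 12) g :=
        ⟨hf.mono fun _ _ h₁ h₂ => hd.ne' (vebSub_child_inj h₁ h₂),
          hg.mono fun _ _ h₁ h₂ => hd.ne' (vebSub_child_inj h₁ h₂)⟩
      refine ⟨hK.of_cluster (by omega) (fun h hh => clusterSet_diff_of_ne hh) ?_ ?_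
        (fun h hh hh' => hf.mono fun _ _ h₁ h₂ => hh (vebSub_child_inj h₁ h₂))
        (fun h hh hh' => hg.mono fun _ _ h₁ h₂ => hh (vebSub_child_inj h₁ h₂)),
        hf.mono fun _ _ h h' => h ⟨_, hd.le, h'⟩, hg.mono fun _ _ h h' => h ⟨_, hd.le, h'⟩⟩
      · rw [clusterSet_diff]; exact hR'
      · rw [summarySet_diff]
        · exact hK.2.congr (by omega) hS.1 hS.2
        · by_cases e : a = y % vebSize l
          · exact ⟨b, hb, by omega⟩
          · exact ⟨a, ha, e⟩

/-- The minimum (`a = 11`) or the maximum (`a = 12`) of the summary of the current node, increased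
by 1. -/
def vebSummaryEnd (a : ℕ) : Expr :=
  .read a (.plus (.times (.plus (.times (.reg 41) (.plus (.reg 47) (.lit 1))) (.reg 47)) (.reg 6))
    (.minus (.reg 40) (.lit 1)))

/-- The minimum (`a = 11`) or the maximum (`a = 12`) of the inner part of the current node. -/
def vebInnerEnd (a : ℕ) : Expr :=
  .plus (.times (.minus (vebSummaryEnd a) (.lit 1)) (.reg 47))
    (.minus (.read a (.plus (.times (.plus (.times (.reg 41) (.plus (.reg 47) (.lit 1)))
      (.minus (vebSummaryEnd a) (.lit 1))) (.reg 6)) (.minus (.reg 40) (.lit 1)))) (.lit 1))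

/-- One level of the deletion of register 42 from node number register 41 on level register 40.
Register 43 is set to 0 when the deletion is complete. -/
def vebDeleteBody : Cmd :=
  vebLoad ;;
  .branch (.equal (.reg 45) (.reg 46))
    (.assign 43 (.lit 0) ;; .write 11 (.reg 44) (.lit 0) ;; .write 12 (.reg 44) (.lit 0))
    (.assign 47 (.read 8 (.minus (.reg 40) (.lit 1))) ;;
      .branch (.equal (.plus (.reg 42) (.lit 1)) (.reg 45))
        (.branch (.equal (.times (.reg 40) (vebSummaryEnd 11)) (.lit 0))
          (.write 11 (.reg 44) (.reg 46) ;; .assign 43 (.lit 0))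
          (.assign 42 (vebInnerEnd 11) ;;
            .write 11 (.reg 44) (.plus (.reg 42) (.lit 1)) ;; vebDeleteRec))
        (.branch (.equal (.plus (.reg 42) (.lit 1)) (.reg 46))
          (.branch (.equal (.times (.reg 40) (vebSummaryEnd 11)) (.lit 0))
            (.write 12 (.reg 44) (.reg 45) ;; .assign 43 (.lit 0))
            (.assign 42 (vebInnerEnd 12) ;;
              .write 12 (.reg 44) (.plus (.reg 42) (.lit 1)) ;; vebDeleteRec))
          vebDeleteRec))

theorem vebStep_delete (D : Subroutines) (B lam : ℕ) :
    VebStep D B lam vebDeleteBody (fun x X => X \ {x}) fun x X => x ∈ X := by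
  intro l i x s X he hl hi h40 h41 h42 h43 hx hxX hR
  have hB := he.bound
  have hul : vebSize l ≤ vebSize lam := vebSize_mono hl
  have hlam : vebSize lam ≤ vebSize lam * (lam + 1) := Nat.le_mul_of_pos_right _ (by omega)
  have hE := hR.ends
  obtain ⟨h11, h12⟩ := hE.lt_of hR.lt (by omega : vebSize l < B)
  obtain ⟨rfl, -⟩ | ⟨a, b, ha, hb, haX, hbX, hab⟩ := hE
  · exact hxX.elim
  have haddr : i * (lam + 1) + l < B := by
    have := Nat.mul_le_mul_right (lam + 1) (Nat.succ_le_of_lt hi.lt_vebSize)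
    rw [Nat.succ_mul] at this
    omega
  have hn : ∀ {p : ℕ → ℕ → Prop} (v : ℕ) (f : ℕ → ℕ), ¬p l i →
      VebAgree (lam + 1) p f (Function.update f (i * (lam + 1) + l) v) :=
    fun v f hp => VebAgree.rfl.update (by omega) hp
  rw [vebDeleteBody, wp_seq]
  refine wp_vebLoad he hl hi h40 h41 h11 h12 fun s₁ a₁ f₁ r44 r45 r46 => ?_
  have f40 : VebFrame s s₁ := ⟨fun r hr => f₁ r (by omega), fun _ _ _ => by rw [a₁]⟩
  have hlt : ∀ z ∈ X \ {x}, z < vebSize l := fun z hz => hR.lt z hz.1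
  have hI := fun z => mem_innerPart (x := z) haX hbX hab
  have hal := hR.lt a haX
  have hbl := hR.lt b hbX
  have hxab := hab x hxX
  -- If the inner part is empty, then no recursive call is needed.
  have small : ∀ (s' : Store), innerPart X = ∅ →
      VebEnds (s'.arr 11 (i * (lam + 1) + l)) (s'.arr 12 (i * (lam + 1) + l)) (X \ {x}) →
      (∀ p : ℕ → ℕ → Prop, ¬p l i → VebAgree (lam + 1) p (s.arr 11) (s'.arr 11) ∧
        VebAgree (lam + 1) p (s.arr 12) (s'.arr 12)) →
      VebDone lam l i s (X \ {x}) (s'.arr 11) (s'.arr 12) := by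
    intro s' h he' hag
    have h1 := hag (fun k j => VebSub l i k j ∧ ¬(k = l ∧ j = i)) (by simp)
    have h2 := hag (fun k j => ¬VebSub l i k j) (not_not.2 (.refl _ _))
    refine ⟨hR.of_inner_eq (by omega) ?_ hlt he' h1.1 h1.2, h2⟩
    rw [h]
    refine innerPart_of_pair (a := a) (b := b) fun z hz => ?_
    by_contra hne
    rw [not_or] at hne
    have : z ∈ innerPart X := (hI z).2 ⟨hz.1, hne⟩
    rw [h] at this
    exact this
  -- Otherwise, the recursive call deletes from the inner part: `x`, or the element that replaces an
  -- end.
  have large : ∀ (s' : Store) (y : ℕ), VebFrame s s' →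
      s'.reg 40 = l → s'.reg 41 = i → s'.reg 42 = y → s'.reg 43 = 1 →
      y ∈ innerPart X → innerPart (X \ {x}) = innerPart X \ {y} →
      VebEnds (s'.arr 11 (i * (lam + 1) + l)) (s'.arr 12 (i * (lam + 1) + l)) (X \ {x}) →
      (∀ p : ℕ → ℕ → Prop, ¬p l i → VebAgree (lam + 1) p (s.arr 11) (s'.arr 11) ∧
        VebAgree (lam + 1) p (s.arr 12) (s'.arr 12)) →
      WP D B vebDeleteRec s' fun t s'' => t ≤ 70 ∧
        ∃ l', l = l' + 1 ∧ VebDesc lam (fun x X => X \ {x}) (fun x X => x ∈ X) l' i s s''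
          (VebDone lam l i s (X \ {x})) := by
    intro s' y hf r40 r41 r42 r43 hyX hin he' hag
    obtain ⟨hyX', hya, hyb⟩ := (hI y).1 hyX
    obtain ⟨l, rfl⟩ : ∃ l', l = l' + 1 := by
      refine Nat.exists_eq_succ_of_ne_zero ?_
      rintro rfl
      have := hab y hyX'
      rw [show vebSize 0 = 2 from rfl] at *
      omega
    have h1 := hag (VebBelow l i) VebBelow.not_self
    refine wp_vebDeleteRec (he.of_frame hf) hl hi r40 r41 r42 (hR.lt y hyX') hyX
      (hR.kids.congr (by omega) h1.1 h1.2) fun t ht s'' hs'' => ⟨ht, l, rfl, ?_⟩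
    obtain ⟨i', x', X', hf', q40, q41, q42, q43, hs, hx', hp', hR', hG⟩ := hs''
    refine ⟨i', x', X', hf.trans hf', q40, q41, q42, by rw [q43, r43, h43], hs, hx', hp', hR',
      fun f g hR'' hg₁ hg₂ => ?_⟩
    obtain ⟨hK, k1, k2⟩ := hG f g hR'' hg₁ hg₂
    have h2 := hag (fun k j => ¬VebSub (l + 1) i k j) (not_not.2 (.refl _ _))
    refine ⟨⟨hlt, ?_, hin ▸ hK⟩, h2.1.trans (k1.mono fun _ _ => VebBelow.not_of_not_vebSub),
      h2.2.trans (k2.mono fun _ _ => VebBelow.not_of_not_vebSub)⟩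
    rw [k1 _ _ (by omega) VebBelow.not_self, k2 _ _ (by omega) VebBelow.not_self]
    exact he'
  rw [wp_branch]
  simp only [Expr.eval, Expr.cost, r45, r46]
  constructor
  · intro h
    have h : s.arr 11 (i * (lam + 1) + l) = s.arr 12 (i * (lam + 1) + l) := by simpa using h
    obtain rfl : a = b := by omega
    obtain rfl : x = a := by omega
    simp only [wp_seq, wp_assign, wp_write, Expr.eval, Expr.cost, Store.setReg_reg,
      Store.setCell_reg, Nat.reduceEqDiff, reduceIte, r44]
    have fr := ((f40.setReg (r := 43) (v := 0) (by norm_num)).setCell (a := 11)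
      (j := i * (lam + 1) + l) (v := 0) (.inl rfl)).setCell (a := 12)
      (j := i * (lam + 1) + l) (v := 0) (.inr rfl)
    refine ⟨by omega, haddr, by omega, haddr, by omega, by omega, .inl ⟨fr, by simp,
      small _ (innerPart_of_pair (a := x) (b := x) fun z hz => ?_) (.inl ⟨?_, by simp, by simp⟩)
        fun p hp => by simp [a₁, hn _ _ hp]⟩⟩
    · have := hab z hz; omega
    · refine Set.eq_empty_of_forall_notMem fun z hz => hz.2 ?_
      have := hab z hz.1
      exact (show z = x by omega)
  · intro hne
    have h : a ≠ b := fun e => by simp [ha, hb, e] at hne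
    clear hne
    have h8 : s.arr 8 (l - 1) = vebSize (l - 1) := he.table _ (by omega)
    have hu : vebSize (l - 1) ≤ vebSize l := vebSize_mono (by omega)
    rw [wp_seq, wp_assign]
    simp only [Expr.eval, Expr.cost, a₁, f₁ 40 (by norm_num), h40, h8]
    refine ⟨by omega, ?_⟩
    set s₂ := s₁.setReg 47 (vebSize (l - 1)) with hs₂
    have a₂ : s₂.arr = s.arr := by rw [hs₂, Store.setReg_arr, a₁]
    have f₂ : VebFrame s s₂ := f40.setReg (by norm_num)
    have q : s₂.reg 40 = l ∧ s₂.reg 41 = i ∧ s₂.reg 42 = x ∧ s₂.reg 43 = 1 ∧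
        s₂.reg 44 = i * (lam + 1) + l ∧ s₂.reg 45 = a + 1 ∧ s₂.reg 46 = b + 1 ∧
        s₂.reg 47 = vebSize (l - 1) ∧ s₂.reg 6 = lam + 1 := by
      simp [hs₂, f₁, h40, h41, h42, h43, r44, r45, r46, ha, hb, he.width]
    clear_value s₂
    obtain ⟨q40, q41, q42, q43, q44, q45, q46, q47, q6⟩ := q
    have hempty : (Expr.equal (.times (.reg 40) (vebSummaryEnd 11)) (.lit 0)).eval s₂ =
        if innerPart X = ∅ then 1 else 0 := by
      simp only [vebSummaryEnd, Expr.eval, q40, q41, q47, q6, a₂]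
      refine if_congr ?_ rfl rfl
      cases l with
      | zero =>
        refine iff_of_true (Nat.zero_mul _) (innerPart_of_pair (a := 0) (b := 1) fun z hz => ?_)
        have := hR.lt z hz
        rw [show vebSize 0 = 2 from rfl] at this
        omega
      | succ l =>
        rw [mul_eq_zero, or_iff_right (by omega)]
        exact hR.kids.summary_eq_zero_iff
    have hcost : (Expr.equal (.times (.reg 40) (vebSummaryEnd 11)) (.lit 0)).cost = 18 := rfl
    have hcost' : ∀ c, (vebInnerEnd c).cost = 50 := fun c => rfl
    have hsucc : innerPart X ≠ ∅ → ∃ l', l = l' + 1 := by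
      refine fun hne => Nat.exists_eq_succ_of_ne_zero ?_
      rintro rfl
      refine hne (innerPart_of_pair (a := 0) (b := 1) fun z hz => ?_)
      have := hR.lt z hz
      rw [show vebSize 0 = 2 from rfl] at this
      omega
    have hpair : innerPart X = ∅ → ∀ z ∈ X, z = a ∨ z = b := by
      intro h z hz
      by_contra hne
      rw [not_or] at hne
      have : z ∈ innerPart X := (hI z).2 ⟨hz, hne⟩
      rw [h] at this
      exact this
    simp only [wp_branch, hempty, hcost]
    simp only [wp_seq, wp_assign, wp_write, Expr.eval, Expr.cost,
      Store.setReg_reg, Nat.reduceEqDiff, reduceIte, q42, q44, q45, q46, hcost']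
    refine ⟨fun hx0 => ⟨fun h0 => ?_, fun h0 => ?_⟩,
      fun hx0 => ⟨fun hx1 => ⟨fun h0 => ?_, fun h0 => ?_⟩, fun hx1 => ?_⟩⟩
    · have h0 : innerPart X = ∅ := by simpa using h0
      obtain rfl : x = a := by simpa using hx0
      refine ⟨haddr, by omega, by omega, by omega, .inl
        ⟨(f₂.setCell (.inl rfl)).setReg (by norm_num), by simp, small _ h0 (.inr ⟨b, b, by simp,
          by simp [a₂, hb], ⟨hbX, h.symm⟩, ⟨hbX, h.symm⟩, ?_⟩)
        fun p hp => by simp [a₂, hn _ _ hp, VebAgree.rfl]⟩⟩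
      rintro z ⟨hz, hzx⟩
      have := (hpair h0 z hz).resolve_left hzx
      omega
    · have h0 : innerPart X ≠ ∅ := by simpa using h0
      obtain rfl : x = a := by simpa using hx0
      obtain ⟨l, rfl⟩ := hsucc h0
      obtain ⟨h', c, h1, h2, hy, hmin⟩ := hR.kids.min h0
      have hv : (vebInnerEnd 11).eval s₂ = h' * vebSize l + c := by
        rw [vebChild] at h1 h2
        simp only [vebInnerEnd, vebSummaryEnd, Expr.eval, q40, q41, q47, q6, a₂,
          Nat.add_sub_cancel, h1, h2]
      rw [hv]
      have hyX := hR.lt _ (innerPart_subset hy)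
      refine ⟨by omega, haddr, by omega, (large _ _ ((f₂.setReg (by norm_num)).setCell (.inl rfl))
        (by simp [q40]) (by simp [q41]) (by simp) (by simp [q43]) hy
        (innerPart_diff_min haX hbX hab hy hmin)
        (.inr ⟨_, b, by simp, by simp [a₂, hb], ⟨innerPart_subset hy, ((hI _).1 hy).2.1⟩,
          ⟨hbX, h.symm⟩, fun z hz => ⟨?_, (hab z hz.1).2⟩⟩)
        fun p hp => by simp [a₂, hn _ _ hp, VebAgree.rfl]).mono fun t s' ⟨ht, hs⟩ =>
        ⟨by omega, .inr hs⟩⟩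
      by_cases hzb : z = b
      · rw [hzb]; exact (hab _ (innerPart_subset hy)).2
      · exact hmin z ((hI z).2 ⟨hz.1, hz.2, hzb⟩)
    · have h0 : innerPart X = ∅ := by simpa using h0
      obtain rfl : x = b := by simpa using hx1
      refine ⟨haddr, by omega, by omega, by omega, .inl
        ⟨(f₂.setCell (.inr rfl)).setReg (by norm_num), by simp, small _ h0 (.inr ⟨a, a,
          by simp [a₂, ha], by simp, ⟨haX, h⟩, ⟨haX, h⟩, ?_⟩)
        fun p hp => by simp [a₂, hn _ _ hp, VebAgree.rfl]⟩⟩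
      rintro z ⟨hz, hzx⟩
      have := (hpair h0 z hz).resolve_right hzx
      omega
    · have h0 : innerPart X ≠ ∅ := by simpa using h0
      obtain rfl : x = b := by simpa using hx1
      obtain ⟨l, rfl⟩ := hsucc h0
      obtain ⟨h', c, h1, h2, hy, hmax⟩ := hR.kids.max h0
      have hv : (vebInnerEnd 12).eval s₂ = h' * vebSize l + c := by
        rw [vebChild] at h1 h2
        simp only [vebInnerEnd, vebSummaryEnd, Expr.eval, q40, q41, q47, q6, a₂,
          Nat.add_sub_cancel, h1, h2]
      rw [hv]
      have hyX := hR.lt _ (innerPart_subset hy)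
      refine ⟨by omega, haddr, by omega, (large _ _ ((f₂.setReg (by norm_num)).setCell (.inr rfl))
        (by simp [q40]) (by simp [q41]) (by simp) (by simp [q43]) hy
        (innerPart_diff_max haX hbX hab hy hmax)
        (.inr ⟨a, _, by simp [a₂, ha], by simp, ⟨haX, h⟩,
          ⟨innerPart_subset hy, ((hI _).1 hy).2.2⟩, fun z hz => ⟨(hab z hz.1).1, ?_⟩⟩)
        fun p hp => by simp [a₂, hn _ _ hp, VebAgree.rfl]).mono fun t s' ⟨ht, hs⟩ =>
        ⟨by omega, .inr hs⟩⟩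
      by_cases hza : z = a
      · rw [hza]; exact (hab _ (innerPart_subset hy)).1
      · exact hmax z ((hI z).2 ⟨hz.1, hza, hz.2⟩)
    · have hx0 : x ≠ a := by simpa using hx0
      have hx1 : x ≠ b := by simpa using hx1
      have hxI := (hI x).2 ⟨hxX, hx0, hx1⟩
      refine (large _ x f₂ q40 q41 q42 q43 hxI (innerPart_diff_of_mem haX hbX hab hxI)
        (.inr ⟨a, b, by simp [a₂, ha], by simp [a₂, hb], ⟨haX, Ne.symm hx0⟩, ⟨hbX, Ne.symm hx1⟩,
          fun z hz => hab z hz.1⟩)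
        fun p hp => by simp [a₂, VebAgree.rfl]).mono fun t s' ⟨ht, hs⟩ => ⟨by omega, .inr hs⟩

/-! ### Successor search in van Emde Boas trees -/

/-- The root of the tree in the arrays 11 and 12 holds `X`. -/
def VebSet (lam : ℕ) (s : Store) (X : Set ℕ) : Prop :=
  VebRep (lam + 1) (s.arr 11) (s.arr 12) lam 0 X

theorem VebRep.empty {W : ℕ} (l i : ℕ) : VebRep W (fun _ => 0) (fun _ => 0) l i ∅ := by
  induction l generalizing i with
  | zero => exact ⟨by simp, .inl ⟨rfl, rfl, rfl⟩⟩
  | succ l ih =>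
    refine ⟨by simp, .inl ⟨rfl, rfl, rfl⟩, fun h _ => ?_, ?_⟩ <;> rw [innerPart_empty]
    · rw [show clusterSet (vebSize l) ∅ h = ∅ by ext; simp [clusterSet]]
      exact ih _
    · rw [show summarySet (vebSize l) ∅ = ∅ by ext; simp [summarySet]]
      exact ih _

/-- Start an operation with argument `e` at the root and repeat `body` until it is complete. -/
def vebRun (body : Cmd) (e : Expr) : Cmd :=
  .assign 42 e ;; .assign 40 (.reg 5) ;; .assign 41 (.lit 0) ;; .assign 43 (.lit 1) ;;
    .loop (.reg 43) body

/-- What a van Emde Boas operation relies on at its start. -/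
theorem wp_vebRun {D : Subroutines} {B lam x : ℕ} {s : Store} {Q : ℕ → Store → Prop} {body : Cmd}
    {e : Expr} (he : VebEnv B lam s) (hx : x < vebSize lam) (hxe : e.eval s = x)
    (hQ : ∀ s', VebFrame s s' → s'.arr = s.arr → s'.reg 40 = lam → s'.reg 41 = 0 → s'.reg 42 = x →
      s'.reg 43 = 1 → WP D B (.loop (.reg 43) body) s' fun t s'' => Q (t + e.cost + 7) s'') :
    WP D B (vebRun body e) s Q := by
  have hlam : vebSize lam ≤ vebSize lam * (lam + 1) := Nat.le_mul_of_pos_right _ (by omega)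
  have hl := lt_vebSize lam
  have hB := he.bound
  simp only [vebRun, wp_seq, wp_assign, hxe, Expr.eval, Expr.cost, Store.setReg_reg,
    Nat.reduceEqDiff, reduceIte, he.top]
  refine ⟨by omega, by omega, by omega, by omega, ?_⟩
  refine (hQ _ ((((VebFrame.refl s).setReg (by norm_num)).setReg (by norm_num)).setReg
    (by norm_num)|>.setReg (by norm_num)) rfl (by simp) (by simp) (by simp) (by simp)).mono
    fun t s' h => ?_
  convert h using 1
  omega

theorem VebStep.run {D : Subroutines} {B lam x : ℕ} {s : Store} {X : Set ℕ} {body : Cmd} {e : Expr}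
    {op : ℕ → Set ℕ → Set ℕ} {pre : ℕ → Set ℕ → Prop} (hb : VebStep D B lam body op pre)
    (he : VebEnv B lam s) (hX : VebSet lam s X) (hx : x < vebSize lam) (hxe : e.eval s = x)
    (hp : pre x X) :
    WP D B (vebRun body e) s fun t s' =>
      t ≤ 210 * (lam + 1) + e.cost + 7 ∧ VebFrame s s' ∧ VebSet lam s' (op x X) := by
  refine wp_vebRun he hx hxe fun s' hf ha r40 r41 r42 r43 => ?_
  exact (hb.loop (he.of_frame hf) le_rfl (.refl _ _) r40 r41 r42 r43 hx hp
    (by rw [ha]; exact hX)).mono fun t s'' ⟨ht, hf', hR, _⟩ => ⟨by omega, hf.trans hf', hR⟩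

/-- `(k, j, r)` is one level below `(l, i, v)`: the element `v` of node `i` on level `l` is
represented by the element `r` of its child node `j` on level `k = l - 1`. An element `r` of the
summary represents the least element of cluster `r`. -/
def VebUp (W : ℕ) (f : ℕ → ℕ) (a b : ℕ × ℕ × ℕ) : Prop :=
  b.1 = a.1 + 1 ∧ a.2.2 < vebSize a.1 ∧
    ((∃ h < vebSize a.1, a.2.1 = vebChild a.1 b.2.1 h ∧ b.2.2 = h * vebSize a.1 + a.2.2) ∨
      (a.2.1 = vebChild a.1 b.2.1 (vebSize a.1) ∧ ∃ m < vebSize a.1,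
        f (vebChild a.1 b.2.1 a.2.2 * W + a.1) = m + 1 ∧ b.2.2 = a.2.2 * vebSize a.1 + m))

/-- One level of the search for the least element that is at least register 42, on the way down. If
the answer is an end of the current node, it is put into register 52, and register 43 is set to 0.
Otherwise the search goes on in the cluster of register 42, or in the summary if the greatest
element of that cluster is too small. -/
def vebSuccBody : Cmd :=
  vebLoad ;;
  .branch (.less (.reg 42) (.reg 45))
    (.assign 52 (.minus (.reg 45) (.lit 1)) ;; .assign 43 (.lit 0))
    (.branch (.equal (.reg 40) (.lit 0))
      (.assign 52 (.minus (.reg 46) (.lit 1)) ;; .assign 43 (.lit 0))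
      (vebDescend ;;
        .branch (.less (.reg 49) (.read 12 (.reg 51)))
          (.assign 41 (.reg 50) ;; .assign 42 (.reg 49))
          (.branch (.less (.plus (.reg 48) (.lit 1)) (.read 12 (.plus (.times
              (.plus (.times (.reg 41) (.plus (.reg 47) (.lit 1))) (.reg 47)) (.reg 6)) (.reg 40))))
            (.assign 41 (.plus (.times (.reg 41) (.plus (.reg 47) (.lit 1))) (.reg 47)) ;;
              .assign 42 (.plus (.reg 48) (.lit 1)))
            (.assign 40 (.plus (.reg 40) (.lit 1)) ;;
              .assign 52 (.minus (.reg 46) (.lit 1)) ;; .assign 43 (.lit 0)))))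

theorem wp_vebSuccBody {D : Subroutines} {B lam l i x : ℕ} {s : Store} {X : Set ℕ}
    (he : VebEnv B lam s) (hl : l ≤ lam) (hi : VebSub lam 0 l i) (h40 : s.reg 40 = l)
    (h41 : s.reg 41 = i) (h42 : s.reg 42 = x) (h43 : s.reg 43 = 1) (hx : x < vebSize l)
    (hxX : ∃ y ∈ X, x ≤ y) (hR : VebRep (lam + 1) (s.arr 11) (s.arr 12) l i X) :
    WP D B vebSuccBody s fun t s' => t ≤ 110 ∧ VebFrame s s' ∧ s'.arr = s.arr ∧
      ((s'.reg 43 = 0 ∧ s'.reg 40 = l ∧ s'.reg 41 = i ∧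
          IsLeast {y | y ∈ X ∧ x ≤ y} (s'.reg 52)) ∨
        ∃ l' i' x' X', l = l' + 1 ∧ s'.reg 40 = l' ∧ s'.reg 41 = i' ∧ s'.reg 42 = x' ∧
          s'.reg 43 = 1 ∧ x' < vebSize l' ∧ (∃ y ∈ X', x' ≤ y) ∧ VebSub l i l' i' ∧
          VebRep (lam + 1) (s.arr 11) (s.arr 12) l' i' X' ∧
          ∀ v', IsLeast {y | y ∈ X' ∧ x' ≤ y} v' → ∃ v, IsLeast {y | y ∈ X ∧ x ≤ y} v ∧
            VebUp (lam + 1) (s.arr 11) (l', i', v') (l, i, v)) := by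
  have hB := he.bound
  have hul : vebSize l ≤ vebSize lam := vebSize_mono hl
  have hlam : vebSize lam ≤ vebSize lam * (lam + 1) := Nat.le_mul_of_pos_right _ (by omega)
  have hE := hR.ends
  obtain ⟨h11, h12⟩ := hE.lt_of hR.lt (by omega : vebSize l < B)
  obtain ⟨y₀, hy₀, hxy₀⟩ := hxX
  obtain ⟨rfl, -⟩ | ⟨a, b, ha, hb, haX, hbX, hab⟩ := hE
  · exact hy₀.elim
  have hxb : x ≤ b := hxy₀.trans (hab y₀ hy₀).2
  have hI := fun z => mem_innerPart (x := z) haX hbX hab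
  have hal := hR.lt a haX
  have hbl := hR.lt b hbX
  rw [vebSuccBody, wp_seq]
  refine wp_vebLoad he hl hi h40 h41 h11 h12 fun s₁ a₁ f₁ r44 r45 r46 => ?_
  have f40 : VebFrame s s₁ := ⟨fun r hr => f₁ r (by omega), fun _ _ _ => by rw [a₁]⟩
  simp only [wp_branch, wp_seq, wp_assign, Expr.eval, Expr.cost, Store.setReg_reg, r45, r46,
    f₁ 42 (by norm_num), f₁ 40 (by norm_num), h40, h42, ha, hb, Nat.add_sub_cancel]
  refine ⟨fun hxa => ?_, fun hxa => ⟨fun h0 => ?_, fun h0 => ?_⟩⟩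
  · have hxa : x ≤ a := by simpa [Nat.lt_succ_iff] using hxa
    refine ⟨by omega, by omega, by omega, (f40.setReg (by norm_num)).setReg (by norm_num), a₁,
      .inl ⟨by simp, by simp, by simp [f₁, h41], ?_⟩⟩
    simp only [Nat.reduceEqDiff, reduceIte]
    exact ⟨⟨haX, hxa⟩, fun z hz => (hab z hz.1).1⟩
  · have hxa : a < x := by simpa [Nat.lt_succ_iff] using hxa
    have h0 : l = 0 := by simpa using h0
    subst h0
    refine ⟨by omega, by omega, by omega, (f40.setReg (by norm_num)).setReg (by norm_num), a₁,
      .inl ⟨by simp, by simp, by simp [f₁, h41], ?_⟩⟩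
    simp only [Nat.reduceEqDiff, reduceIte]
    refine ⟨⟨hbX, hxb⟩, fun z hz => ?_⟩
    have := hz.2
    rw [show vebSize 0 = 2 from rfl] at *
    omega
  · have hxa : a < x := by simpa [Nat.lt_succ_iff] using hxa
    have h0 : l ≠ 0 := by simpa using h0
    obtain ⟨l, rfl⟩ := Nat.exists_eq_succ_of_ne_zero h0
    clear h0
    simp only [Nat.succ_eq_add_one] at *
    have hu := two_le_vebSize l
    have hul' : vebSize l ≤ vebSize (l + 1) := vebSize_mono (by omega)
    have hd : x / vebSize l < vebSize l := by
      rw [vebSize_succ] at hx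
      exact Nat.div_lt_of_lt_mul hx
    have hm : x % vebSize l < vebSize l := Nat.mod_lt _ (by omega)
    have hK := hR.kids
    have hC := hK.1 _ hd
    have hS := hK.2
    have hc := (hi.trans (vebSub_child hd.le)).lt_vebSize
    have hc' := (hi.trans (vebSub_child le_rfl)).lt_vebSize
    have hdm := Nat.div_add_mod' x (vebSize l)
    refine wp_vebDescend (he.of_frame f40) hl hi (by rw [f₁ _ (by norm_num), h40])
      (by rw [f₁ _ (by norm_num), h41]) (by rw [f₁ _ (by norm_num), h42]) hx
      fun t ht s₂ a₂ f₂ q40 q41 q42 q43 q46 q47 q48 q49 q50 q51 => ?_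
    rw [a₁] at a₂
    rw [f₁ _ (by norm_num), h43] at q43
    have f₂' : VebFrame s s₂ := ⟨fun r hr => (f₂ r hr).trans (f₁ r (by omega)),
      fun _ _ _ => by rw [a₂]⟩
    have hsum : (i * (vebSize l + 1) + vebSize l) = vebChild l i (vebSize l) := rfl
    simp only [a₂, f₂'.1 6 (by norm_num), he.width, q40, q41, q46, q47, q48, q49, q50, q51, r46,
      hb, hsum, Nat.add_sub_cancel, Nat.reduceEqDiff, reduceIte]
    refine ⟨fun h1 => ?_, fun h1 => ⟨fun h2 => ?_, fun h2 => ?_⟩⟩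
    · -- Some element of the cluster of `x` is large enough.
      have h1 : x % vebSize l < s.arr 12 (vebChild l i (x / vebSize l) * (lam + 1) + l) := by
        simpa using h1
      refine ⟨by omega, by omega, by omega, (f₂'.setReg (by norm_num)).setReg (by norm_num), a₂,
        .inr ⟨l, vebChild l i (x / vebSize l), x % vebSize l, _, rfl, by simp, by simp,
        by simp, by simp [q43], hm, ?_, vebSub_child hd.le, hC, fun v' hv' =>
        ⟨x / vebSize l * vebSize l + v', ⟨⟨innerPart_subset hv'.1.1.2, ?_⟩, fun z hz => ?_⟩,
          rfl, hv'.1.1.1, .inl ⟨_, hd, rfl, rfl⟩⟩⟩⟩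
      · obtain ⟨-, -, h2⟩ | ⟨-, c, -, h2, -, hc, -⟩ := hC.ends
        · omega
        · exact ⟨c, hc, by omega⟩
      · have := hv'.1.2; omega
      · have hvb := (hab _ (innerPart_subset hv'.1.1.2)).2
        by_cases hzb : z = b
        · omega
        have hzI := (hI z).2 ⟨hz.1, by have := hz.2; omega, hzb⟩
        obtain h3 | h3 := (Nat.div_le_div_right (c := vebSize l) hz.2).lt_or_eq
        · have := Nat.mul_le_mul_right (vebSize l) (Nat.succ_le_of_lt h3)
          have := Nat.div_add_mod' z (vebSize l)
          have := hv'.1.1.1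
          rw [Nat.succ_mul] at *
          omega
        · have h4 := Nat.div_add_mod' z (vebSize l)
          have h5 : v' ≤ z % vebSize l := by
            refine hv'.2 ⟨?_, ?_⟩
            · rw [h3]; exact (mem_clusterSet_div (by omega)).2 hzI
            · have := hz.2; rw [h3] at hdm; omega
          rw [h3]; omega
    · -- The next nonempty cluster contains the answer.
      have h1 : s.arr 12 (vebChild l i (x / vebSize l) * (lam + 1) + l) ≤ x % vebSize l := by
        simpa using h1
      have h2 : x / vebSize l + 1 < s.arr 12 (vebChild l i (vebSize l) * (lam + 1) + l) := by
        simpa using h2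
      obtain ⟨c, hc, hS2⟩ : ∃ c ∈ summarySet (vebSize l) (innerPart X), x / vebSize l + 1 ≤ c := by
        obtain ⟨-, -, h3⟩ | ⟨-, c, -, h3, -, hc, -⟩ := hS.ends
        · omega
        · exact ⟨c, hc, by omega⟩
      have hcl := hS.lt c hc
      refine ⟨by omega, by omega, by omega, (f₂'.setReg (by norm_num)).setReg (by norm_num), a₂,
        .inr ⟨l, vebChild l i (vebSize l), x / vebSize l + 1, _, rfl, by simp, by simp,
        by simp, by simp [q43], by omega, ⟨c, hc, hS2⟩, vebSub_child le_rfl, hS,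
        fun v' hv' => ?_⟩⟩
      have hvl := hS.lt _ hv'.1.1
      obtain ⟨hE, -⟩ | ⟨m, _, hm1, -, hm2, -, hm3⟩ := (hK.1 v' hvl).ends
      · exact absurd hE (mem_summarySet_iff.1 hv'.1.1)
      have hmX := hm2.2
      have hvx : x ≤ v' * vebSize l + m := by
        have := Nat.mul_le_mul_right (vebSize l) hv'.1.2
        rw [Nat.succ_mul] at this
        omega
      refine ⟨v' * vebSize l + m, ⟨⟨innerPart_subset hmX, hvx⟩, fun z hz => ?_⟩, rfl, hvl,
        .inr ⟨rfl, m, hm2.1, hm1, rfl⟩⟩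
      have hvb := (hab _ (innerPart_subset hmX)).2
      by_cases hzb : z = b
      · omega
      have hzI := (hI z).2 ⟨hz.1, by have := hz.2; omega, hzb⟩
      have h4 := Nat.div_add_mod' z (vebSize l)
      obtain h3 | h3 := (Nat.div_le_div_right (c := vebSize l) hz.2).lt_or_eq
      · have h5 := hv'.2 ⟨mem_summarySet_div (by omega) hzI, h3⟩
        obtain h6 | h6 := h5.lt_or_eq
        · have := Nat.mul_le_mul_right (vebSize l) (Nat.succ_le_of_lt h6)
          have := hm2.1
          rw [Nat.succ_mul] at *
          omega
        · have h7 := (hm3 _ (by rw [h6]; exact (mem_clusterSet_div (by omega)).2 hzI)).1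
          rw [h6]; omega
      · have h5 : z % vebSize l ∈ clusterSet (vebSize l) (innerPart X) (x / vebSize l) := by
          rw [h3]; exact (mem_clusterSet_div (by omega)).2 hzI
        have := hz.2
        rw [h3] at hdm
        obtain ⟨hE, -⟩ | ⟨_, d, -, h6, _, -, hd'⟩ := hC.ends
        · rw [hE] at h5; exact h5.elim
        · have := (hd' _ h5).2
          omega
    · -- No element of the inner part is large enough.
      have h1 : s.arr 12 (vebChild l i (x / vebSize l) * (lam + 1) + l) ≤ x % vebSize l := by
        simpa using h1
      have h2 : s.arr 12 (vebChild l i (vebSize l) * (lam + 1) + l) ≤ x / vebSize l + 1 := by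
        simpa using h2
      have hll := lt_vebSize l
      refine ⟨by omega, by omega, by omega, by omega, ((f₂'.setReg (by norm_num)).setReg
        (by norm_num)).setReg (by norm_num), a₂, .inl ⟨by simp, by simp, by simp, ?_⟩⟩
      refine ⟨⟨hbX, hxb⟩, fun z hz => ?_⟩
      by_contra hzb
      have hzb : z < b := by omega
      have hzI := (hI z).2 ⟨hz.1, by have := hz.2; omega, hzb.ne⟩
      have h4 := Nat.div_add_mod' z (vebSize l)
      obtain h3 | h3 := (Nat.div_le_div_right (c := vebSize l) hz.2).lt_or_eq
      · have h5 := mem_summarySet_div (u := vebSize l) (by omega) hzI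
        obtain ⟨hE, -⟩ | ⟨_, d, -, h6, _, -, hd'⟩ := hS.ends
        · rw [hE] at h5; exact h5.elim
        · have := (hd' _ h5).2
          omega
      · have h5 : z % vebSize l ∈ clusterSet (vebSize l) (innerPart X) (x / vebSize l) := by
          rw [h3]; exact (mem_clusterSet_div (by omega)).2 hzI
        have := hz.2
        rw [h3] at hdm
        obtain ⟨hE, -⟩ | ⟨_, d, -, h6, _, -, hd'⟩ := hC.ends
        · rw [hE] at h5; exact h5.elim
        · have := (hd' _ h5).2
          omega

theorem wp_vebSuccLoop {D : Subroutines} {B lam l i x : ℕ} {s : Store} {X : Set ℕ}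
    (he : VebEnv B lam s) (hl : l ≤ lam) (hi : VebSub lam 0 l i) (h40 : s.reg 40 = l)
    (h41 : s.reg 41 = i) (h42 : s.reg 42 = x) (h43 : s.reg 43 = 1) (hx : x < vebSize l)
    (hxX : ∃ y ∈ X, x ≤ y) (hR : VebRep (lam + 1) (s.arr 11) (s.arr 12) l i X) :
    WP D B (.loop (.reg 43) vebSuccBody) s fun t s' =>
      t ≤ 120 * (l + 1) ∧ VebFrame s s' ∧ s'.arr = s.arr ∧ s'.reg 41 < B ∧
      ∃ v, IsLeast {y | y ∈ X ∧ x ≤ y} v ∧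
        Relation.ReflTransGen (VebUp (lam + 1) (s.arr 11))
          (s'.reg 40, s'.reg 41, s'.reg 52) (l, i, v) := by
  have hiB : i < B := by
    have := he.bound
    have := hi.lt_vebSize
    have : vebSize lam ≤ vebSize lam * (lam + 1) := Nat.le_mul_of_pos_right _ (by omega)
    omega
  have aux := wp_vebSuccBody (D := D) he hl hi h40 h41 h42 h43 hx hxX hR
  induction l generalizing i x s X with
  | zero =>
    refine wp_loop_true (by simp [Expr.eval, h43]) (aux.mono fun t s' ⟨ht, hf, ha, h⟩ => ?_)
    obtain ⟨r43, r40, r41, hv⟩ | ⟨l', _, _, _, h', -⟩ := h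
    · refine wp_loop_false (by simp [Expr.eval, r43]) ⟨?_, hf, ha, by omega, _, hv, ?_⟩
      · simp only [Expr.cost]; omega
      · rw [r40, r41]
    · omega
  | succ l ih =>
    refine wp_loop_true (by simp [Expr.eval, h43]) (aux.mono fun t s' ⟨ht, hf, ha, h⟩ => ?_)
    obtain ⟨r43, r40, r41, hv⟩ |
      ⟨l', i', x', X', h', r40, r41, r42, r43, hx', hxX', hs, hR', hup⟩ := h
    · refine wp_loop_false (by simp [Expr.eval, r43]) ⟨?_, hf, ha, by omega, _, hv, ?_⟩
      · simp only [Expr.cost]; omega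
      · rw [r40, r41]
    · obtain rfl : l' = l := by omega
      rw [← ha] at hR'
      have he' := he.of_frame hf
      have hi' := hi.trans hs
      have hiB' : i' < B := by
        have := he.bound
        have := hi'.lt_vebSize
        have : vebSize lam ≤ vebSize lam * (lam + 1) := Nat.le_mul_of_pos_right _ (by omega)
        omega
      refine (ih he' (by omega) hi' r40 r41 r42 r43 hx' hxX' hR' hiB'
        (wp_vebSuccBody he' (by omega) hi' r40 r41 r42 r43 hx' hxX' hR')).mono
        fun t' s'' ⟨ht', hf', ha', h41', v', hv', hpath⟩ => ?_
      obtain ⟨v, hv, hstep⟩ := hup v' hv'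
      refine ⟨?_, hf.trans hf', ha'.trans ha, h41', v, hv, .tail (ha ▸ hpath) hstep⟩
      simp only [Expr.cost]; omega

/-- The way up: register 52, an element of node number register 41 on level register 40, is replaced
by the element of the root that it represents. -/
def vebLift : Cmd :=
  .loop (.less (.reg 40) (.reg 5))
    (.assign 47 (.read 8 (.reg 40)) ;;
      .assign 48 (.rem (.reg 41) (.plus (.reg 47) (.lit 1))) ;;
      .assign 41 (.quot (.reg 41) (.plus (.reg 47) (.lit 1))) ;;
      .branch (.less (.reg 48) (.reg 47))
        (.assign 52 (.plus (.times (.reg 48) (.reg 47)) (.reg 52)))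
        (.assign 52 (.plus (.times (.reg 52) (.reg 47)) (.minus (.read 11 (.plus (.times
          (.plus (.times (.reg 41) (.plus (.reg 47) (.lit 1))) (.reg 52)) (.reg 6)) (.reg 40)))
          (.lit 1)))) ;;
      .assign 40 (.plus (.reg 40) (.lit 1)))

theorem vebChild_div_mod {l i c : ℕ} (hc : c ≤ vebSize l) :
    vebChild l i c / (vebSize l + 1) = i ∧ vebChild l i c % (vebSize l + 1) = c := by
  obtain ⟨h1, h2⟩ := eq_div_mod (u := vebSize l + 1) (h := i) (l := c) (by omega) rfl
  exact ⟨h1.symm, h2.symm⟩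

theorem VebUp.level_le {W : ℕ} {f : ℕ → ℕ} {a b : ℕ × ℕ × ℕ}
    (h : Relation.ReflTransGen (VebUp W f) a b) : a.1 ≤ b.1 := by
  induction h with
  | refl => exact le_rfl
  | tail _ h ih => exact ih.trans (by rw [h.1]; omega)

theorem wp_vebLift {D : Subroutines} {B lam v : ℕ} {s : Store} {f : ℕ → ℕ} {a : ℕ × ℕ × ℕ}
    (he : VebEnv B lam s) (hf : s.arr 11 = f) (ha : a = (s.reg 40, s.reg 41, s.reg 52))
    (h41 : s.reg 41 < B) (h : Relation.ReflTransGen (VebUp (lam + 1) f) a (lam, 0, v)) :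
    WP D B vebLift s fun t s' => t ≤ 60 * (lam - s.reg 40) + 4 ∧ s.reg 40 ≤ lam ∧ VebFrame s s' ∧
      s'.arr = s.arr ∧ s'.reg 52 = v := by
  induction h using Relation.ReflTransGen.head_induction_on generalizing s with
  | refl =>
    simp only [Prod.mk.injEq] at ha
    obtain ⟨r40, r41, r52⟩ := ha
    refine wp_loop_false (by simp [Expr.eval, ← r40, he.top]) ⟨?_, r40.ge, .refl s, rfl, r52.symm⟩
    simp only [Expr.cost]; omega
  | @head a b hab hb ih =>
    subst ha
    have hbl := VebUp.level_le hb
    obtain ⟨l', i', r'⟩ := b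
    obtain ⟨h1, h2, h3⟩ := hab
    simp only at h1 h2 h3 hbl
    subst h1
    generalize r40 : s.reg 40 = l at *
    generalize r41 : s.reg 41 = i at *
    generalize r52 : s.reg 52 = r at *
    have hB := he.bound
    have hu := two_le_vebSize l
    have hul : vebSize l ≤ vebSize lam := vebSize_mono (by omega)
    have hul' : vebSize l * vebSize l ≤ vebSize lam := by
      rw [← vebSize_succ]; exact vebSize_mono (by omega)
    have hlam : vebSize lam ≤ vebSize lam * (lam + 1) := Nat.le_mul_of_pos_right _ (by omega)
    have hll := lt_vebSize lam
    have h8 : s.arr 8 l = vebSize l := he.table l (by omega)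
    have hr' : r' < B := by
      obtain ⟨h, hh, -, rfl⟩ | ⟨-, m, hm, -, rfl⟩ := h3
      · have := Nat.mul_le_mul_right (vebSize l) (Nat.succ_le_of_lt hh)
        rw [Nat.succ_mul] at this
        omega
      · have := Nat.mul_le_mul_right (vebSize l) (Nat.succ_le_of_lt h2)
        rw [Nat.succ_mul] at this
        omega
    refine wp_loop_true (by simp [Expr.eval, r40, he.top]; omega) ?_
    have key : ∀ (t : ℕ) (s' : Store), t ≤ 50 → VebFrame s s' → s'.arr = s.arr →
        s'.reg 40 = l + 1 → s'.reg 41 = i' → s'.reg 52 = r' → i' < B →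
        WP D B vebLift s' fun t' s'' => 3 + t + t' + 1 ≤ 60 * (lam - l) + 4 ∧ l ≤ lam ∧
          VebFrame s s'' ∧ s''.arr = s.arr ∧ s''.reg 52 = v := by
      intro t s' ht hf' ha' q40 q41 q52 hi'
      refine (ih (he.of_frame hf') (by rw [ha', hf]) (by rw [q40, q41, q52])
        (by rw [q41]; exact hi')).mono fun t' s'' ⟨ht', h4, hf'', ha'', hv⟩ =>
        ⟨by omega, by omega, hf'.trans hf'', ha''.trans ha', hv⟩
    simp only [wp_seq, wp_assign, wp_branch, Expr.eval, Expr.cost, Store.setReg_reg,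
      Store.setReg_arr, Nat.reduceEqDiff, reduceIte, r40, r41, r52, h8]
    have hm := Nat.mod_lt i (by omega : 0 < vebSize l + 1)
    have fr : VebFrame s (((s.setReg 47 (vebSize l)).setReg 48 (i % (vebSize l + 1))).setReg 41
        (i / (vebSize l + 1))) :=
      (((VebFrame.refl s).setReg (by norm_num)).setReg (by norm_num)).setReg (by norm_num)
    have hid := Nat.div_le_self i (vebSize l + 1)
    refine ⟨by omega, by omega, by omega, fun hc => ?_, fun hc => ?_⟩
    · have hc : i % (vebSize l + 1) < vebSize l := by simpa using hc
      obtain ⟨h, hh, rfl, rfl⟩ | ⟨rfl, -⟩ := h3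
      · obtain ⟨e1, e2⟩ := vebChild_div_mod (i := i') hh.le
        rw [e1, e2]
        refine ⟨hr', by omega, key _ _ (by omega) ?_ rfl ?_ ?_ ?_ ?_⟩
        · rw [e1, e2] at fr
          exact (fr.setReg (by norm_num)).setReg (by norm_num)
        · simp
        · simp
        · simp
        · omega
      · rw [(vebChild_div_mod le_rfl).2] at hc
        omega
    · have hc : vebSize l ≤ i % (vebSize l + 1) := by simpa using hc
      obtain ⟨h, hh, rfl, -⟩ | ⟨rfl, m, hm, hfm, rfl⟩ := h3
      · rw [(vebChild_div_mod hh.le).2] at hc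
        omega
      · obtain ⟨e1, e2⟩ := vebChild_div_mod (l := l) (i := i') le_rfl
        have hv : s.arr 11 ((i' * (vebSize l + 1) + r) * (lam + 1) + l) = m + 1 := hf ▸ hfm
        rw [e1, e2, he.width, hv, Nat.add_sub_cancel]
        refine ⟨hr', by omega, key _ _ (by omega) ?_ rfl ?_ ?_ ?_ ?_⟩
        · rw [e1, e2] at fr
          exact (fr.setReg (by norm_num)).setReg (by norm_num)
        · simp
        · simp
        · simp
        · omega

/-- The least element of the set that is at least `e`, in register 52. -/
def vebSucc (e : Expr) : Cmd := vebRun vebSuccBody e ;; vebLift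

theorem wp_vebSucc {D : Subroutines} {B lam x : ℕ} {s : Store} {X : Set ℕ} {e : Expr}
    (he : VebEnv B lam s) (hX : VebSet lam s X) (hx : x < vebSize lam) (hxe : e.eval s = x)
    (hxX : ∃ y ∈ X, x ≤ y) :
    WP D B (vebSucc e) s fun t s' => t ≤ 180 * (lam + 1) + e.cost + 11 ∧ VebFrame s s' ∧
      s'.arr = s.arr ∧ IsLeast {y | y ∈ X ∧ x ≤ y} (s'.reg 52) := by
  rw [vebSucc, wp_seq]
  refine wp_vebRun he hx hxe fun s₁ hf ha r40 r41 r42 r43 => ?_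
  refine (wp_vebSuccLoop (he.of_frame hf) le_rfl (.refl _ _) r40 r41 r42 r43 hx hxX
    (by rw [ha]; exact hX)).mono fun t s₂ ⟨ht, hf', ha', h41, v, hv, hp⟩ => ?_
  refine (wp_vebLift (v := v) ((he.of_frame hf).of_frame hf') rfl rfl h41 (by rwa [ha'])).mono
    fun t' s₃ ⟨ht', _, hf'', ha'', hv'⟩ => ⟨?_, (hf.trans hf').trans hf'', by rw [ha'', ha', ha],
      by rwa [hv']⟩
  omega

/-! ### Largest non-crossing matchings by thresholds -/

/-- `M` is a non-crossing matching in the (possibly infinite) graph `G`. -/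
def NonCrossingIn (G : Set (ℕ × ℕ)) (M : List (ℕ × ℕ)) : Prop :=
  (∀ e ∈ M, e ∈ G) ∧ M.Pairwise fun e f => e.1 < f.1 ∧ e.2 < f.2

theorem NonCrossingIn.mono {G G' : Set (ℕ × ℕ)} {M : List (ℕ × ℕ)} (h : NonCrossingIn G M)
    (hG : G ⊆ G') : NonCrossingIn G' M :=
  ⟨fun e he => hG (h.1 e he), h.2⟩

/-- The `k` records that end with number `r`, where record `r` is the edge `(P r, Q r)` and is
preceded by record `A r`. -/
def readChain (P Q A : ℕ → ℕ) : ℕ → ℕ → List (ℕ × ℕ)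
  | 0, _ => []
  | k + 1, r => readChain P Q A k (A r) ++ [(P r, Q r)]

theorem length_readChain (P Q A : ℕ → ℕ) (k r : ℕ) : (readChain P Q A k r).length = k := by
  induction k generalizing r with
  | zero => rfl
  | succ k ih => simp [readChain, ih]

/-- Appending a record does not change the existing chains. -/
theorem readChain_congr {P Q A P' Q' A' : ℕ → ℕ} {rc : ℕ} (hA : ∀ r, A r ≤ rc)
    (hP : ∀ r ≤ rc, P' r = P r) (hQ : ∀ r ≤ rc, Q' r = Q r) (hA' : ∀ r ≤ rc, A' r = A r) (k : ℕ)
    {r : ℕ} (hr : r ≤ rc) : readChain P' Q' A' k r = readChain P Q A k r := by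
  induction k generalizing r with
  | zero => rfl
  | succ k ih => rw [readChain, readChain, hP r hr, hQ r hr, hA' r hr, ih (hA r)]

/-- For each `k` from 1 to `m`, the threshold `T k` bounds the first coordinates of a non-crossing
matching of size `k` in `G`, which is recorded as the chain that ends with record `R k`. The
thresholds increase, and `rc` is the number of the last record. -/
structure Thresholds (G : Set (ℕ × ℕ)) (m : ℕ) (T R P Q A : ℕ → ℕ) (rc : ℕ) : Prop where
  pred_le : ∀ r, A r ≤ rc
  rec_le : ∀ k, R k ≤ rc
  size_le : m ≤ rc
  step : ∀ k, 1 ≤ k → k < m → T k < T (k + 1)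
  chain : ∀ k, 1 ≤ k → k ≤ m → NonCrossingIn G (readChain P Q A k (R k)) ∧
    ∀ e ∈ readChain P Q A k (R k), e.1 ≤ T k

/-- The thresholds are as small as possible: `m` is the largest size of a non-crossing matching, and
`T k` the least right end (in the first coordinate) of one of size `k`. -/
def ThresholdsOptimal (G : Set (ℕ × ℕ)) (m : ℕ) (T : ℕ → ℕ) : Prop :=
  ∀ M x, NonCrossingIn G M → (∀ e ∈ M, e.1 ≤ x) → M ≠ [] → M.length ≤ m ∧ T M.length ≤ x

/-- A position `p` that is to become the threshold for `f`, by appending it to the chain that ends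
with record `a`. -/
structure Candidate (G : Set (ℕ × ℕ)) (m : ℕ) (T P Q A : ℕ → ℕ) (rc p f a : ℕ) : Prop where
  pos : 1 ≤ f
  le : f ≤ m + 1
  below : ∀ k, 1 ≤ k → k < f → T k < p
  above : f ≤ m → p ≤ T f
  rec_le : a ≤ rc
  chain : NonCrossingIn G (readChain P Q A (f - 1) a)
  lt : ∀ e ∈ readChain P Q A (f - 1) a, e.1 < p

section Thresholds

variable {G G' : Set (ℕ × ℕ)} {m rc : ℕ} {T R P Q A : ℕ → ℕ}

theorem Thresholds.lt (h : Thresholds G m T R P Q A rc) {k k' : ℕ} (hk : 1 ≤ k) (hkk' : k < k')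
    (hk' : k' ≤ m) : T k < T k' := by
  induction k', hkk' using Nat.le_induction with
  | base => exact h.step k hk hk'
  | succ n hn ih =>
    have hn : k + 1 ≤ n := hn
    exact (ih (by omega)).trans (h.step n (by omega) (by omega))

theorem Thresholds.injOn (h : Thresholds G m T R P Q A rc) {k k' : ℕ} (hk : 1 ≤ k) (hkm : k ≤ m)
    (hk' : 1 ≤ k') (hkm' : k' ≤ m) (e : T k = T k') : k = k' := by
  rcases lt_trichotomy k k' with hlt | heq | hgt
  · exact absurd e (h.lt hk hlt hkm').ne
  · exact heq
  · exact absurd e (h.lt hk' hgt hkm).ne'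

/-- Replacing (or appending) a threshold. -/
theorem Thresholds.update (h : Thresholds G m T R P Q A rc) {p q f a : ℕ} (hf : 1 ≤ f)
    (hfm : f ≤ m + 1) (hbelow : ∀ k, 1 ≤ k → k < f → T k < p) (habove : f ≤ m → p < T f)
    (ha : a ≤ rc) (hc : NonCrossingIn G (readChain P Q A (f - 1) a))
    (hcq : ∀ e ∈ readChain P Q A (f - 1) a, e.1 < p ∧ e.2 < q) (hpq : (p, q) ∈ G) :
    Thresholds G (max m f) (Function.update T f p) (Function.update R f (rc + 1))
      (Function.update P (rc + 1) p) (Function.update Q (rc + 1) q)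
      (Function.update A (rc + 1) a) (rc + 1) := by
  have hcongr : ∀ k r, r ≤ rc → readChain (Function.update P (rc + 1) p)
      (Function.update Q (rc + 1) q) (Function.update A (rc + 1) a) k r = readChain P Q A k r :=
    fun k r hr => readChain_congr h.pred_le
      (fun r hr => Function.update_of_ne (by omega) _ _)
      (fun r hr => Function.update_of_ne (by omega) _ _)
      (fun r hr => Function.update_of_ne (by omega) _ _) k hr
  refine ⟨fun r => ?_, fun k => ?_, ?_, fun k hk hkm => ?_, fun k hk hkm => ?_⟩
  · rw [Function.update_apply]
    have := h.pred_le r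
    split_ifs <;> omega
  · rw [Function.update_apply]
    have := h.rec_le k
    split_ifs <;> omega
  · have := h.size_le; omega
  · rw [Function.update_apply, Function.update_apply]
    split_ifs with h1 h2 h2
    · omega
    · subst h1
      exact (habove (by omega)).trans (h.step k hk (by omega))
    · exact hbelow k hk (by omega)
    · exact h.step k hk (by omega)
  · rw [Function.update_apply, Function.update_apply]
    split_ifs with h1
    · subst h1
      obtain ⟨k, rfl⟩ := Nat.exists_eq_succ_of_ne_zero (by omega : k ≠ 0)
      simp only [Nat.succ_eq_add_one, Nat.add_sub_cancel] at *
      simp only [readChain, Function.update_self, hcongr k a ha]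
      refine ⟨⟨?_, ?_⟩, ?_⟩
      · simp only [List.mem_append, List.mem_singleton]
        rintro e (he | rfl)
        exacts [hc.1 e he, hpq]
      · rw [List.pairwise_append]
        refine ⟨hc.2, List.pairwise_singleton _ _, fun e he e' he' => ?_⟩
        rw [List.mem_singleton] at he'
        subst he'
        exact hcq e he
      · simp only [List.mem_append, List.mem_singleton]
        rintro e (he | rfl)
        exacts [(hcq e he).1.le, le_rfl]
    · rw [hcongr k _ (h.rec_le k)]
      exact h.chain k hk (by omega)

theorem Thresholds.mono (h : Thresholds G m T R P Q A rc) (hG : G ⊆ G') :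
    Thresholds G' m T R P Q A rc :=
  { h with chain := fun k h1 h2 => ⟨(h.chain k h1 h2).1.mono hG, (h.chain k h1 h2).2⟩ }

/-- Adding a row: the new edges are the `(p, q)` with `p ∈ row`, where `q` is larger than all second
coordinates so far. If each of them has been turned into a threshold (or there was a smaller one
already), then the thresholds are optimal again. -/
theorem ThresholdsOptimal.add_row (h : ThresholdsOptimal G m T) {q : ℕ}
    (hq : ∀ e ∈ G, e.2 < q) {row : List ℕ} {m' : ℕ} {T' : ℕ → ℕ}
    (hG' : G' = G ∪ {e | e.1 ∈ row ∧ e.2 = q}) (hm : m ≤ m')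
    (hT : ∀ k, 1 ≤ k → k ≤ m → T' k ≤ T k) (hT' : ∀ k, 1 ≤ k → k < m' → T' k < T' (k + 1))
    (hrow : ∀ p ∈ row, ∃ f, 1 ≤ f ∧ (f ≤ m → p ≤ T f) ∧ f ≤ m' ∧ T' f ≤ p) :
    ThresholdsOptimal G' m' T' := by
  have hmono : ∀ k k', 1 ≤ k → k ≤ k' → k' ≤ m' → T' k ≤ T' k' := by
    intro k k' hk hkk'
    induction k', hkk' using Nat.le_induction with
    | base => exact fun _ => le_rfl
    | succ n hn ih => exact fun hn' => (ih (by omega)).trans (hT' n (by omega) (by omega)).le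
  intro M x hM hx hne
  obtain ⟨N, ⟨p, q'⟩, rfl⟩ : ∃ N e, M = N ++ [e] :=
    ⟨_, _, (List.dropLast_append_getLast hne).symm⟩
  have hp := hx (p, q') (by simp)
  have hpw := List.pairwise_append.1 hM.2
  have hN : ∀ e ∈ N, e.1 < p ∧ e.2 < q' :=
    fun e he => hpw.2.2 e he _ (List.mem_singleton_self _)
  have hmem := hM.1 (p, q') (by simp)
  have hq' : ∀ e ∈ G', e.2 ≤ q := by
    rw [hG']
    rintro e (he | he)
    exacts [(hq e he).le, he.2.le]
  have hNG : NonCrossingIn G N := by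
    refine ⟨fun e he => ?_, hpw.1⟩
    have h1 := hM.1 e (by simp [he])
    rw [hG'] at h1
    refine h1.resolve_right fun h2 => ?_
    have := hq' _ hmem
    have := (hN e he).2
    have := h2.2
    simp only at *
    omega
  rw [hG'] at hmem
  obtain hmem | ⟨hp', hq''⟩ := hmem
  · have hMG : ∀ e ∈ N ++ [(p, q')], e ∈ G := by
      simp only [List.mem_append, List.mem_singleton]
      rintro e (he | rfl)
      exacts [hNG.1 e he, hmem]
    obtain ⟨h1, h2⟩ := h _ x ⟨hMG, hM.2⟩ hx hne
    exact ⟨h1.trans hm, (hT _ (by simp) h1).trans h2⟩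
  · simp only at hp hp'
    obtain ⟨f, hf1, hf, hfm, hTf⟩ := hrow p hp'
    rw [List.length_append, List.length_singleton]
    suffices hlen : N.length + 1 ≤ f from
      ⟨hlen.trans hfm, (hmono _ f (by omega) hlen hfm).trans (hTf.trans hp)⟩
    by_contra hlt
    have hNne : N ≠ [] := by rintro rfl; simp at hlt; omega
    have hp0 : 0 < p := by
      obtain ⟨e, he⟩ := List.exists_mem_of_ne_nil N hNne
      have := (hN e he).1
      omega
    obtain ⟨h1, -⟩ := h N (p - 1) hNG (fun e he => by have := (hN e he).1; omega) hNne
    obtain ⟨h3, h4⟩ := h (N.take f) (p - 1) ⟨fun e he => hNG.1 e (List.mem_of_mem_take he),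
      hNG.2.sublist (List.take_sublist _ _)⟩
      (fun e he => by have := (hN e (List.mem_of_mem_take he)).1; omega)
      (fun e => by simp [List.take_eq_nil_iff, hNne] at e; omega)
    rw [List.length_take, min_eq_left (by omega)] at h3 h4
    have := hf h3
    omega

end Thresholds

/-! ### Collecting and processing the candidates of a row -/

/-- The thresholds of the graph `G` are stored: their number in register 30, the thresholds and
their records in the arrays 13 and 14, and the records (whose number is in register 31) in the
arrays 16, 17, 18. The thresholds also form the set of the van Emde Boas tree, and array 15 inverts
array 13. -/
structure ThresholdStore (B lam : ℕ) (s : Store) (G : Set (ℕ × ℕ)) : Prop where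
  env : VebEnv B lam s
  set : VebSet lam s {x | ∃ k, 1 ≤ k ∧ k ≤ s.reg 30 ∧ s.arr 13 k = x}
  rank : ∀ k, 1 ≤ k → k ≤ s.reg 30 → s.arr 15 (s.arr 13 k) = k
  thresholds : Thresholds G (s.reg 30) (s.arr 13) (s.arr 14) (s.arr 16) (s.arr 17) (s.arr 18)
    (s.reg 31)

theorem ThresholdStore.mono {B lam : ℕ} {s : Store} {G G' : Set (ℕ × ℕ)}
    (h : ThresholdStore B lam s G) (hG : G ⊆ G') : ThresholdStore B lam s G' :=
  { h with thresholds := h.thresholds.mono hG }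

theorem ThresholdStore.congr {B lam : ℕ} {s s' : Store} {G : Set (ℕ × ℕ)}
    (h : ThresholdStore B lam s G) (h5 : s'.reg 5 = s.reg 5) (h6 : s'.reg 6 = s.reg 6)
    (h30 : s'.reg 30 = s.reg 30) (h31 : s'.reg 31 = s.reg 31)
    (ha : ∀ a, 8 ≤ a → a ≤ 18 → a ≠ 9 → a ≠ 10 → s'.arr a = s.arr a) :
    ThresholdStore B lam s' G := by
  have e := fun a h1 h2 h3 h4 => ha a h1 h2 h3 h4
  refine ⟨⟨h5.trans h.env.top, h6.trans h.env.width, fun k hk => ?_, h.env.bound⟩, ?_, ?_, ?_⟩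
  · rw [ha 8 (by norm_num) (by norm_num) (by norm_num) (by norm_num), h.env.table k hk]
  · rw [VebSet, h30, ha 11 (by norm_num) (by norm_num) (by norm_num) (by norm_num),
      ha 12 (by norm_num) (by norm_num) (by norm_num) (by norm_num),
      ha 13 (by norm_num) (by norm_num) (by norm_num) (by norm_num)]
    exact h.set
  · rw [h30, ha 15 (by norm_num) (by norm_num) (by norm_num) (by norm_num),
      ha 13 (by norm_num) (by norm_num) (by norm_num) (by norm_num)]
    exact h.rank
  · rw [h30, h31, ha 13 (by norm_num) (by norm_num) (by norm_num) (by norm_num),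
      ha 14 (by norm_num) (by norm_num) (by norm_num) (by norm_num),
      ha 16 (by norm_num) (by norm_num) (by norm_num) (by norm_num),
      ha 17 (by norm_num) (by norm_num) (by norm_num) (by norm_num),
      ha 18 (by norm_num) (by norm_num) (by norm_num) (by norm_num)]
    exact h.thresholds

/-- The candidates collected for the current row, beginning with the store `s₀`: their number is in
register 32, their positions `acc` in array 19, the thresholds that they compete for in array 20,
and the records that they follow in array 21. -/
structure Candidates (s₀ : Store) (G : Set (ℕ × ℕ)) (acc : List ℕ) (s : Store) : Prop where
  reg : ∀ r < 16, s.reg r = s₀.reg r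
  reg_30 : s.reg 30 = s₀.reg 30
  reg_31 : s.reg 31 = s₀.reg 31
  arr : ∀ a, a ≠ 19 → a ≠ 20 → a ≠ 21 → s.arr a = s₀.arr a
  length : s.reg 32 = acc.length
  cand : ∀ z (h : z < acc.length), s.arr 19 z = acc[z] ∧
    Candidate G (s₀.reg 30) (s₀.arr 13) (s₀.arr 16) (s₀.arr 17) (s₀.arr 18) (s₀.reg 31)
      acc[z] (s.arr 20 z) (s.arr 21 z)

/-- Append the candidate with position register 23 for the threshold register 33. -/
def pushCandidate : Cmd :=
  .write 19 (.reg 32) (.reg 23) ;;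
  .write 20 (.reg 32) (.reg 33) ;;
  .write 21 (.reg 32) (.read 14 (.minus (.reg 33) (.lit 1))) ;;
  .assign 32 (.plus (.reg 32) (.lit 1))

/-- Collect register 23 as a candidate: it competes for the threshold given by the least threshold
that is not smaller. -/
def collectCandidate : Cmd :=
  .branch (.less (.reg 23) (.read 12 (.reg 5)))
    (vebSucc (.reg 23) ;; .assign 33 (.read 15 (.reg 52)))
    (.assign 33 (.plus (.reg 30) (.lit 1))) ;;
  pushCandidate

theorem wp_collectCandidate {D : Subroutines} {B lam p : ℕ} {s₀ s : Store} {G : Set (ℕ × ℕ)}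
    {acc : List ℕ} (h₀ : ThresholdStore B lam s₀ G) (hs : Candidates s₀ G acc s)
    (hp : s.reg 23 = p) (hpl : p < vebSize lam) (hacc : acc.length + 1 < B)
    (hrc : s₀.reg 31 + 1 < B) :
    WP D B collectCandidate s fun t s' => t ≤ 180 * (lam + 1) + 40 ∧
      Candidates s₀ G (acc ++ [p]) s' ∧ ∀ r < 30, s'.reg r = s.reg r := by
  have h : ThresholdStore B lam s G := h₀.congr (hs.reg _ (by norm_num)) (hs.reg _ (by norm_num))
    hs.reg_30 hs.reg_31 fun a _ _ _ _ => hs.arr a (by omega) (by omega) (by omega)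
  have hlam : vebSize lam ≤ vebSize lam * (lam + 1) := Nat.le_mul_of_pos_right _ (by omega)
  have hB := h.env.bound
  have hm := h₀.thresholds.size_le
  have hE := h.set.ends
  rw [Nat.zero_mul, Nat.zero_add] at hE
  have main : ∀ (s₁ : Store) (f t : ℕ), t ≤ 180 * (lam + 1) + 20 → VebFrame s s₁ →
      s₁.arr = s.arr →
      (1 ≤ f ∧ f ≤ s.reg 30 + 1 ∧ (∀ k, 1 ≤ k → k < f → s.arr 13 k < p) ∧
        (f ≤ s.reg 30 → p ≤ s.arr 13 f)) →
      WP D B pushCandidate (s₁.setReg 33 f) fun t' s' =>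
          t + t' ≤ 180 * (lam + 1) + 40 ∧
      Candidates s₀ G (acc ++ [p]) s' ∧ ∀ r < 30, s'.reg r = s.reg r := by
    intro s₁ f t ht hf ha ⟨hf1, hfm, hfb, hfa⟩
    have q32 : s₁.reg 32 = acc.length := by rw [hf.1 _ (by norm_num), hs.length]
    have q23 : s₁.reg 23 = p := by rw [hf.1 _ (by norm_num), hp]
    simp only [pushCandidate, wp_seq, wp_assign, wp_write, Expr.eval, Expr.cost, Store.setReg_reg,
      Store.setCell_reg, Store.setCell_arr, Store.setReg_arr, Nat.reduceEqDiff, reduceIte, q32, q23,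
      ha]
    have hR := h.thresholds.rec_le (f - 1)
    have := hs.reg_30
    have := hs.reg_31
    refine ⟨by omega, by omega, by omega, by omega, by omega, by omega, by omega, by omega,
      ⟨fun r hr => ?_, ?_, ?_, fun a h1 h2 h3 => ?_, ?_, fun z hz => ?_⟩, fun r hr => ?_⟩
    · simp only [Store.setReg_reg, Store.setCell_reg]
      rw [if_neg (by omega), if_neg (by omega), hf.1 _ (by omega), hs.reg r hr]
    · simp [hf.1, hs.reg_30]
    · simp [hf.1, hs.reg_31]
    · simp [h1, h2, h3, ha, hs.arr a h1 h2 h3]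
    · simp
    · have h' := h.thresholds
      rw [hs.reg_30, hs.reg_31, hs.arr 13 (by norm_num) (by norm_num) (by norm_num),
        hs.arr 14 (by norm_num) (by norm_num) (by norm_num),
        hs.arr 16 (by norm_num) (by norm_num) (by norm_num),
        hs.arr 17 (by norm_num) (by norm_num) (by norm_num),
        hs.arr 18 (by norm_num) (by norm_num) (by norm_num)] at h'
      rw [hs.reg_30, hs.arr 13 (by norm_num) (by norm_num) (by norm_num)] at *
      simp only [Store.setCell_arr, Store.setReg_arr, Nat.reduceEqDiff, reduceIte, ha,
        Function.update_apply]
      by_cases hz' : z = acc.length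
      · subst hz'
        simp only [reduceIte, List.getElem_concat_length, true_and]
        have hc : NonCrossingIn G (readChain (s₀.arr 16) (s₀.arr 17) (s₀.arr 18) (f - 1)
            (s.arr 14 (f - 1))) ∧ ∀ e ∈ readChain (s₀.arr 16) (s₀.arr 17) (s₀.arr 18) (f - 1)
            (s.arr 14 (f - 1)), e.1 < p := by
          rw [hs.arr 14 (by norm_num) (by norm_num) (by norm_num)]
          by_cases hf2 : f - 1 = 0
          · rw [hf2]
            exact ⟨⟨by simp [readChain], by simp [readChain]⟩, by simp [readChain]⟩
          · obtain ⟨h1, h2⟩ := h'.chain (f - 1) (by omega) (by omega)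
            exact ⟨h1, fun e he => (h2 e he).trans_lt (hfb _ (by omega) (by omega))⟩
        refine ⟨hf1, hfm, hfb, hfa, ?_, hc.1, hc.2⟩
        rw [hs.arr 14 (by norm_num) (by norm_num) (by norm_num)]
        exact h'.rec_le _
      · have hz'' : z < acc.length := by simp at hz; omega
        simp only [hz', reduceIte, List.getElem_append_left hz'']
        exact hs.cand z hz''
    · rw [if_neg (by omega), if_neg (by omega), hf.1 _ (by omega)]
  have h5 : s.reg 5 = lam := h.env.top
  rw [collectCandidate, wp_seq, wp_branch]
  simp only [wp_seq, wp_assign, Expr.eval, Expr.cost, hp, h5]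
  refine ⟨fun h1 => ?_, fun h1 => ?_⟩
  · have h1 : p < s.arr 12 lam := by simpa using h1
    have hex : ∃ y ∈ {x | ∃ k, 1 ≤ k ∧ k ≤ s.reg 30 ∧ s.arr 13 k = x}, p ≤ y := by
      obtain ⟨-, -, h2⟩ | ⟨_, b, -, h2, -, hb, -⟩ := hE
      · omega
      · exact ⟨b, hb, by omega⟩
    refine (wp_vebSucc (e := .reg 23) h.env h.set hpl hp hex).mono fun t s₁ ⟨ht, hf, ha, hv⟩ => ?_
    obtain ⟨⟨⟨k, hk1, hkm, hkv⟩, hpv⟩, hmin⟩ := hv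
    have hr : s₁.arr 15 (s₁.reg 52) = k := by rw [ha, ← hkv, h.rank k hk1 hkm]
    rw [hr]
    have := hs.reg_30
    refine ⟨by omega, ?_⟩
    refine main s₁ k _ ?_ hf ha ⟨hk1, by omega, fun k' hk1' hk' => ?_, fun _ => by omega⟩
    · simp only [Expr.cost] at ht; omega
    · by_contra hlt
      have h2 := hmin ⟨⟨k', hk1', by omega, rfl⟩, by omega⟩
      have := h.thresholds.lt hk1' hk' hkm
      omega
  · have h1 : s.arr 12 lam ≤ p := by simpa using h1
    have := hs.reg_30
    refine ⟨by omega, main s _ _ (by omega) (.refl s) rfl ⟨by omega, le_rfl, fun k hk1 hk => ?_,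
      fun h => by omega⟩⟩
    obtain ⟨h2, -⟩ | ⟨_, b, -, h2, -, -, hb⟩ := hE
    · have h3 : s.arr 13 k ∈ (∅ : Set ℕ) := h2 ▸ ⟨k, hk1, by omega, rfl⟩
      exact h3.elim
    · have := (hb _ ⟨k, hk1, by omega, rfl⟩).2
      omega

/-- Make register 23 the threshold number register 33, with a new record for the edge that joins
register 23 to register 15 and follows record register 34. -/
def commitCandidate : Cmd :=
  vebRun vebInsertBody (.reg 23) ;;
  .write 13 (.reg 33) (.reg 23) ;;
  .write 15 (.reg 23) (.reg 33) ;;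
  .assign 31 (.plus (.reg 31) (.lit 1)) ;;
  .write 14 (.reg 33) (.reg 31) ;;
  .write 16 (.reg 31) (.reg 23) ;;
  .write 17 (.reg 31) (.reg 15) ;;
  .write 18 (.reg 31) (.reg 34)

theorem wp_commitCandidate {D : Subroutines} {B lam m f p q a : ℕ} {s : Store} {G : Set (ℕ × ℕ)}
    (henv : VebEnv B lam s)
    (hX : VebSet lam s {x | ∃ k, 1 ≤ k ∧ k ≤ max m f ∧ k ≠ f ∧ s.arr 13 k = x})
    (hrank : ∀ k, 1 ≤ k → k ≤ m → s.arr 15 (s.arr 13 k) = k)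
    (ht : Thresholds G m (s.arr 13) (s.arr 14) (s.arr 16) (s.arr 17) (s.arr 18) (s.reg 31))
    (h30 : s.reg 30 = max m f) (h23 : s.reg 23 = p) (h33 : s.reg 33 = f) (h34 : s.reg 34 = a)
    (h15 : s.reg 15 = q) (hpl : p < vebSize lam) (hqB : q < B) (hrc : s.reg 31 + 1 < B)
    (hf : 1 ≤ f) (hfm : f ≤ m + 1) (hbelow : ∀ k, 1 ≤ k → k < f → s.arr 13 k < p)
    (habove : f ≤ m → p < s.arr 13 f) (ha : a ≤ s.reg 31)
    (hc : NonCrossingIn G (readChain (s.arr 16) (s.arr 17) (s.arr 18) (f - 1) a))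
    (hcq : ∀ e ∈ readChain (s.arr 16) (s.arr 17) (s.arr 18) (f - 1) a, e.1 < p ∧ e.2 < q)
    (hpq : (p, q) ∈ G) :
    WP D B commitCandidate s fun t s' => t ≤ 210 * (lam + 1) + 40 ∧ ThresholdStore B lam s' G ∧
      (∀ r < 40, r ≠ 31 → s'.reg r = s.reg r) ∧ s'.reg 31 = s.reg 31 + 1 ∧
      s'.arr 13 = Function.update (s.arr 13) f p ∧
      (∀ b, b = 16 ∨ b = 17 ∨ b = 18 → ∀ r ≤ s.reg 31, s'.arr b r = s.arr b r) ∧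
      ∀ b, b < 11 ∨ 18 < b → s'.arr b = s.arr b := by
  have hlam : vebSize lam ≤ vebSize lam * (lam + 1) := Nat.le_mul_of_pos_right _ (by omega)
  have hB := henv.bound
  have hm := ht.size_le
  have hpT : ∀ k, 1 ≤ k → k ≤ m → k ≠ f → s.arr 13 k ≠ p := by
    intro k hk hkm hkf e
    obtain h | h := Nat.lt_or_gt_of_ne hkf
    · exact (hbelow k hk h).ne e
    · have := ht.lt hf h hkm
      have := habove (by omega)
      omega
  have hpX : p ∉ {x | ∃ k, 1 ≤ k ∧ k ≤ max m f ∧ k ≠ f ∧ s.arr 13 k = x} := by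
    rintro ⟨k, hk, hkm, hkf, e⟩
    exact hpT k hk (by omega) hkf e
  rw [commitCandidate, wp_seq]
  refine ((vebStep_insert D B lam).run (e := .reg 23) henv hX hpl h23 hpX).mono
    fun t s₁ ⟨ht', hfr, hX'⟩ => ?_
  simp only [wp_seq, wp_assign, wp_write, Expr.eval, Expr.cost, Store.setReg_reg,
    Store.setCell_reg, Nat.reduceEqDiff, reduceIte, hfr.1 33 (by norm_num), hfr.1 23 (by norm_num),
    hfr.1 31 (by norm_num), hfr.1 15 (by norm_num), hfr.1 34 (by norm_num), h33, h23, h34, h15]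
  refine ⟨by omega, by omega, by omega, by omega, by omega, by omega, by omega, by omega, by omega,
    by omega, by omega, by omega, by omega, ?_, ⟨?_, ?_, ?_, ?_⟩, fun r hr hr' => ?_, ?_, ?_, ?_,
    fun b hb => ?_⟩
  · simp only [Expr.cost] at ht'; omega
  · have h1 := henv.of_frame hfr
    exact ⟨by simp [h1.top], by simp [h1.width], fun k hk => by simp [h1.table k hk], h1.bound⟩
  · have hset : {x | ∃ k, 1 ≤ k ∧ k ≤ max m f ∧ Function.update (s.arr 13) f p k = x} =
        insert p {x | ∃ k, 1 ≤ k ∧ k ≤ max m f ∧ k ≠ f ∧ s.arr 13 k = x} := by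
      ext x
      simp only [Set.mem_ofPred_eq, Set.mem_insert_iff]
      constructor
      · rintro ⟨k, hk, hkm, e⟩
        by_cases hkf : k = f
        · subst hkf
          exact .inl (by simpa using e.symm)
        · rw [Function.update_of_ne hkf] at e
          exact .inr ⟨k, hk, hkm, hkf, e⟩
      · rintro (rfl | ⟨k, hk, hkm, hkf, e⟩)
        · exact ⟨f, hf, le_max_right _ _, by simp⟩
        · exact ⟨k, hk, hkm, by rwa [Function.update_of_ne hkf]⟩
    simp only [VebSet, Store.setCell_reg, Store.setCell_arr, Store.setReg_reg, Store.setReg_arr,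
      Nat.reduceEqDiff, reduceIte, hfr.1 30 (by norm_num), h30,
      hfr.2 13 (by norm_num) (by norm_num), hset]
    exact hX'
  · simp only [Store.setCell_reg, Store.setCell_arr, Store.setReg_reg, Store.setReg_arr,
      Nat.reduceEqDiff, reduceIte, hfr.1 30 (by norm_num), h30,
      hfr.2 13 (by norm_num) (by norm_num), hfr.2 15 (by norm_num) (by norm_num)]
    intro k hk hkm
    by_cases hkf : k = f
    · subst hkf; simp
    · rw [Function.update_of_ne hkf, Function.update_of_ne (hpT k hk (by omega) hkf)]
      exact hrank k hk (by omega)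
  · simp only [Store.setCell_reg, Store.setCell_arr, Store.setReg_reg, Store.setReg_arr,
      Nat.reduceEqDiff, reduceIte, hfr.1 30 (by norm_num), h30,
      hfr.2 13 (by norm_num) (by norm_num), hfr.2 14 (by norm_num) (by norm_num),
      hfr.2 16 (by norm_num) (by norm_num), hfr.2 17 (by norm_num) (by norm_num),
      hfr.2 18 (by norm_num) (by norm_num)]
    exact ht.update hf hfm hbelow habove ha hc hcq hpq
  · rw [if_neg hr', hfr.1 r hr]
  · simp
  · simp [hfr.2]
  · rintro b hb r hr
    have h1 : r ≠ s.reg 31 + 1 := by omega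
    obtain rfl | rfl | rfl := hb <;> simp [hfr.2, h1]
  · simp only [Store.setCell_arr, Store.setReg_arr]
    rw [if_neg (by omega), if_neg (by omega), if_neg (by omega), if_neg (by omega),
      if_neg (by omega), if_neg (by omega), hfr.2 b (by omega) (by omega)]

/-- Process candidate number register 16: it becomes a new threshold or replaces a larger one,
unless the threshold that it competes for is not larger any more. -/
def processCandidate : Cmd :=
  .assign 23 (.read 19 (.reg 16)) ;;
  .assign 33 (.read 20 (.reg 16)) ;;
  .assign 34 (.read 21 (.reg 16)) ;;
  .branch (.less (.reg 30) (.reg 33))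
    (.assign 30 (.reg 33) ;; commitCandidate)
    (.branch (.less (.reg 23) (.read 13 (.reg 33)))
      (vebRun vebDeleteBody (.read 13 (.reg 33)) ;; commitCandidate)
      .skip)

/-- The first `z` of the candidates in the store `s₀` have been processed. The old records are
unchanged, so that the chains that the candidates were collected with remain valid. -/
structure Processed (B lam : ℕ) (s₀ : Store) (G : Set (ℕ × ℕ)) (z : ℕ) (s : Store) : Prop where
  store : ThresholdStore B lam s G
  reg : ∀ r < 16, s.reg r = s₀.reg r
  reg_32 : s.reg 32 = s₀.reg 32
  arr : ∀ b, b < 11 ∨ 18 < b → s.arr b = s₀.arr b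
  size : s₀.reg 30 ≤ s.reg 30 ∧ s.reg 30 ≤ s₀.reg 30 + 1
  records : s₀.reg 31 ≤ s.reg 31 ∧ s.reg 31 ≤ s₀.reg 31 + z
  le : ∀ k, 1 ≤ k → k ≤ s₀.reg 30 → s.arr 13 k ≤ s₀.arr 13 k
  chain : ∀ b, b = 16 ∨ b = 17 ∨ b = 18 → ∀ r ≤ s₀.reg 31, s.arr b r = s₀.arr b r
  done : ∀ y < z, s₀.arr 20 y ≤ s.reg 30 ∧ s.arr 13 (s₀.arr 20 y) ≤ s₀.arr 19 y

theorem wp_processCandidate {D : Subroutines} {B lam z q : ℕ} {s₀ s : Store} {G G' : Set (ℕ × ℕ)}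
    (hA : ∀ r, s₀.arr 18 r ≤ s₀.reg 31) (hm₀ : s₀.reg 30 ≤ s₀.reg 31)
    (hs : Processed B lam s₀ G' z s) (hz : s.reg 16 = z)
    (hcand : Candidate G (s₀.reg 30) (s₀.arr 13) (s₀.arr 16) (s₀.arr 17) (s₀.arr 18) (s₀.reg 31)
      (s₀.arr 19 z) (s₀.arr 20 z) (s₀.arr 21 z))
    (hpl : s₀.arr 19 z < vebSize lam) (hG : G ⊆ G') (hGq : ∀ e ∈ G, e.2 < q)
    (hpq : (s₀.arr 19 z, q) ∈ G') (hq : s₀.reg 15 = q) (hqB : q < B)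
    (hrc : s₀.reg 31 + z + 1 < B) :
    WP D B processCandidate s fun t s' => t ≤ 420 * (lam + 1) + 100 ∧ s'.reg 16 = z ∧
      Processed B lam s₀ G' (z + 1) s' := by
  have hlam : vebSize lam ≤ vebSize lam * (lam + 1) := Nat.le_mul_of_pos_right _ (by omega)
  have hB := hs.store.env.bound
  obtain ⟨hm1, hm2⟩ := hs.size
  obtain ⟨hr1, hr2⟩ := hs.records
  have hT := hs.store.thresholds
  have hsz := hT.size_le
  obtain ⟨cpos, cle, cbelow, cabove, crec, cchain, clt⟩ := hcand
  generalize hp : s₀.arr 19 z = p at *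
  generalize hf : s₀.arr 20 z = f at *
  generalize ha : s₀.arr 21 z = a at *
  have hbelow : ∀ k, 1 ≤ k → k < f → s.arr 13 k < p := fun k hk hkf =>
    (hs.le k hk (by omega)).trans_lt (cbelow k hk hkf)
  have hchain : readChain (s.arr 16) (s.arr 17) (s.arr 18) (f - 1) a =
      readChain (s₀.arr 16) (s₀.arr 17) (s₀.arr 18) (f - 1) a :=
    readChain_congr hA (hs.chain 16 (by simp)) (hs.chain 17 (by simp)) (hs.chain 18 (by simp)) _
      crec
  have hc : NonCrossingIn G' (readChain (s.arr 16) (s.arr 17) (s.arr 18) (f - 1) a) :=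
    hchain ▸ cchain.mono hG
  have hcq : ∀ e ∈ readChain (s.arr 16) (s.arr 17) (s.arr 18) (f - 1) a, e.1 < p ∧ e.2 < q := by
    rw [hchain]
    exact fun e he => ⟨clt e he, hGq e (cchain.1 e he)⟩
  -- The outcome of a commitment.
  have done : ∀ s', s'.reg 30 = max (s.reg 30) f → ThresholdStore B lam s' G' →
      (∀ r < 30, r ≠ 23 → s'.reg r = s.reg r) → s'.reg 32 = s.reg 32 →
      s'.reg 31 = s.reg 31 + 1 → s'.arr 13 = Function.update (s.arr 13) f p →
      (f ≤ s.reg 30 → p < s.arr 13 f) →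
      (∀ b, b = 16 ∨ b = 17 ∨ b = 18 → ∀ r ≤ s.reg 31, s'.arr b r = s.arr b r) →
      (∀ b, b < 11 ∨ 18 < b → s'.arr b = s.arr b) →
      s'.reg 16 = z ∧ Processed B lam s₀ G' (z + 1) s' := by
    intro s' h30 hst hreg h32 h31 h13 hab hch harr
    refine ⟨by rw [hreg _ (by norm_num) (by norm_num), hz], hst, fun r hr => ?_, ?_, fun b hb => ?_,
      by omega, by omega, fun k hk hkm => ?_, fun b hb r hr => ?_, fun y hy => ?_⟩
    · rw [hreg r (by omega) (by omega), hs.reg r hr]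
    · rw [h32, hs.reg_32]
    · rw [harr b hb, hs.arr b hb]
    · have h1 := hs.le k hk hkm
      rw [h13, Function.update_apply]
      split_ifs with h
      · subst h; exact cabove hkm
      · exact h1
    · rw [hch b hb r (by omega), hs.chain b hb r hr]
    · rw [h13, h30, Function.update_apply]
      by_cases hy' : y = z
      · subst hy'; rw [hf, hp]; simp
      · obtain ⟨h1, h2⟩ := hs.done y (by omega)
        refine ⟨by omega, ?_⟩
        split_ifs with h
        · rw [h] at h1 h2
          have := hab h1
          omega
        · exact h2
  simp only [processCandidate, wp_seq, wp_assign, wp_branch, wp_skip, Expr.eval, Expr.cost,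
    Store.setReg_reg, Store.setReg_arr, Nat.reduceEqDiff, reduceIte, hz,
    hs.arr 19 (.inr (by norm_num)), hs.arr 20 (.inr (by norm_num)),
    hs.arr 21 (.inr (by norm_num)), hp, hf, ha]
  have hfr : ∀ {r v : ℕ}, r ≠ 5 → r ≠ 6 → ∀ {s : Store}, VebEnv B lam s →
      VebEnv B lam (s.setReg r v) := fun h5 h6 _ h =>
    ⟨by simp [h.top, h5.symm], by simp [h.width, h6.symm], h.table, h.bound⟩
  have henv : VebEnv B lam (((s.setReg 23 p).setReg 33 f).setReg 34 a) :=
    hfr (by norm_num) (by norm_num) (hfr (by norm_num) (by norm_num)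
      (hfr (by norm_num) (by norm_num) hs.store.env))
  refine ⟨by omega, by omega, by omega, fun h1 => ?_, fun h1 => ⟨fun h2 => ?_, fun h2 => ?_⟩⟩
  · have h1 : s.reg 30 < f := by simpa using h1
    refine ⟨by omega, ?_⟩
    refine (wp_commitCandidate (m := s.reg 30) (f := f) (p := p) (q := q) (a := a) (G := G')
      (hfr (by norm_num) (by norm_num) henv) ?_ hs.store.rank ?_ ?_ ?_ ?_ ?_ ?_ hpl hqB ?_ cpos
      (by omega) hbelow (fun h => by omega) (by simp; omega) hc hcq hpq).mono
      fun t s' ⟨ht, hst, hreg, h31, h13, hch, harr⟩ => ⟨by omega, done s' ?_ hst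
        (fun r hr hr' => ?_) ?_ ?_ ?_ (fun h => by omega) ?_ harr⟩
    · have hset : {x | ∃ k, 1 ≤ k ∧ k ≤ max (s.reg 30) f ∧ k ≠ f ∧ s.arr 13 k = x} =
          {x | ∃ k, 1 ≤ k ∧ k ≤ s.reg 30 ∧ s.arr 13 k = x} := by
        ext x
        simp only [Set.mem_ofPred_eq]
        refine exists_congr fun k => ⟨?_, ?_⟩
        · rintro ⟨h3, h4, h5, h6⟩; exact ⟨h3, by omega, h6⟩
        · rintro ⟨h3, h4, h6⟩; exact ⟨h3, by omega, by omega, h6⟩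
      rw [VebSet]
      simp only [Store.setReg_arr]
      rw [hset]
      exact hs.store.set
    · simpa using hT
    · simp; omega
    · simp
    · simp
    · simp
    · simp [hs.reg, hq]
    · simp; omega
    · rw [hreg 30 (by norm_num) (by norm_num)]; simp; omega
    · rw [hreg r (by omega) (by omega)]
      simp only [Store.setReg_reg]
      rw [if_neg (by omega), if_neg (by omega), if_neg (by omega), if_neg (by omega)]
    · rw [hreg 32 (by norm_num) (by norm_num)]; simp
    · rw [h31]; simp
    · rw [h13]; simp
    · intro b hb r hr
      rw [hch b hb r (by simpa using hr)]; simp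
  · have h1 : f ≤ s.reg 30 := by simpa using h1
    have h2 : p < s.arr 13 f := by simpa using h2
    have hfX : s.arr 13 f ∈ {x | ∃ k, 1 ≤ k ∧ k ≤ s.reg 30 ∧ s.arr 13 k = x} := ⟨f, cpos, h1, rfl⟩
    refine ((vebStep_delete D B lam).run (x := s.arr 13 f) (e := .read 13 (.reg 33)) henv
      (hs.store.set : VebSet lam (((s.setReg 23 p).setReg 33 f).setReg 34 a) _)
      (hs.store.set.lt _ hfX) (by simp [Expr.eval]) hfX).mono fun t s₁ ⟨ht, hfr', hX⟩ => ?_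
    have ha' : ∀ b, b ≠ 11 → b ≠ 12 → s₁.arr b = s.arr b := fun b h3 h4 => hfr'.2 b h3 h4
    refine (wp_commitCandidate (m := s.reg 30) (f := f) (p := p) (q := q) (a := a) (G := G')
      (henv.of_frame hfr') ?_ ?_ ?_ ?_ ?_ ?_ ?_ ?_ hpl hqB ?_ cpos
      (by omega) ?_ ?_ ?_ ?_ ?_ hpq).mono
      fun t' s' ⟨ht', hst, hreg, h31, h13, hch, harr⟩ => ⟨?_, done s' ?_ hst
        (fun r hr hr' => ?_) ?_ ?_ ?_ (fun h => h2) ?_ fun b hb => ?_⟩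
    · rw [ha' 13 (by norm_num) (by norm_num)]
      convert hX using 1
      ext x
      simp only [Set.mem_ofPred_eq, Set.mem_sdiff, Set.mem_singleton_iff]
      constructor
      · rintro ⟨k, h3, h4, h5, rfl⟩
        exact ⟨⟨k, h3, by omega, rfl⟩, fun e => h5 (hT.injOn h3 (by omega) cpos h1 e)⟩
      · rintro ⟨⟨k, h3, h4, rfl⟩, h5⟩
        exact ⟨k, h3, by omega, fun e => h5 (by rw [e]), rfl⟩
    · rw [ha' 13 (by norm_num) (by norm_num), ha' 15 (by norm_num) (by norm_num)]
      exact hs.store.rank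
    · rw [ha' 13 (by norm_num) (by norm_num), ha' 14 (by norm_num) (by norm_num),
        ha' 16 (by norm_num) (by norm_num), ha' 17 (by norm_num) (by norm_num),
        ha' 18 (by norm_num) (by norm_num), hfr'.1 31 (by norm_num)]
      simpa using hT
    · rw [hfr'.1 30 (by norm_num)]; simp; omega
    · rw [hfr'.1 23 (by norm_num)]; simp
    · rw [hfr'.1 33 (by norm_num)]; simp
    · rw [hfr'.1 34 (by norm_num)]; simp
    · rw [hfr'.1 15 (by norm_num)]; simp [hs.reg, hq]
    · rw [hfr'.1 31 (by norm_num)]; simp; omega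
    · rw [ha' 13 (by norm_num) (by norm_num)]; exact hbelow
    · rw [ha' 13 (by norm_num) (by norm_num)]; exact fun _ => h2
    · rw [hfr'.1 31 (by norm_num)]; simp; omega
    · rw [ha' 16 (by norm_num) (by norm_num), ha' 17 (by norm_num) (by norm_num),
        ha' 18 (by norm_num) (by norm_num)]
      exact hc
    · rw [ha' 16 (by norm_num) (by norm_num), ha' 17 (by norm_num) (by norm_num),
        ha' 18 (by norm_num) (by norm_num)]
      exact hcq
    · simp only [Expr.cost] at ht; omega
    · rw [hreg 30 (by norm_num) (by norm_num), hfr'.1 30 (by norm_num)]; simp; omega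
    · rw [hreg r (by omega) (by omega), hfr'.1 r (by omega)]
      simp only [Store.setReg_reg]
      rw [if_neg (by omega), if_neg (by omega), if_neg (by omega)]
    · rw [hreg 32 (by norm_num) (by norm_num), hfr'.1 32 (by norm_num)]; simp
    · rw [h31, hfr'.1 31 (by norm_num)]; simp
    · rw [h13, ha' 13 (by norm_num) (by norm_num)]
    · intro b hb r hr
      have h31' : s₁.reg 31 = s.reg 31 := by rw [hfr'.1 31 (by norm_num)]; simp
      rw [hch b hb r (by omega), ha' b (by omega) (by omega)]
    · rw [harr b hb, ha' b (by omega) (by omega)]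
  · have h1 : f ≤ s.reg 30 := by simpa using h1
    have h2 : s.arr 13 f ≤ p := by simpa using h2
    refine ⟨by omega, by simp, hs.store.congr (by simp) (by simp) (by simp) (by simp)
      (fun _ _ _ _ _ => rfl), fun r hr => ?_, by simp [hs.reg_32], hs.arr, by simpa using hs.size,
      by simp; omega, hs.le, hs.chain, fun y hy => ?_⟩
    · simp only [Store.setReg_reg]
      rw [if_neg (by omega), if_neg (by omega), if_neg (by omega), hs.reg r hr]
    · by_cases hy' : y = z
      · subst hy'; rw [hf, hp]; exact ⟨by simpa using h1, h2⟩
      · simpa using hs.done y (by omega)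

/-! ### One row of the graph -/

/-- Process all candidates of a row. -/
def processRow : Cmd := .for 16 (.lit 0) (.reg 32) processCandidate

theorem wp_processRow {D : Subroutines} {B lam q : ℕ} {s₀ s : Store} {G G' : Set (ℕ × ℕ)}
    {row : List ℕ} (h₀ : ThresholdStore B lam s₀ G)
    (hopt : ThresholdsOptimal G (s₀.reg 30) (s₀.arr 13)) (hs : Candidates s₀ G row s)
    (hrow : ∀ p ∈ row, p < vebSize lam) (hGq : ∀ e ∈ G, e.2 < q)
    (hG' : G' = G ∪ {e | e.1 ∈ row ∧ e.2 = q}) (hq : s₀.reg 15 = q) (hqB : q < B)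
    (hrc : s₀.reg 31 + row.length + 1 < B) :
    WP D B processRow s fun t s' => t ≤ row.length * (420 * (lam + 1) + 108) + 6 ∧
      ThresholdStore B lam s' G' ∧ ThresholdsOptimal G' (s'.reg 30) (s'.arr 13) ∧
      s'.reg 31 ≤ s₀.reg 31 + row.length ∧ (∀ r < 16, s'.reg r = s₀.reg r) ∧
      ∀ b < 11, s'.arr b = s₀.arr b := by
  have hG : G ⊆ G' := by rw [hG']; exact Set.subset_union_left
  have hst : ThresholdStore B lam s G := h₀.congr (hs.reg _ (by norm_num)) (hs.reg _ (by norm_num))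
    hs.reg_30 hs.reg_31 fun a _ _ _ _ => hs.arr a (by omega) (by omega) (by omega)
  have hcong : ∀ {s₁ v z}, Processed B lam s G' z s₁ →
      Processed B lam s G' z (s₁.setReg 16 v) := fun {s₁ v z} h =>
    ⟨h.store.congr (by simp) (by simp) (by simp) (by simp) fun _ _ _ _ _ => rfl, fun r hr => by
      rw [Store.setReg_reg, if_neg (by omega), h.reg r hr], by simp [h.reg_32], h.arr,
      by simpa using h.size, by simpa using h.records, h.le, h.chain, fun y hy => by
      simpa using h.done y hy⟩
  have e30 := hs.reg_30
  have e31 := hs.reg_31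
  have e13 := hs.arr 13 (by norm_num) (by norm_num) (by norm_num)
  refine (wp_for (a := 0) (b := row.length) (T := 420 * (lam + 1) + 100)
    (fun z s' => Processed B lam s G' z s' ∧ s'.reg 16 = z) rfl (by omega) (by omega)
    ⟨hcong ⟨hst.mono hG, fun _ _ => rfl, rfl, fun _ _ => rfl, by omega, by omega,
      fun _ _ _ => le_rfl, fun _ _ _ _ => rfl, fun y hy => by omega⟩, by simp⟩
    (fun z s' h => ⟨h.2, by simp [Expr.eval, h.1.reg_32, hs.length]⟩) ?_).mono ?_
  · rintro z s' - hz ⟨hp, hz'⟩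
    obtain ⟨hc1, hc2⟩ := hs.cand z hz
    have hmem : s.arr 19 z ∈ row := by rw [hc1]; exact List.getElem_mem hz
    refine (wp_processCandidate (q := q) (G := G) (G' := G') hst.thresholds.pred_le
      hst.thresholds.size_le hp hz' ?_ (hrow _ hmem) hG hGq ?_ ?_ hqB (by omega)).mono
      fun t s'' ⟨ht, h1, h2⟩ => ⟨ht, h1, hcong h2, by simp⟩
    · rw [hs.reg_30, hs.reg_31, hs.arr 13 (by norm_num) (by norm_num) (by norm_num),
        hs.arr 16 (by norm_num) (by norm_num) (by norm_num),
        hs.arr 17 (by norm_num) (by norm_num) (by norm_num),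
        hs.arr 18 (by norm_num) (by norm_num) (by norm_num), hc1]
      exact hc2
    · rw [hG']; exact .inr ⟨hmem, rfl⟩
    · rw [hs.reg _ (by norm_num), hq]
  · rintro t s' ⟨ht, hp, -⟩
    have hsize := hp.size
    have hrec := hp.records
    have hle := hp.le
    rw [e30] at hsize hle
    rw [e13] at hle
    refine ⟨?_, hp.store, hopt.add_row hGq hG' hsize.1 hle hp.store.thresholds.step
      fun p hpr => ?_, by omega, fun r hr => by rw [hp.reg r hr, hs.reg r hr], fun b hb => by
      rw [hp.arr b (.inl hb), hs.arr b (by omega) (by omega) (by omega)]⟩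
    · simp only [Expr.cost, Nat.sub_zero] at ht; omega
    · obtain ⟨z, hz, rfl⟩ := List.getElem_of_mem hpr
      obtain ⟨hc1, hc2⟩ := hs.cand z hz
      obtain ⟨h1, h2⟩ := hp.done z hz
      exact ⟨_, hc2.pos, hc2.above, h1, hc1 ▸ h2⟩

/-- The data that the program keeps during its main loop: the input, the numbers of the blocks of
the two strings, and the number of sub-blocks of a block. -/
structure Loaded (S S' : List IndexedSym) (N₁ N₂ w : ℕ) (s : Store) : Prop where
  reg : ∀ r < 5, s.reg r = (inputStore S S' N₁ N₂ w).reg r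
  reg_7 : s.reg 7 = numBlocks S.length N₁
  reg_8 : s.reg 8 = N₁ / N₂
  reg_9 : s.reg 9 = numBlocks S'.length N₁
  arr : ∀ a < 6, s.arr a = (inputStore S S' N₁ N₂ w).arr a

theorem Loaded.congr {S S' : List IndexedSym} {N₁ N₂ w : ℕ} {s s' : Store}
    (h : Loaded S S' N₁ N₂ w s) (hr : ∀ r < 10, s'.reg r = s.reg r)
    (ha : ∀ a < 6, s'.arr a = s.arr a) : Loaded S S' N₁ N₂ w s' :=
  ⟨fun r h' => by rw [hr r (by omega), h.reg r h'], by rw [hr _ (by norm_num), h.reg_7],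
    by rw [hr _ (by norm_num), h.reg_8], by rw [hr _ (by norm_num), h.reg_9],
    fun a h' => by rw [ha a h', h.arr a h']⟩

section Rows

variable (S S' : List IndexedSym) (N₁ N₂ w : ℕ) (o₁ o₂ : List ℕ) (q : ℕ)

/-- The neighbours of position `q` of `S'` in sub-block `k'` of block `k` of `S`. -/
def subblockRow (k k' : ℕ) : List ℕ :=
  (List.Ico 0 N₂).flatMap fun a =>
    if k * N₁ + k' * N₂ + a < S.length ∧ S[k * N₁ + k' * N₂ + a]? = S'[q]? then
      [k * N₁ + k' * N₂ + a]
    else []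

/-- The neighbours of position `q` of `S'` in the sub-blocks of block `k` of `S` that are close to
`j'`. The window is an interval with truncated ends. -/
def windowRow (k j' : ℕ) : List ℕ :=
  (List.Ico (min (j' - w) (N₁ / N₂)) (min (N₁ / N₂) (j' + w + 1))).flatMap
    (subblockRow S S' N₁ N₂ q k)

/-- The neighbours of position `q` of `S'` in block `k` of `S`, if the second decoder has returned
`o₂`. -/
def blockRow (k : ℕ) : List ℕ :=
  (List.Ico 0 o₂.length).flatMap fun y => windowRow S S' N₁ N₂ w q k (o₂.getD y 0)

/-- The neighbours of position `q` of `S'` in the blocks of `S` that are close to `j`. -/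
def blocksRow (j : ℕ) : List ℕ :=
  (List.Ico (min (j - w) (numBlocks S.length N₁)) (min (numBlocks S.length N₁) (j + w + 1))).flatMap
    (blockRow S S' N₁ N₂ w o₂ q)

/-- The neighbours in `S` of position `q` of `S'`, if the decoders have returned `o₁` and `o₂` for
the block and the sub-block of `q`. -/
def rowList : List ℕ :=
  (List.Ico 0 o₁.length).flatMap fun x => blocksRow S S' N₁ N₂ w o₂ q (o₁.getD x 0)

end Rows

/-- Collect the neighbours of the position register 15 of `S'` as candidates. -/
def collectRow : Cmd :=
  .assign 32 (.lit 0) ;;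
  .for 16 (.lit 0) (.reg 11)
    (.for 17 (.min (.minus (.read 9 (.reg 16)) (.reg 4)) (.reg 7))
        (.min (.reg 7) (.plus (.plus (.read 9 (.reg 16)) (.reg 4)) (.lit 1)))
      (.for 19 (.lit 0) (.reg 13)
        (.for 20 (.min (.minus (.read 10 (.reg 19)) (.reg 4)) (.reg 8))
            (.min (.reg 8) (.plus (.plus (.read 10 (.reg 19)) (.reg 4)) (.lit 1)))
          (.for 22 (.lit 0) (.reg 3)
            (.assign 23 (.plus (.plus (.times (.reg 17) (.reg 2)) (.times (.reg 20) (.reg 3)))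
                (.reg 22)) ;;
              .branch (.times (.times (.less (.reg 23) (.reg 0))
                    (.equal (.read 0 (.reg 23)) (.read 3 (.reg 15))))
                  (.times (.equal (.read 1 (.reg 23)) (.read 4 (.reg 15)))
                    (.equal (.read 2 (.reg 23)) (.read 5 (.reg 15)))))
                collectCandidate .skip)))))

theorem Candidates.setReg {s₀ s : Store} {G : Set (ℕ × ℕ)} {acc : List ℕ} {r v : ℕ}
    (h : Candidates s₀ G acc s) (hr : 16 ≤ r) (hr' : r < 30) :
    Candidates s₀ G acc (s.setReg r v) :=
  ⟨fun r' h' => by rw [Store.setReg_reg, if_neg (by omega), h.reg r' h'],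
    by rw [Store.setReg_reg, if_neg (by omega), h.reg_30],
    by rw [Store.setReg_reg, if_neg (by omega), h.reg_31], h.arr,
    by rw [Store.setReg_reg, if_neg (by omega), h.length], h.cand⟩

/-- A version of the loop rule with a coarse time bound. -/
theorem wp_for_flatMap_of_le {α : Type*} {D : Subroutines} {B : ℕ} {s : Store} {r : ℕ}
    {lo hi : Expr} {c : Cmd} {a b X T : ℕ} (P : List α → Store → Prop) (F : ℕ → List α)
    {acc₀ : List α} (hcost : lo.cost + hi.cost ≤ 33) (hX : b - a ≤ X) (hX' : 1 ≤ X) (hT : 1 ≤ T)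
    (hP : ∀ acc s v, P acc s → P acc (s.setReg r v))
    (hs : P acc₀ s) (hlo : lo.eval s = a) (hab : a ≤ b) (hB : b < B)
    (hhi : ∀ acc s', P acc s' → (∀ r' < r, s'.reg r' = s.reg r') → hi.eval s' = b)
    (hc : ∀ x acc s', a ≤ x → x < b → P acc s' → s'.reg r = x →
      (∀ r' < r, s'.reg r' = s.reg r') → acc ++ F x <+: acc₀ ++ (List.Ico a b).flatMap F →
      WP D B c s' fun t s'' => t ≤ T ∧ P (acc ++ F x) s'' ∧ ∀ r' ≤ r, s''.reg r' = s'.reg r') :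
    WP D B (.for r lo hi c) s fun t s' => t ≤ 81 * (X * T) ∧
      P (acc₀ ++ (List.Ico a b).flatMap F) s' ∧ ∀ r' < r, s'.reg r' = s.reg r' := by
  refine (wp_for_flatMap P F hP hs hlo hab hB hhi hc).mono fun t s' ⟨ht, h⟩ => ⟨?_, h⟩
  have h1 : (b - a) * (T + hi.cost + 7) ≤ X * (T + 40) := Nat.mul_le_mul hX (by omega)
  have h2 : X ≤ X * T := Nat.le_mul_of_pos_right _ (by omega)
  rw [mul_add X] at h1
  omega

/-- A bound for the time needed to collect a row. -/
def rowTime (L₁ L₂ N₂ w lam : ℕ) : ℕ :=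
  81 * (L₁ * (81 * ((2 * w + 1) * (81 * (L₂ * (81 * ((2 * w + 1) *
    (81 * (N₂ * (180 * (lam + 1) + 90))))))))))

theorem block_add_lt {l N k c : ℕ} (hN : 0 < N) (hk : k < numBlocks l N) (hc : c < N) :
    k * N + c < l + N := by
  have h := Nat.div_mul_le_self (l + N - 1) N
  have h2 := Nat.mul_le_mul_right N (Nat.succ_le_of_lt hk)
  rw [numBlocks] at h2
  rw [Nat.succ_mul] at h2
  omega

theorem numBlocks_le {l N : ℕ} (hN : 0 < N) : numBlocks l N ≤ l := by
  rw [numBlocks]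
  obtain rfl | hl := Nat.eq_zero_or_pos l
  · rw [Nat.div_eq_of_lt (by omega)]
  · refine Nat.div_le_of_le_mul ?_
    obtain ⟨k, rfl⟩ := Nat.exists_eq_add_of_lt hN
    obtain ⟨j, rfl⟩ := Nat.exists_eq_add_of_lt hl
    have : (0 + k + 1) * (0 + j + 1) = k * j + k + j + 1 := by ring
    omega

theorem getD_eq_iff {S S' : List IndexedSym} {p q : ℕ} (hp : p < S.length) (hq : q < S'.length) :
    S[p]? = S'[q]? ↔ (S.getD p (0, 0, 0)).1 = (S'.getD q (0, 0, 0)).1 ∧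
      (S.getD p (0, 0, 0)).2.1 = (S'.getD q (0, 0, 0)).2.1 ∧
      (S.getD p (0, 0, 0)).2.2 = (S'.getD q (0, 0, 0)).2.2 := by
  simp [List.getD, hp, hq, Prod.ext_iff]

theorem wp_collectRow {D : Subroutines} {B lam q L₁ L₂ N₁ N₂ w : ℕ} {S S' : List IndexedSym}
    {s : Store} {G : Set (ℕ × ℕ)} {o₁ o₂ : List ℕ} (h : ThresholdStore B lam s G)
    (hs : Loaded S S' N₁ N₂ w s) (hq : s.reg 15 = q) (hqS : q < S'.length)
    (h11 : s.reg 11 = o₁.length) (h13 : s.reg 13 = o₂.length)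
    (h9 : ∀ x < o₁.length, s.arr 9 x = o₁.getD x 0)
    (h10 : ∀ x < o₂.length, s.arr 10 x = o₂.getD x 0)
    (hL₁ : o₁.length ≤ L₁) (hL₂ : o₂.length ≤ L₂) (hL₁' : 1 ≤ L₁) (hL₂' : 1 ≤ L₂) (hN₂ : 0 < N₂)
    (hN₁ : 0 < N₁)
    (hSl : S.length ≤ vebSize lam) (hB : S.length + N₁ < B) (hB₁ : L₁ < B) (hB₂ : L₂ < B)
    (hrow : (rowList S S' N₁ N₂ w o₁ o₂ q).length + 1 < B) (hrc : s.reg 31 + 1 < B) :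
    WP D B collectRow s fun t s' => t ≤ rowTime L₁ L₂ N₂ w lam + 10 ∧
      Candidates s G (rowList S S' N₁ N₂ w o₁ o₂ q) s' := by
  have hcnt : numBlocks S.length N₁ < B := (numBlocks_le hN₁).trans_lt (by omega)
  have hsub : N₁ / N₂ < B := (Nat.div_le_self _ _).trans_lt (by omega)
  have hN₂₁ : N₂ * (N₁ / N₂) ≤ N₁ := Nat.mul_div_le _ _
  have e2 : s.reg 2 = N₁ := hs.reg 2 (by norm_num)
  have e3 : s.reg 3 = N₂ := hs.reg 3 (by norm_num)
  have e4 : s.reg 4 = w := hs.reg 4 (by norm_num)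
  have e0 : s.reg 0 = S.length := hs.reg 0 (by norm_num)
  have hset : ∀ r, 16 ≤ r → r < 30 → ∀ acc s' v, Candidates s G acc s' →
      Candidates s G acc (s'.setReg r v) := fun r h1 h2 _ _ _ h => h.setReg h1 h2
  have h0 : Candidates s G [] (s.setReg 32 0) :=
    ⟨fun r hr => by rw [Store.setReg_reg, if_neg (by omega)], by simp, by simp, fun _ _ _ _ => rfl,
      by simp, by simp⟩
  rw [collectRow, wp_seq, wp_assign]
  refine ⟨by simp only [Expr.eval]; omega, ?_⟩
  have h7 := hs.reg_7
  have h8 := hs.reg_8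
  have a9 : ∀ {acc s'}, Candidates s G acc s' → s'.arr 9 = s.arr 9 := fun hc =>
    hc.arr 9 (by norm_num) (by norm_num) (by norm_num)
  have a10 : ∀ {acc s'}, Candidates s G acc s' → s'.arr 10 = s.arr 10 := fun hc =>
    hc.arr 10 (by norm_num) (by norm_num) (by norm_num)
  have hwin : ∀ j cnt, min cnt (j + w + 1) - min (j - w) cnt ≤ 2 * w + 1 := by intros; omega
  have hpos : 1 ≤ 180 * (lam + 1) + 90 := by omega
  have hpos' : ∀ X T, 1 ≤ X → 1 ≤ T → 1 ≤ 81 * (X * T) := fun X T h1 h2 =>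
    Nat.mul_pos (by norm_num) (Nat.mul_pos h1 h2)
  rw [rowTime]
  generalize hT5 : 180 * (lam + 1) + 90 = T5 at hpos ⊢
  have p4 := hpos' N₂ T5 hN₂ hpos
  generalize hT4 : 81 * (N₂ * T5) = T4 at p4 ⊢
  have p3 := hpos' (2 * w + 1) T4 (by omega) p4
  generalize hT3 : 81 * ((2 * w + 1) * T4) = T3 at p3 ⊢
  have p2 := hpos' L₂ T3 hL₂' p3
  generalize hT2 : 81 * (L₂ * T3) = T2 at p2 ⊢
  have p1 := hpos' (2 * w + 1) T2 (by omega) p2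
  generalize hT1 : 81 * ((2 * w + 1) * T2) = T1 at p1 ⊢
  refine (wp_for_flatMap_of_le (a := 0) (b := o₁.length) (X := L₁) (T := T1) (Candidates s G)
    (fun x => blocksRow S S' N₁ N₂ w o₂ q (o₁.getD x 0)) (by simp [Expr.cost]) (by omega) hL₁' p1
    (hset 16 (by norm_num) (by norm_num)) h0 rfl (by omega) (by omega)
    (fun acc s' hc _ => by simp [Expr.eval, hc.reg, h11])
    fun x acc₁ s₁ _ hx hc₁ hx₁ _ hpre₁ => ?_).mono
    fun t s' ⟨ht, hc, _⟩ => ⟨by simp only [Expr.cost]; omega, hc⟩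
  rw [← hT1]
  refine (wp_for_flatMap_of_le (a := min (o₁.getD x 0 - w) (numBlocks S.length N₁))
    (b := min (numBlocks S.length N₁) (o₁.getD x 0 + w + 1)) (X := 2 * w + 1) (T := T2)
    (Candidates s G) (blockRow S S' N₁ N₂ w o₂ q) (by simp [Expr.cost, Expr.min]) (hwin _ _)
    (by omega) p2 (hset 17 (by norm_num) (by norm_num)) hc₁
    (by simp [Expr.eval, hx₁, a9 hc₁, h9 x hx, hc₁.reg, e4, h7]) (by omega) (by omega)
    (fun acc s' hc hr => by
      simp [Expr.eval, hr 16 (by norm_num), hx₁, a9 hc, h9 x hx, hc.reg, e4, h7])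
    fun k acc₂ s₂ _ hk hc₂ hk₂ _ hpre₂ => ?_).mono
    fun t s' ⟨ht, hc, hr⟩ => ⟨ht, hc, fun r' hr' => hr r' (by omega)⟩
  rw [← hT2]
  refine (wp_for_flatMap_of_le (a := 0) (b := o₂.length) (X := L₂) (T := T3) (Candidates s G)
    (fun y => windowRow S S' N₁ N₂ w q k (o₂.getD y 0)) (by simp [Expr.cost]) (by omega) hL₂' p3
    (hset 19 (by norm_num) (by norm_num)) hc₂ rfl (by omega) (by omega)
    (fun acc s' hc _ => by simp [Expr.eval, hc.reg, h13])
    fun y acc₃ s₃ _ hy hc₃ hy₃ hr₃ hpre₃ => ?_).mono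
    fun t s' ⟨ht, hc, hr⟩ => ⟨ht, hc, fun r' hr' => hr r' (by omega)⟩
  rw [← hT3]
  refine (wp_for_flatMap_of_le (a := min (o₂.getD y 0 - w) (N₁ / N₂))
    (b := min (N₁ / N₂) (o₂.getD y 0 + w + 1)) (X := 2 * w + 1) (T := T4)
    (Candidates s G) (subblockRow S S' N₁ N₂ q k) (by simp [Expr.cost, Expr.min]) (hwin _ _)
    (by omega) p4 (hset 20 (by norm_num) (by norm_num)) hc₃
    (by simp [Expr.eval, hy₃, a10 hc₃, h10 y hy, hc₃.reg, e4, h8]) (by omega) (by omega)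
    (fun acc s' hc hr => by
      simp [Expr.eval, hr 19 (by norm_num), hy₃, a10 hc, h10 y hy, hc.reg, e4, h8])
    fun k' acc₄ s₄ _ hk' hc₄ hk₄ hr₄ hpre₄ => ?_).mono
    fun t s' ⟨ht, hc, hr⟩ => ⟨ht, hc, fun r' hr' => hr r' (by omega)⟩
  rw [← hT4]
  refine (wp_for_flatMap_of_le (a := 0) (b := N₂) (X := N₂) (T := T5) (Candidates s G)
    (fun a => if k * N₁ + k' * N₂ + a < S.length ∧ S[k * N₁ + k' * N₂ + a]? = S'[q]? then
      [k * N₁ + k' * N₂ + a] else []) (by simp [Expr.cost]) (by omega) hN₂ hpos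
    (hset 22 (by norm_num) (by norm_num)) hc₄ rfl (by omega) ((Nat.div_pos_iff.1 (by omega :
      0 < N₁ / N₂)).2.trans_lt (by omega))
    (fun acc s' hc _ => by simp [Expr.eval, hc.reg, e3])
    fun a acc₅ s₅ _ ha hc₅ ha₅ hr₅ hpre₅ => ?_).mono
    fun t s' ⟨ht, hc, hr⟩ => ⟨ht, hc, fun r' hr' => hr r' (by omega)⟩
  have hsubN : k' * N₂ + a < N₁ := by
    have h1 : (k' + 1) * N₂ ≤ N₁ / N₂ * N₂ := Nat.mul_le_mul_right _ (by omega)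
    have h2 := Nat.div_mul_le_self N₁ N₂
    rw [Nat.succ_mul] at h1
    omega
  have hpB : k * N₁ + k' * N₂ + a < B := by
    have := block_add_lt (l := S.length) (c := k' * N₂ + a) hN₁ (k := k) (by omega) hsubN
    omega
  have r17 : s₅.reg 17 = k := by rw [hr₅ _ (by norm_num), hr₄ _ (by norm_num),
    hr₃ _ (by norm_num), hk₂]
  have r20 : s₅.reg 20 = k' := by rw [hr₅ _ (by norm_num), hk₄]
  have r2 : s₅.reg 2 = N₁ := by rw [hc₅.reg _ (by norm_num), e2]
  have r3 : s₅.reg 3 = N₂ := by rw [hc₅.reg _ (by norm_num), e3]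
  have r0 : s₅.reg 0 = S.length := by rw [hc₅.reg _ (by norm_num), e0]
  have r15 : s₅.reg 15 = q := by rw [hc₅.reg _ (by norm_num), hq]
  have harr : ∀ b < 6, s₅.arr b = (inputStore S S' N₁ N₂ w).arr b := fun b hb => by
    rw [hc₅.arr b (by omega) (by omega) (by omega), hs.arr b hb]
  simp only [wp_seq, wp_assign, wp_branch, wp_skip, Expr.eval, Expr.cost, Store.setReg_reg,
    Store.setReg_arr, Nat.reduceEqDiff, reduceIte, r17, r20, r2, r3, ha₅, r0, r15]
  generalize hp : k * N₁ + k' * N₂ + a = p at *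
  have hcond : ((if p < S.length then 1 else 0) * (if s₅.arr 0 p = s₅.arr 3 q then 1 else 0) *
      ((if s₅.arr 1 p = s₅.arr 4 q then 1 else 0) * if s₅.arr 2 p = s₅.arr 5 q then 1 else 0)) =
      if p < S.length ∧ S[p]? = S'[q]? then 1 else 0 := by
    by_cases hpS : p < S.length
    · rw [if_congr (and_congr_right fun _ => getD_eq_iff hpS hqS) rfl rfl]
      simp only [harr 0 (by norm_num), harr 1 (by norm_num), harr 2 (by norm_num),
        harr 3 (by norm_num), harr 4 (by norm_num), harr 5 (by norm_num), inputStore, hpS,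
        true_and, reduceIte, one_mul, ite_and]
      split_ifs <;> rfl
    · simp [hpS]
  refine ⟨hpB, ?_⟩
  rw [hcond]
  refine ⟨fun h1 => ?_, fun h1 => ?_⟩
  · have h1 : p < S.length ∧ S[p]? = S'[q]? := by simpa using h1
    rw [if_pos h1] at hpre₅ ⊢
    have hlen := ((((hpre₅.trans hpre₄).trans hpre₃).trans hpre₂).trans hpre₁).length_le
    have hlen' : (rowList S S' N₁ N₂ w o₁ o₂ q).length =
      (([] : List ℕ) ++ (List.Ico 0 o₁.length).flatMap fun x =>
        blocksRow S S' N₁ N₂ w o₂ q (o₁.getD x 0)).length := rfl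
    rw [← hlen', List.length_append, List.length_singleton] at hlen
    refine (wp_collectCandidate (p := p) h (hc₅.setReg (by norm_num) (by norm_num)) (by simp)
      (h1.1.trans_le hSl) (by omega) hrc).mono fun t s' ⟨ht, hc, hr⟩ => ⟨by omega, hc,
      fun r' hr' => ?_⟩
    rw [hr r' (by omega), Store.setReg_reg, if_neg (by omega)]
  · have h1 : ¬(p < S.length ∧ S[p]? = S'[q]?) := by simpa using h1
    rw [if_neg h1, List.append_nil]
    refine ⟨by omega, hc₅.setReg (by norm_num) (by norm_num), fun r' hr' => ?_⟩
    rw [if_neg (by omega)]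

/-! ### The graph as the union of its rows -/

theorem mem_Ico_window {cnt w j k : ℕ} :
    k ∈ List.Ico (min (j - w) cnt) (min cnt (j + w + 1)) ↔ k ∈ window cnt w j := by
  simp only [List.Ico.mem, window, List.mem_filter, List.mem_range, decide_eq_true_eq]
  omega

theorem mem_flatMap_getD {l : List ℕ} (F : ℕ → List ℕ) {p : ℕ} :
    p ∈ (List.Ico 0 l.length).flatMap (fun x => F (l.getD x 0)) ↔ ∃ j ∈ l, p ∈ F j := by
  rw [List.mem_flatMap]
  constructor
  · rintro ⟨x, hx, h⟩
    have hx : x < l.length := (List.Ico.mem.1 hx).2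
    rw [List.getD_eq_getElem _ _ hx] at h
    exact ⟨_, List.getElem_mem hx, h⟩
  · rintro ⟨j, hj, h⟩
    obtain ⟨x, hx, rfl⟩ := List.getElem_of_mem hj
    exact ⟨x, List.Ico.mem.2 ⟨Nat.zero_le _, hx⟩, by rwa [List.getD_eq_getElem _ _ hx]⟩

theorem mem_rowList {S S' : List IndexedSym} {N₁ N₂ w q p : ℕ} {o₁ o₂ : List ℕ} :
    p ∈ rowList S S' N₁ N₂ w o₁ o₂ q ↔ ∃ j ∈ o₁, ∃ k ∈ window (numBlocks S.length N₁) w j,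
      ∃ j' ∈ o₂, ∃ k' ∈ window (N₁ / N₂) w j', ∃ a < N₂, p = k * N₁ + k' * N₂ + a ∧
        p < S.length ∧ S[p]? = S'[q]? := by
  rw [rowList, mem_flatMap_getD (blocksRow S S' N₁ N₂ w o₂ q)]
  refine exists_congr fun j => and_congr_right fun _ => ?_
  rw [blocksRow, List.mem_flatMap]
  refine exists_congr fun k => and_congr mem_Ico_window ?_
  rw [blockRow, mem_flatMap_getD (windowRow S S' N₁ N₂ w q k)]
  refine exists_congr fun j' => and_congr_right fun _ => ?_
  rw [windowRow, List.mem_flatMap]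
  refine exists_congr fun k' => and_congr mem_Ico_window ?_
  rw [subblockRow, List.mem_flatMap]
  refine exists_congr fun a => and_congr (by simp) ?_
  split_ifs with h
  · rw [List.mem_singleton]
    exact ⟨fun e => by subst e; exact ⟨rfl, h⟩, fun e => e.1⟩
  · simp only [List.not_mem_nil, false_iff]
    rintro ⟨rfl, h'⟩
    exact h h'

theorem length_flatMap_Ico_le {F : ℕ → List ℕ} {a b X c : ℕ} (hX : b - a ≤ X)
    (h : ∀ x, (F x).length ≤ c) : ((List.Ico a b).flatMap F).length ≤ X * c := by
  rw [List.length_flatMap]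
  refine (List.sum_le_card_nsmul _ c fun y hy => ?_).trans ?_
  · obtain ⟨x, -, rfl⟩ := List.mem_map.1 hy
    exact h x
  · rw [List.length_map, List.Ico.length, smul_eq_mul]
    exact Nat.mul_le_mul_right _ hX

/-- The length of a row, if at most `X` blocks and at most `Y` sub-blocks are in a window. -/
theorem length_rowList_le {S S' : List IndexedSym} {N₁ N₂ w q X Y L₁ L₂ : ℕ} {o₁ o₂ : List ℕ}
    (hX : ∀ j, min (numBlocks S.length N₁) (j + w + 1) - min (j - w) (numBlocks S.length N₁) ≤ X)
    (hY : ∀ j, min (N₁ / N₂) (j + w + 1) - min (j - w) (N₁ / N₂) ≤ Y)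
    (h₁ : o₁.length ≤ L₁) (h₂ : o₂.length ≤ L₂) :
    (rowList S S' N₁ N₂ w o₁ o₂ q).length ≤ L₁ * (X * (L₂ * (Y * N₂))) := by
  refine length_flatMap_Ico_le (by omega) fun x => length_flatMap_Ico_le (hX _) fun k =>
    length_flatMap_Ico_le (by omega) fun y => length_flatMap_Ico_le (hY _) fun k' =>
    (length_flatMap_Ico_le (X := N₂) (c := 1) (by omega) fun a => ?_).trans (by omega)
  split_ifs <;> simp

section Graph

variable (D : Subroutines) (S S' : List IndexedSym) (N₁ N₂ w : ℕ)

/-- The neighbours in `S` of position `q` of `S'` (with repetitions). -/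
def rowAt (q : ℕ) : List ℕ :=
  if q < S'.length then
    rowList S S' N₁ N₂ w (D.out false (block₁ S' N₁ (q / N₁)))
      (D.out true (block₂ S' N₁ N₂ (q / N₁) (q % N₁ / N₂))) q
  else []

/-- The part of the graph that belongs to the first `Q` positions of `S'`. -/
def rowsGraph (Q : ℕ) : Set (ℕ × ℕ) := {e | e.2 < Q ∧ e.1 ∈ rowAt D S S' N₁ N₂ w e.2}

theorem rowsGraph_succ (Q : ℕ) : rowsGraph D S S' N₁ N₂ w (Q + 1) =
    rowsGraph D S S' N₁ N₂ w Q ∪ {e | e.1 ∈ rowAt D S S' N₁ N₂ w Q ∧ e.2 = Q} := by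
  ext ⟨p, q⟩
  simp only [rowsGraph, Set.mem_union, Set.mem_ofPred_eq]
  constructor
  · rintro ⟨h1, h2⟩
    obtain h | rfl : q < Q ∨ q = Q := by omega
    exacts [.inl ⟨h, h2⟩, .inr ⟨h2, rfl⟩]
  · rintro (⟨h1, h2⟩ | ⟨h2, rfl⟩)
    exacts [⟨by omega, h2⟩, ⟨by omega, h2⟩]

end Graph

theorem position_div {N₁ N₂ i i' b : ℕ} (hi' : i' < N₁ / N₂) (hb : b < N₂) :
    (i * N₁ + i' * N₂ + b) / N₁ = i ∧ (i * N₁ + i' * N₂ + b) % N₁ / N₂ = i' := by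
  have h1 : (i' + 1) * N₂ ≤ N₁ / N₂ * N₂ := Nat.mul_le_mul_right _ hi'
  have h2 := Nat.div_mul_le_self N₁ N₂
  rw [Nat.succ_mul] at h1
  have h3 : i' * N₂ + b < N₁ := by omega
  rw [add_assoc, mul_comm i]
  refine ⟨?_, ?_⟩
  · rw [Nat.mul_add_div (by omega), Nat.div_eq_of_lt h3, add_zero]
  · rw [Nat.mul_add_mod, Nat.mod_eq_of_lt h3, mul_comm, Nat.mul_add_div (by omega),
      Nat.div_eq_of_lt hb, add_zero]

/-- The loops of the algorithm, reordered by the positions of `S'`. -/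
theorem mem_matchingGraph {N₁ N₂ : ℕ} {C₁ : InsDelCode N₁} {C₂ : InsDelCode N₂}
    {D₁ : Decoder C₁} {D₂ : Decoder C₂} {w : ℕ} {S S' : List IndexedSym} (hN₂ : 0 < N₂)
    (hN : N₂ ∣ N₁) (hN₁ : 0 < N₁) {e : ℕ × ℕ} :
    e ∈ matchingGraph D₁ D₂ w S S' ↔
      e ∈ rowsGraph (D₁.subroutines D₂) S S' N₁ N₂ w (numBlocks S'.length N₁ * N₁) := by
  obtain ⟨p, q⟩ := e
  have hid : ∀ {a b : List IndexedSym} {N x y : ℕ}, (p, q) ∈ identicalPairs a b N x y ↔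
      ∃ c < N, ∃ d < N, p = x + c ∧ q = y + d ∧ p < a.length ∧ q < b.length ∧ a[p]? = b[q]? := by
    intro a b N x y
    simp only [identicalPairs, List.mem_filterMap, Prod.exists, Option.ite_none_right_eq_some,
      Option.some.injEq, Prod.mk.injEq]
    constructor
    · rintro ⟨c, d, h1, ⟨h2, h3, h4⟩, rfl, rfl⟩
      have := List.pair_mem_product.1 h1
      rw [List.mem_range, List.mem_range] at this
      exact ⟨c, this.1, d, this.2, rfl, rfl, h2, h3, h4⟩
    · rintro ⟨c, hc, d, hd, rfl, rfl, h2, h3, h4⟩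
      exact ⟨c, d, List.pair_mem_product.2 ⟨List.mem_range.2 hc, List.mem_range.2 hd⟩,
        ⟨h2, h3, h4⟩, rfl, rfl⟩
  -- In `edgeList`, the decoded lists are coerced to lists of natural numbers by the list monad.
  have hval : ∀ {k : ℕ} (l : List (Fin k)), (do let a ← l; pure (a : ℕ)) = l.map Fin.val :=
    fun l => List.map_eq_flatMap.symm
  simp only [matchingGraph, List.mem_toFinset, edgeList, List.mem_flatMap, List.mem_range, hid,
    rowsGraph, Set.mem_ofPred_eq, rowAt, hval]
  constructor
  · rintro ⟨i, hi, j, hj, k, hk, i', hi', j', hj', k', hk', a, ha, b, hb, rfl, rfl, h1, h2, h3⟩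
    obtain ⟨e1, e2⟩ := position_div (i := i) hi' hb
    refine ⟨?_, ?_⟩
    · rw [← Nat.div_lt_iff_lt_mul hN₁, e1]
      exact hi
    · rw [if_pos h2, mem_rowList, e1, e2]
      exact ⟨j, hj, k, hk, j', hj', k', hk', a, ha, rfl,
        h1, h3⟩
  · rintro ⟨h1, h2⟩
    split_ifs at h2 with h3
    · obtain ⟨j, hj, k, hk, j', hj', k', hk', a, ha, e, h4, h5⟩ := mem_rowList.1 h2
      have h6 := Nat.mod_lt q hN₁
      refine ⟨q / N₁, (Nat.div_lt_iff_lt_mul hN₁).2 h1, j, hj, k, hk, q % N₁ / N₂,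
        Nat.div_lt_div_of_lt_of_dvd hN h6, j', hj', k', hk', a, ha, q % N₁ % N₂,
        Nat.mod_lt _ hN₂, e, ?_, h4, h3, h5⟩
      have h7 := Nat.div_add_mod q N₁
      have h8 := Nat.div_add_mod (q % N₁) N₂
      rw [mul_comm (q / N₁), mul_comm (q % N₁ / N₂)]
      omega
    · simp at h2

/-! ### The loops over the positions of the second string -/

/-- The numerical hypotheses under which the main loop is analysed: `L₁` and `L₂` bound the lengths
and `T₁` and `T₂` the times of the decoder outputs, `R` bounds the lengths of the rows. -/
structure Sizes (D : Subroutines) (B lam : ℕ) (S S' : List IndexedSym)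
    (N₁ N₂ w L₁ L₂ T₁ T₂ R : ℕ) : Prop where
  pos_N₁ : 0 < N₁
  pos_N₂ : 0 < N₂
  pos_L₁ : 1 ≤ L₁
  pos_L₂ : 1 ≤ L₂
  out₁ : ∀ y, (D.out false y).length ≤ L₁
  out₂ : ∀ y, (D.out true y).length ≤ L₂
  time₁ : ∀ y, y.length ≤ N₁ → D.time false y ≤ T₁
  time₂ : ∀ y, y.length ≤ N₂ → D.time true y ≤ T₂
  row : ∀ q, (rowAt D S S' N₁ N₂ w q).length ≤ R
  length : S.length ≤ vebSize lam
  lt_B : S.length + N₁ < B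
  lt_B' : S'.length + N₁ < B
  L₁_lt : L₁ < B
  L₂_lt : L₂ < B
  records : (S'.length + N₁) * R + R + 1 < B

/-- The state of the main loop when the first `Q` positions of `S'` have been processed. -/
structure RowsDone (D : Subroutines) (B lam : ℕ) (S S' : List IndexedSym)
    (N₁ N₂ w R Q : ℕ) (s : Store) : Prop where
  loaded : Loaded S S' N₁ N₂ w s
  store : ThresholdStore B lam s (rowsGraph D S S' N₁ N₂ w Q)
  optimal : ThresholdsOptimal (rowsGraph D S S' N₁ N₂ w Q) (s.reg 30) (s.arr 13)
  records : s.reg 31 ≤ Q * R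

section Main

variable {D : Subroutines} {B lam : ℕ} {S S' : List IndexedSym} {N₁ N₂ w L₁ L₂ T₁ T₂ R : ℕ}
  {s : Store}

theorem RowsDone.setReg {Q r v : ℕ} (h : RowsDone D B lam S S' N₁ N₂ w R Q s) (hr : 10 ≤ r)
    (hr' : r < 30) : RowsDone D B lam S S' N₁ N₂ w R Q (s.setReg r v) := by
  have e : ∀ r', r' < 10 ∨ 30 ≤ r' → (s.setReg r v).reg r' = s.reg r' := fun r' h' => by
    rw [Store.setReg_reg, if_neg (by omega)]
  refine ⟨h.loaded.congr (fun r' h' => e r' (by omega)) fun _ _ => rfl,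
    h.store.congr (e _ (by norm_num)) (e _ (by norm_num)) (e _ (by norm_num)) (e _ (by norm_num))
    fun _ _ _ _ _ => rfl, ?_, ?_⟩
  · rw [e _ (by norm_num)]; exact h.optimal
  · rw [e _ (by norm_num)]; exact h.records

theorem RowsDone.setList {Q a : ℕ} {l : List ℕ} (h : RowsDone D B lam S S' N₁ N₂ w R Q s)
    (ha : a = 9 ∨ a = 10) : RowsDone D B lam S S' N₁ N₂ w R Q (s.setList a l) := by
  have e : ∀ a', a' ≠ 9 → a' ≠ 10 → (s.setList a l).arr a' = s.arr a' := fun a' h1 h2 => by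
    rw [Store.setList_arr, if_neg (by omega)]
  refine ⟨h.loaded.congr (fun _ _ => rfl) fun a' h' => e a' (by omega) (by omega),
    h.store.congr rfl rfl rfl rfl fun a' _ _ h1 h2 => e a' h1 h2, ?_, h.records⟩
  rw [e 13 (by norm_num) (by norm_num)]
  exact h.optimal

/-- Process position `b` (register 14) of the current sub-block. -/
def rowBody : Cmd :=
  .assign 15 (.plus (.plus (.times (.reg 10) (.reg 2)) (.times (.reg 12) (.reg 3))) (.reg 14)) ;;
  .branch (.less (.reg 15) (.reg 1)) (collectRow ;; processRow) .skip

theorem wp_rowBody {i i' b : ℕ} (hz : Sizes D B lam S S' N₁ N₂ w L₁ L₂ T₁ T₂ R)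
    (hs : RowsDone D B lam S S' N₁ N₂ w R (i * N₁ + i' * N₂ + b) s)
    (hi : i < numBlocks S'.length N₁) (hi' : i' < N₁ / N₂) (hb : b < N₂) (h10 : s.reg 10 = i)
    (h12 : s.reg 12 = i') (h14 : s.reg 14 = b)
    (h11 : s.reg 11 = (D.out false (block₁ S' N₁ i)).length)
    (h13 : s.reg 13 = (D.out true (block₂ S' N₁ N₂ i i')).length)
    (h9 : ∀ x < (D.out false (block₁ S' N₁ i)).length,
      s.arr 9 x = (D.out false (block₁ S' N₁ i)).getD x 0)
    (h10' : ∀ x < (D.out true (block₂ S' N₁ N₂ i i')).length,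
      s.arr 10 x = (D.out true (block₂ S' N₁ N₂ i i')).getD x 0) :
    WP D B rowBody s fun t s' =>
      t ≤ rowTime L₁ L₂ N₂ w lam + R * (420 * (lam + 1) + 108) + 40 ∧
      RowsDone D B lam S S' N₁ N₂ w R (i * N₁ + i' * N₂ + b + 1) s' ∧
      (∀ r < 15, s'.reg r = s.reg r) ∧ ∀ a < 11, s'.arr a = s.arr a := by
  obtain ⟨e1, e2⟩ := position_div (i := i) hi' hb
  have hqB : i * N₁ + i' * N₂ + b < S'.length + N₁ := by
    have h1 : (i' + 1) * N₂ ≤ N₁ / N₂ * N₂ := Nat.mul_le_mul_right _ hi'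
    have h2 := Nat.div_mul_le_self N₁ N₂
    rw [Nat.succ_mul] at h1
    have := block_add_lt (l := S'.length) (c := i' * N₂ + b) hz.pos_N₁ hi (by omega)
    omega
  have hrow := hz.row (i * N₁ + i' * N₂ + b)
  have hsucc := rowsGraph_succ D S S' N₁ N₂ w (i * N₁ + i' * N₂ + b)
  rw [rowAt, e1, e2] at hrow hsucc
  generalize hq : i * N₁ + i' * N₂ + b = q at *
  have g1 : s.reg 1 = S'.length := hs.loaded.reg 1 (by norm_num)
  have g2 : s.reg 2 = N₁ := hs.loaded.reg 2 (by norm_num)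
  have g3 : s.reg 3 = N₂ := hs.loaded.reg 3 (by norm_num)
  have hB' := hz.lt_B'
  have hrec := hs.records
  have hqR : q * R ≤ (S'.length + N₁) * R := Nat.mul_le_mul_right _ hqB.le
  have hRB := hz.records
  have hs' := hs.setReg (r := 15) (v := q) (by norm_num) (by norm_num)
  rw [rowBody, wp_seq, wp_assign, wp_branch]
  simp only [Expr.eval, Expr.cost, h10, h12, h14, g2, g3, hq, Store.setReg_reg, reduceIte,
    Nat.reduceEqDiff, g1, wp_skip, wp_seq]
  refine ⟨by omega, fun h1 => ?_, fun h1 => ?_⟩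
  · have h1 : q < S'.length := by simpa using h1
    rw [if_pos h1] at hrow hsucc
    refine (wp_collectRow (L₁ := L₁) (L₂ := L₂) hs'.store hs'.loaded (by simp) h1
      (by simpa using h11) (by simpa using h13) h9 h10' (hz.out₁ _) (hz.out₂ _) hz.pos_L₁ hz.pos_L₂
      hz.pos_N₂ hz.pos_N₁ hz.length hz.lt_B hz.L₁_lt hz.L₂_lt (by omega) (by simp; omega)).mono
      fun t₁ s₁ ⟨ht₁, hc⟩ => ?_
    refine (wp_processRow hs'.store hs'.optimal hc (fun p hp => ?_) (fun e he => he.1) hsucc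
      (by simp) (by omega) (by simp; omega)).mono
      fun t₂ s₂ ⟨ht₂, hst, hopt, hr31, hreg, harr⟩ =>
        ⟨?_, ⟨?_, hst, hopt, ?_⟩, fun r hr => ?_, harr⟩
    · obtain ⟨-, -, -, -, -, -, -, -, -, -, -, h2, -⟩ := mem_rowList.1 hp
      exact h2.trans_le hz.length
    · have := Nat.mul_le_mul_right (420 * (lam + 1) + 108) hrow
      omega
    · exact hs.loaded.congr (fun r hr => by
        rw [hreg r (by omega), Store.setReg_reg, if_neg (by omega)]) fun a ha => harr a (by omega)
    · simp only [Store.setReg_reg, Nat.reduceEqDiff, reduceIte] at hr31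
      rw [Nat.succ_mul]
      omega
    · rw [hreg r (by omega), Store.setReg_reg, if_neg (by omega)]
  · have h1 : ¬q < S'.length := by simpa using h1
    rw [if_neg h1] at hsucc
    have hsucc : rowsGraph D S S' N₁ N₂ w (q + 1) = rowsGraph D S S' N₁ N₂ w q := by
      rw [hsucc]; simp
    refine ⟨by omega, ⟨hs'.loaded, by rw [hsucc]; exact hs'.store,
      by rw [hsucc]; exact hs'.optimal, ?_⟩, fun r hr => by rw [if_neg (by omega)], fun _ _ => rfl⟩
    have := hs'.records
    rw [Nat.succ_mul]
    omega

/-- The array segment that a decoder is called on is a block: both are cut off at the end of `S'`.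
-/
theorem segment_block {s : Store} {S' : List IndexedSym} {f : IndexedSym → ℕ} {a start len : ℕ}
    (ha : ∀ p < S'.length, s.arr a p = f (S'.getD p (0, 0, 0))) :
    ((S'.drop start).take len).map f =
      s.segment a start (min len (S'.length - start)) := by
  refine List.ext_getElem (by simp [Store.segment]) fun x h1 h2 => ?_
  simp only [List.length_map, List.length_take, List.length_drop] at h1
  have h3 : start + x < S'.length := by omega
  simp [Store.segment, ha _ h3, List.getD, h3]

/-- Decode sub-block `i'` (register 12) of the current block, and process its positions. -/
def subblockBody : Cmd :=
  .decode true 5 (.plus (.times (.reg 10) (.reg 2)) (.times (.reg 12) (.reg 3)))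
    (.min (.reg 3)
      (.minus (.reg 1) (.plus (.times (.reg 10) (.reg 2)) (.times (.reg 12) (.reg 3)))))
    10 13 ;;
  .for 14 (.lit 0) (.reg 3) rowBody

/-- A bound for the time that a position of the second string takes in the main loop. -/
def positionTime (L₁ L₂ N₂ w R lam : ℕ) : ℕ :=
  rowTime L₁ L₂ N₂ w lam + R * (420 * (lam + 1) + 108) + 200

theorem wp_subblockBody {i i' : ℕ} (hz : Sizes D B lam S S' N₁ N₂ w L₁ L₂ T₁ T₂ R)
    (hs : RowsDone D B lam S S' N₁ N₂ w R (i * N₁ + i' * N₂) s)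
    (hi : i < numBlocks S'.length N₁) (hi' : i' < N₁ / N₂) (h10 : s.reg 10 = i)
    (h12 : s.reg 12 = i') (h11 : s.reg 11 = (D.out false (block₁ S' N₁ i)).length)
    (h9 : ∀ x < (D.out false (block₁ S' N₁ i)).length,
      s.arr 9 x = (D.out false (block₁ S' N₁ i)).getD x 0) :
    WP D B subblockBody s fun t s' =>
      t ≤ T₂ + N₂ * positionTime L₁ L₂ N₂ w R lam ∧
      RowsDone D B lam S S' N₁ N₂ w R (i * N₁ + (i' + 1) * N₂) s' ∧
      (∀ r < 13, s'.reg r = s.reg r) ∧ s'.arr 9 = s.arr 9 := by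
  have g1 : s.reg 1 = S'.length := hs.loaded.reg 1 (by norm_num)
  have g2 : s.reg 2 = N₁ := hs.loaded.reg 2 (by norm_num)
  have g3 : s.reg 3 = N₂ := hs.loaded.reg 3 (by norm_num)
  have hN₂B : N₂ < B := by
    have h1 := (Nat.div_pos_iff.1 (by omega : 0 < N₁ / N₂)).2
    have h2 := hz.lt_B
    omega
  have ht : (block₂ S' N₁ N₂ i i').length ≤ N₂ := by simp [block₂]
  have ht := hz.time₂ _ ht
  rw [subblockBody, wp_seq]
  refine wp_decode (block₂ S' N₁ N₂ i i') ?_ ?_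
  · simp only [Expr.eval, Expr.eval_min, h10, h12, g1, g2, g3]
    refine segment_block fun p _ => ?_
    rw [hs.loaded.arr 5 (by norm_num)]
    rfl
  have hs₁ := (hs.setList (l := D.out true (block₂ S' N₁ N₂ i i')) (.inr rfl)).setReg (r := 13)
    (v := (D.out true (block₂ S' N₁ N₂ i i')).length) (by norm_num) (by norm_num)
  have hr₁ : ∀ r, r ≠ 13 → ((s.setList 10 (D.out true (block₂ S' N₁ N₂ i i'))).setReg 13
      (D.out true (block₂ S' N₁ N₂ i i')).length).reg r = s.reg r := fun r hr => by
    rw [Store.setReg_reg, if_neg hr, Store.setList_reg]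
  generalize hs₁' : (s.setList 10 (D.out true (block₂ S' N₁ N₂ i i'))).setReg 13
      (D.out true (block₂ S' N₁ N₂ i i')).length = s₁ at hs₁ hr₁
  have hr13 : s₁.reg 13 = (D.out true (block₂ S' N₁ N₂ i i')).length := by rw [← hs₁']; simp
  have ha10 : ∀ x < (D.out true (block₂ S' N₁ N₂ i i')).length,
      s₁.arr 10 x = (D.out true (block₂ S' N₁ N₂ i i')).getD x 0 := fun x hx => by
    rw [← hs₁']; simp [List.getD, hx]
  have ha9 : s₁.arr 9 = s.arr 9 := by rw [← hs₁']; simp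
  refine (wp_for (a := 0) (b := N₂)
    (T := rowTime L₁ L₂ N₂ w lam + R * (420 * (lam + 1) + 108) + 40)
    (fun b s' => RowsDone D B lam S S' N₁ N₂ w R (i * N₁ + i' * N₂ + b) s' ∧ s'.reg 14 = b ∧
      (∀ r < 14, s'.reg r = s₁.reg r) ∧ ∀ a < 11, s'.arr a = s₁.arr a)
    rfl (by omega) hN₂B ?_ (fun b s' h => ⟨h.2.1, ?_⟩) ?_).mono ?_
  · exact ⟨hs₁.setReg (by norm_num) (by norm_num), by simp, fun r hr => by
      rw [Store.setReg_reg, if_neg (by omega)], fun _ _ => rfl⟩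
  · simp [Expr.eval, h.2.2.1, hr₁, g3]
  · rintro b s' - hb ⟨h1, h2, h3, h4⟩
    refine (wp_rowBody hz h1 hi hi' hb (by rw [h3 _ (by norm_num), hr₁ _ (by norm_num), h10])
      (by rw [h3 _ (by norm_num), hr₁ _ (by norm_num), h12]) h2
      (by rw [h3 _ (by norm_num), hr₁ _ (by norm_num), h11]) (by rw [h3 _ (by norm_num), hr13])
      (by rw [h4 _ (by norm_num), ha9]; exact h9)
      (by rw [h4 _ (by norm_num)]; exact ha10)).mono fun t s₂ ⟨ht, hd, hr, ha⟩ =>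
      ⟨ht, by rw [hr _ (by norm_num), h2], hd.setReg (by norm_num) (by norm_num), by simp,
        fun r hr' => ?_, fun a ha' => by rw [← h4 a ha', ← ha a ha']; rfl⟩
    rw [Store.setReg_reg, if_neg (by omega), hr r (by omega), h3 r hr']
  · rintro t s' ⟨ht', h1, -, h3, h4⟩
    refine ⟨?_, ?_, fun r hr => by rw [h3 r (by omega), hr₁ r (by omega)],
      by rw [h4 _ (by norm_num), ha9]⟩
    · simp only [Expr.cost, Expr.min, Nat.sub_zero] at ht' ⊢
      have h5 : N₂ * positionTime L₁ L₂ N₂ w R lam = N₂ *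
          (rowTime L₁ L₂ N₂ w lam + R * (420 * (lam + 1) + 108) + 40 + 1 + 7) + N₂ * 152 := by
        rw [positionTime]; ring
      have := hz.pos_N₂
      omega
    · rw [Nat.succ_mul, ← add_assoc]
      exact h1

/-- Decode block `i` (register 10) of the second string, and process its sub-blocks. -/
def blockBody : Cmd :=
  .decode false 4 (.times (.reg 10) (.reg 2))
    (.min (.reg 2) (.minus (.reg 1) (.times (.reg 10) (.reg 2)))) 9 11 ;;
  .for 12 (.lit 0) (.reg 8) subblockBody

theorem wp_blockBody {i : ℕ} (hz : Sizes D B lam S S' N₁ N₂ w L₁ L₂ T₁ T₂ R) (hN : N₂ ∣ N₁)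
    (hs : RowsDone D B lam S S' N₁ N₂ w R (i * N₁) s)
    (hi : i < numBlocks S'.length N₁) (h10 : s.reg 10 = i) :
    WP D B blockBody s fun t s' =>
      t ≤ T₁ + N₁ / N₂ * (T₂ + N₂ * positionTime L₁ L₂ N₂ w R lam + 50) + 50 ∧
      RowsDone D B lam S S' N₁ N₂ w R ((i + 1) * N₁) s' ∧ s'.reg 10 = i := by
  have g1 : s.reg 1 = S'.length := hs.loaded.reg 1 (by norm_num)
  have g2 : s.reg 2 = N₁ := hs.loaded.reg 2 (by norm_num)
  have g8 : s.reg 8 = N₁ / N₂ := hs.loaded.reg_8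
  have hB := hz.lt_B
  have hdiv := Nat.div_le_self N₁ N₂
  have ht : (block₁ S' N₁ i).length ≤ N₁ := by simp [block₁]
  have ht := hz.time₁ _ ht
  rw [blockBody, wp_seq]
  refine wp_decode (block₁ S' N₁ i) ?_ ?_
  · simp only [Expr.eval, Expr.eval_min, h10, g1, g2]
    refine segment_block fun p _ => ?_
    rw [hs.loaded.arr 4 (by norm_num)]
    rfl
  have hs₁ := (hs.setList (l := D.out false (block₁ S' N₁ i)) (.inl rfl)).setReg (r := 11)
    (v := (D.out false (block₁ S' N₁ i)).length) (by norm_num) (by norm_num)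
  have hr₁ : ∀ r, r ≠ 11 → ((s.setList 9 (D.out false (block₁ S' N₁ i))).setReg 11
      (D.out false (block₁ S' N₁ i)).length).reg r = s.reg r := fun r hr => by
    rw [Store.setReg_reg, if_neg hr, Store.setList_reg]
  generalize hs₁' : (s.setList 9 (D.out false (block₁ S' N₁ i))).setReg 11
      (D.out false (block₁ S' N₁ i)).length = s₁ at hs₁ hr₁
  have hr11 : s₁.reg 11 = (D.out false (block₁ S' N₁ i)).length := by rw [← hs₁']; simp
  have ha9 : ∀ x < (D.out false (block₁ S' N₁ i)).length,
      s₁.arr 9 x = (D.out false (block₁ S' N₁ i)).getD x 0 := fun x hx => by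
    rw [← hs₁']; simp [List.getD, hx]
  refine (wp_for (a := 0) (b := N₁ / N₂) (T := T₂ + N₂ * positionTime L₁ L₂ N₂ w R lam)
    (fun i' s' => RowsDone D B lam S S' N₁ N₂ w R (i * N₁ + i' * N₂) s' ∧ s'.reg 12 = i' ∧
      (∀ r < 12, s'.reg r = s₁.reg r) ∧ s'.arr 9 = s₁.arr 9)
    rfl (by omega) (by omega) ?_ (fun i' s' h => ⟨h.2.1, ?_⟩) ?_).mono ?_
  · exact ⟨by simpa using hs₁.setReg (by norm_num) (by norm_num), by simp, fun r hr => by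
      rw [Store.setReg_reg, if_neg (by omega)], rfl⟩
  · simp [Expr.eval, h.2.2.1, hr₁, g8]
  · rintro i' s' - hi' ⟨h1, h2, h3, h4⟩
    refine (wp_subblockBody hz h1 hi hi' (by rw [h3 _ (by norm_num), hr₁ _ (by norm_num), h10]) h2
      (by rw [h3 _ (by norm_num), hr11]) (by rw [h4]; exact ha9)).mono
      fun t s₂ ⟨ht, hd, hr, ha⟩ => ⟨ht, by rw [hr _ (by norm_num), h2],
        hd.setReg (by norm_num) (by norm_num), by simp, fun r hr' => ?_, by rw [← h4, ← ha]; rfl⟩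
    rw [Store.setReg_reg, if_neg (by omega), hr r (by omega), h3 r hr']
  · rintro t s' ⟨ht', h1, -, h3, -⟩
    refine ⟨?_, ?_, by rw [h3 _ (by norm_num), hr₁ _ (by norm_num), h10]⟩
    · simp only [Expr.cost, Expr.min, Nat.sub_zero] at ht' ⊢
      generalize T₂ + N₂ * positionTime L₁ L₂ N₂ w R lam = X at ht' ⊢
      have h5 : N₁ / N₂ * (X + 50) = N₁ / N₂ * (X + 1 + 7) + N₁ / N₂ * 42 := by ring
      omega
    · rw [Nat.div_mul_cancel hN] at h1
      rwa [Nat.succ_mul]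

/-- Process all blocks of the second string. -/
def mainLoop : Cmd := .for 10 (.lit 0) (.reg 9) blockBody

theorem wp_mainLoop (hz : Sizes D B lam S S' N₁ N₂ w L₁ L₂ T₁ T₂ R) (hN : N₂ ∣ N₁)
    (hs : RowsDone D B lam S S' N₁ N₂ w R 0 s) :
    WP D B mainLoop s fun t s' => t ≤ numBlocks S'.length N₁ *
      (T₁ + N₁ / N₂ * (T₂ + N₂ * positionTime L₁ L₂ N₂ w R lam + 50) + 58) + 6 ∧
      RowsDone D B lam S S' N₁ N₂ w R (numBlocks S'.length N₁ * N₁) s' := by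
  have hB := hz.lt_B'
  have hb := numBlocks_le (l := S'.length) hz.pos_N₁
  refine (wp_for (a := 0) (b := numBlocks S'.length N₁)
    (T := T₁ + N₁ / N₂ * (T₂ + N₂ * positionTime L₁ L₂ N₂ w R lam + 50) + 50)
    (fun i s' => RowsDone D B lam S S' N₁ N₂ w R (i * N₁) s' ∧ s'.reg 10 = i)
    rfl (by omega) (by omega) ⟨by simpa using hs.setReg (by norm_num) (by norm_num), by simp⟩
    (fun i s' h => ⟨h.2, by exact h.1.loaded.reg_9⟩) ?_).mono ?_
  · rintro i s' - hi ⟨h1, h2⟩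
    exact (wp_blockBody hz hN h1 hi h2).mono fun t s₂ ⟨ht, hd, hr⟩ =>
      ⟨ht, hr, hd.setReg (by norm_num) (by norm_num), by simp⟩
  · rintro t s' ⟨ht, h1, -⟩
    exact ⟨by simpa [Expr.cost] using ht, h1⟩

end Main

/-! ### Initialisation and output -/

/-- Square register 40, beginning with 2, until it is at least register 0. Its values, the universe
sizes, are put into array 8, and register 5 counts them. -/
def buildTable : Cmd :=
  .assign 40 (.lit 2) ;; .write 8 (.lit 0) (.lit 2) ;;
  .loop (.less (.reg 40) (.reg 0))
    (.assign 40 (.times (.reg 40) (.reg 40)) ;; .assign 5 (.plus (.reg 5) (.lit 1)) ;;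
      .write 8 (.reg 5) (.reg 40))

theorem wp_tableLoop {D : Subroutines} {B lam d k : ℕ} {s : Store} (h40 : s.reg 40 = vebSize k)
    (h5 : s.reg 5 = k) (h8 : ∀ j ≤ k, s.arr 8 j = vebSize j) (hk : k + d = lam)
    (hlt : ∀ j < lam, vebSize j < s.reg 0) (hle : s.reg 0 ≤ vebSize lam) (hB : vebSize lam < B) :
    WP D B (.loop (.less (.reg 40) (.reg 0))
      (.assign 40 (.times (.reg 40) (.reg 40)) ;; .assign 5 (.plus (.reg 5) (.lit 1)) ;;
        .write 8 (.reg 5) (.reg 40))) s fun t s' => t ≤ d * 20 + 4 ∧ s'.reg 5 = lam ∧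
      (∀ j ≤ lam, s'.arr 8 j = vebSize j) ∧ (∀ r, r ≠ 5 → r ≠ 40 → s'.reg r = s.reg r) ∧
      ∀ a, a ≠ 8 → s'.arr a = s.arr a := by
  induction d generalizing k s with
  | zero =>
    obtain rfl : k = lam := hk
    refine wp_loop_false ?_ ⟨by simp [Expr.cost], h5, h8, fun _ _ _ => rfl, fun _ _ => rfl⟩
    simp [Expr.eval, h40, hle]
  | succ d ih =>
    have hk1 : vebSize (k + 1) < B := (vebSize_mono (by omega)).trans_lt hB
    have hk2 := lt_vebSize (k + 1)
    refine wp_loop_true ?_ ?_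
    · simp [Expr.eval, h40, hlt k (by omega)]
    simp only [wp_seq, wp_assign, wp_write, Expr.eval, Expr.cost, Store.setReg_reg, h40, h5,
      Nat.reduceEqDiff, reduceIte, ← vebSize_succ]
    refine ⟨hk1, by omega, by omega, hk1, (ih (k := k + 1) (by simp) (by simp) (fun j hj => ?_)
      (by omega) (by simpa using hlt) (by simpa using hle)).mono
      fun t s' ⟨ht, e5, e8, hr, ha⟩ => ⟨by omega, e5, e8, fun r h1 h2 => ?_, fun a h1 => ?_⟩⟩
    · simp only [Store.setCell_arr, reduceIte, Store.setReg_arr, Function.update_apply]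
      split_ifs with h
      · rw [h]
      · exact h8 j (by omega)
    · rw [hr r h1 h2]; simp [h1, h2]
    · rw [ha a h1]; simp [h1]

/-- Set up the registers and the table that the main loop relies on. -/
def setUp : Cmd :=
  .assign 7 (.quot (.minus (.plus (.reg 0) (.reg 2)) (.lit 1)) (.reg 2)) ;;
  .assign 8 (.quot (.reg 2) (.reg 3)) ;;
  .assign 9 (.quot (.minus (.plus (.reg 1) (.reg 2)) (.lit 1)) (.reg 2)) ;;
  buildTable ;;
  .assign 6 (.plus (.reg 5) (.lit 1))

section Program

variable {D : Subroutines} {B lam : ℕ} {S S' : List IndexedSym} {N₁ N₂ w L₁ L₂ T₁ T₂ R : ℕ}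

theorem wp_setUp (hz : Sizes D B lam S S' N₁ N₂ w L₁ L₂ T₁ T₂ R)
    (hlt : ∀ j < lam, vebSize j < S.length) (hB : vebSize lam * (lam + 1) < B) :
    WP D B setUp (inputStore S S' N₁ N₂ w) fun t s => t ≤ lam * 20 + 50 ∧
      RowsDone D B lam S S' N₁ N₂ w R 0 s := by
  have hb := numBlocks_le (l := S.length) hz.pos_N₁
  have hb' := numBlocks_le (l := S'.length) hz.pos_N₁
  have hdiv := Nat.div_le_self N₁ N₂
  have h1 := hz.lt_B
  have h2 := hz.lt_B'
  have hlamB : vebSize lam ≤ vebSize lam * (lam + 1) := Nat.le_mul_of_pos_right _ (by omega)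
  have hlam := lt_vebSize lam
  have hle := hz.length
  have h3 := two_le_vebSize lam
  have e0 : (inputStore S S' N₁ N₂ w).reg 0 = S.length := rfl
  have e1 : (inputStore S S' N₁ N₂ w).reg 1 = S'.length := rfl
  have e2 : (inputStore S S' N₁ N₂ w).reg 2 = N₁ := rfl
  have e3 : (inputStore S S' N₁ N₂ w).reg 3 = N₂ := rfl
  have er : ∀ r, 5 ≤ r → (inputStore S S' N₁ N₂ w).reg r = 0 := by
    intro r hr
    match r, hr with
    | r + 5, _ => rfl
  have ea : ∀ a, 6 ≤ a → (inputStore S S' N₁ N₂ w).arr a = fun _ => 0 := by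
    intro a ha
    match a, ha with
    | a + 6, _ => rfl
  simp only [setUp, buildTable, wp_seq, wp_assign, wp_write, Expr.eval, Expr.cost,
    Store.setReg_reg, Nat.reduceEqDiff, reduceIte, e0, e1, e2, e3]
  refine ⟨hb.trans_lt (by omega), by omega, hb'.trans_lt (by omega), by omega, by omega, by omega,
    (wp_tableLoop (lam := lam) (d := lam) (k := 0) (by simp [vebSize]) (by simp [er])
      (fun j hj => ?_) (by omega) (by simpa [e0] using hlt) (by simpa [e0] using hle)
      (by omega)).mono fun t s ⟨ht, h5, h8, hr, ha⟩ => ⟨by omega, by omega, ?_⟩⟩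
  · obtain rfl : j = 0 := by omega
    simp [vebSize]
  have hreg : ∀ r, r ≠ 5 → r ≠ 6 → r ≠ 7 → r ≠ 8 → r ≠ 9 → r ≠ 40 →
      (s.setReg 6 (s.reg 5 + 1)).reg r = (inputStore S S' N₁ N₂ w).reg r := by
    intro r h1 h2 h3 h4 h5 h6
    rw [Store.setReg_reg, if_neg h2, hr r h1 h6]
    simp [h3, h4, h5, h6]
  have harr : ∀ a, a ≠ 8 → (s.setReg 6 (s.reg 5 + 1)).arr a = (inputStore S S' N₁ N₂ w).arr a := by
    intro a h1
    rw [Store.setReg_arr, ha a h1]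
    simp [h1]
  have h30 : (s.setReg 6 (s.reg 5 + 1)).reg 30 = 0 := by
    rw [hreg _ (by norm_num) (by norm_num) (by norm_num) (by norm_num) (by norm_num) (by norm_num),
      er _ (by norm_num)]
  have h31 : (s.setReg 6 (s.reg 5 + 1)).reg 31 = 0 := by
    rw [hreg _ (by norm_num) (by norm_num) (by norm_num) (by norm_num) (by norm_num) (by norm_num),
      er _ (by norm_num)]
  have ha0 : ∀ a, 9 ≤ a → (s.setReg 6 (s.reg 5 + 1)).arr a = fun _ => 0 := fun a h => by
    rw [harr a (by omega), ea a (by omega)]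
  have hempty : rowsGraph D S S' N₁ N₂ w 0 = ∅ := by
    ext e; simp [rowsGraph]
  refine ⟨⟨fun r h => hreg r (by omega) (by omega) (by omega) (by omega) (by omega) (by omega),
    ?_, ?_, ?_, fun a h => harr a (by omega)⟩, ⟨⟨by simp [h5], by simp [h5], by simpa using h8, hB⟩,
    ?_, ?_, ?_⟩, ?_, ?_⟩
  · rw [Store.setReg_reg, if_neg (by norm_num), hr _ (by norm_num) (by norm_num)]
    simp [numBlocks]
  · rw [Store.setReg_reg, if_neg (by norm_num), hr _ (by norm_num) (by norm_num)]
    simp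
  · rw [Store.setReg_reg, if_neg (by norm_num), hr _ (by norm_num) (by norm_num)]
    simp [numBlocks]
  · rw [h30, VebSet, ha0 11 (by norm_num), ha0 12 (by norm_num)]
    convert VebRep.empty lam 0 using 1
    ext x
    simp only [Set.mem_ofPred_eq, Set.mem_empty_iff_false, iff_false]
    rintro ⟨k, h1, h2, -⟩
    omega
  · rw [h30]; intro k h1 h2; omega
  · rw [h30, h31, ha0 14 (by norm_num), ha0 18 (by norm_num)]
    exact ⟨fun _ => le_rfl, fun _ => le_rfl, le_rfl, fun k h1 h2 => by omega,
      fun k h1 h2 => by omega⟩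
  · rw [hempty]
    intro M x hM _ hne
    obtain ⟨e, he⟩ := List.exists_mem_of_ne_nil M hne
    exact (hM.1 e he).elim
  · rw [h31]; exact Nat.zero_le _

/-- Write the recorded chain that belongs to the last threshold into the output arrays. -/
def writeMatching : Cmd :=
  .assign 35 (.reg 30) ;; .assign 36 (.read 14 (.reg 30)) ;;
  .loop (.reg 35)
    (.assign 35 (.minus (.reg 35) (.lit 1)) ;; .write 6 (.reg 35) (.read 16 (.reg 36)) ;;
      .write 7 (.reg 35) (.read 17 (.reg 36)) ;; .assign 36 (.read 18 (.reg 36))) ;;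
  .assign 0 (.reg 30)

theorem wp_writeLoop {k r rc : ℕ} {s : Store} (h35 : s.reg 35 = k) (h36 : s.reg 36 = r)
    (hk : k < B) (hA : ∀ r, s.arr 18 r ≤ rc) (hrc : rc < B)
    (hM : ∀ e ∈ readChain (s.arr 16) (s.arr 17) (s.arr 18) k r, e.1 < B ∧ e.2 < B) :
    WP D B (.loop (.reg 35)
      (.assign 35 (.minus (.reg 35) (.lit 1)) ;; .write 6 (.reg 35) (.read 16 (.reg 36)) ;;
        .write 7 (.reg 35) (.read 17 (.reg 36)) ;; .assign 36 (.read 18 (.reg 36)))) s fun t s' =>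
      t ≤ k * 20 + 2 ∧ s'.reg 30 = s.reg 30 ∧
      (List.range k).map (fun i => (s'.arr 6 i, s'.arr 7 i)) =
        readChain (s.arr 16) (s.arr 17) (s.arr 18) k r ∧
      ∀ j, k ≤ j → s'.arr 6 j = s.arr 6 j ∧ s'.arr 7 j = s.arr 7 j := by
  induction k generalizing r s with
  | zero => exact wp_loop_false h35 ⟨by simp [Expr.cost], rfl, rfl, fun _ _ => ⟨rfl, rfl⟩⟩
  | succ k ih =>
    have hlast : s.arr 16 r < B ∧ s.arr 17 r < B :=
      hM (s.arr 16 r, s.arr 17 r) (by simp [readChain])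
    refine wp_loop_true (by simp [Expr.eval, h35]) ?_
    simp only [wp_seq, wp_assign, wp_write, Expr.eval, Expr.cost, Store.setReg_reg,
      Store.setReg_arr, Store.setCell_reg, Store.setCell_arr, h35, h36, Nat.reduceEqDiff, reduceIte,
      Nat.add_sub_cancel]
    refine ⟨by omega, by omega, hlast.1, by omega, hlast.2, (hA r).trans_lt hrc,
      (ih (r := s.arr 18 r) (by simp) (by simp) (by omega) (by simpa using hA)
        (fun e he => hM e ?_)).mono
        fun t s' ⟨ht, h30, hmap, hj⟩ => ⟨by omega, by simpa using h30, ?_, fun j hkj => ?_⟩⟩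
    · simp only [Store.setReg_arr, Store.setCell_arr, Nat.reduceEqDiff, reduceIte] at he
      simp [readChain, he]
    · rw [List.range_succ, List.map_append, hmap]
      simp [readChain, hj k le_rfl]
    · obtain ⟨h1, h2⟩ := hj j (by omega)
      rw [h1, h2]
      simp [Function.update_of_ne (by omega : j ≠ k)]

theorem wp_writeMatching {s : Store} {G : Set (ℕ × ℕ)} (h : ThresholdStore B lam s G)
    (hopt : ThresholdsOptimal G (s.reg 30) (s.arr 13)) (hrc : s.reg 31 < B)
    (hG : ∀ e ∈ G, e.1 < B ∧ e.2 < B) :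
    WP D B writeMatching s fun t s' => t ≤ s.reg 31 * 20 + 20 ∧ NonCrossingIn G s'.output ∧
      ∀ M, NonCrossingIn G M → M.length ≤ s'.output.length := by
  have hm := h.thresholds.size_le
  have hchain : NonCrossingIn G (readChain (s.arr 16) (s.arr 17) (s.arr 18) (s.reg 30)
      (s.arr 14 (s.reg 30))) := by
    obtain h0 | h0 := Nat.eq_zero_or_pos (s.reg 30)
    · rw [h0]
      exact ⟨fun e he => (List.not_mem_nil he).elim, .nil⟩
    · exact (h.thresholds.chain _ h0 le_rfl).1
  simp only [writeMatching, wp_seq, wp_assign, Expr.eval, Expr.cost, Store.setReg_reg,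
    Store.setReg_arr, Nat.reduceEqDiff, reduceIte]
  refine ⟨by omega, (h.thresholds.rec_le _).trans_lt hrc, (wp_writeLoop (k := s.reg 30)
    (r := s.arr 14 (s.reg 30))
    (s := (s.setReg 35 (s.reg 30)).setReg 36 (s.arr 14 (s.reg 30))) (by simp) (by simp) (by omega)
    h.thresholds.pred_le hrc
    fun e he => hG e (hchain.1 e he)).mono fun t s' ⟨ht, h30, hmap, _⟩ => ?_⟩
  have h30 : s'.reg 30 = s.reg 30 := by simpa using h30
  rw [h30]
  have hout : (s'.setReg 0 (s.reg 30)).output =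
      readChain (s.arr 16) (s.arr 17) (s.arr 18) (s.reg 30) (s.arr 14 (s.reg 30)) := by
    rw [Store.output, Store.setReg_reg, if_pos rfl]
    exact hmap
  rw [hout, length_readChain]
  refine ⟨by omega, by omega, hchain, fun M hM => ?_⟩
  obtain rfl | hne := eq_or_ne M []
  · exact Nat.zero_le _
  · exact (hopt M (M.foldr (fun e x => max e.1 x) 0) hM (fun e he => by
      clear hM hne
      induction M with
      | nil => simp at he
      | cons a M ih =>
        obtain rfl | he := List.mem_cons.1 he
        · exact le_max_left _ _
        · exact (ih he).trans (le_max_right _ _)) hne).1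

/-- Compute a largest non-crossing matching of the graph of the algorithm. -/
def matchingProgram : Cmd := setUp ;; mainLoop ;; writeMatching

theorem wp_matchingProgram (hz : Sizes D B lam S S' N₁ N₂ w L₁ L₂ T₁ T₂ R) (hN : N₂ ∣ N₁)
    (hlt : ∀ j < lam, vebSize j < S.length) (hB : vebSize lam * (lam + 1) < B) :
    WP D B matchingProgram (inputStore S S' N₁ N₂ w) fun t s =>
      t ≤ lam * 20 + numBlocks S'.length N₁ *
        (T₁ + N₁ / N₂ * (T₂ + N₂ * positionTime L₁ L₂ N₂ w R lam + 50) + 58) +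
        numBlocks S'.length N₁ * N₁ * R * 20 + 76 ∧
      NonCrossingIn (rowsGraph D S S' N₁ N₂ w (numBlocks S'.length N₁ * N₁)) s.output ∧
      ∀ M, NonCrossingIn (rowsGraph D S S' N₁ N₂ w (numBlocks S'.length N₁ * N₁)) M →
        M.length ≤ s.output.length := by
  rw [matchingProgram, wp_seq]
  refine (wp_setUp hz hlt hB).mono fun t₁ s₁ ⟨ht₁, hs₁⟩ => ?_
  rw [wp_seq]
  refine (wp_mainLoop hz hN hs₁).mono fun t₂ s₂ ⟨ht₂, hs₂⟩ => ?_
  have hrec := hs₂.records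
  have hrB := hz.records
  have hQ : numBlocks S'.length N₁ * N₁ ≤ S'.length + N₁ :=
    (Nat.div_mul_le_self _ _).trans (by omega)
  have hQR := Nat.mul_le_mul_right R hQ
  refine (wp_writeMatching hs₂.store hs₂.optimal (by omega) fun e he => ?_).mono
    fun t₃ s₃ ⟨ht₃, h1, h2⟩ => ⟨by omega, h1, h2⟩
  obtain ⟨h1, h2⟩ := he
  have hlt := hz.lt_B
  have hlt' := hz.lt_B'
  rw [rowAt] at h2
  split_ifs at h2 with h3
  · obtain ⟨-, -, -, -, -, -, -, -, -, -, -, h4, -⟩ := mem_rowList.1 h2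
    exact ⟨by omega, by omega⟩
  · simp at h2

end Program

/-! ### Time, word size, and the number of edges -/

/-- The height of the van Emde Boas tree is at most proportional to `log (log n)`. -/
theorem exists_height_le : ∃ K : ℝ, 1 ≤ K ∧ ∀ n lam : ℕ, 3 ≤ n → (∀ j < lam, vebSize j < n) →
    ((lam + 1 : ℕ) : ℝ) ≤ K * Real.log (Real.log n) := by
  have h3 : 1 < Real.log 3 := by
    rw [Real.lt_log_iff_exp_lt (by norm_num)]
    exact Real.exp_one_lt_d9.trans (by norm_num)
  set c := Real.log (Real.log 3) with hc
  have hc0 : 0 < c := Real.log_pos h3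
  have hK : 0 < 4 / c := by positivity
  refine ⟨2 + 4 / c, by linarith, fun n lam hn hlam => ?_⟩
  have hn' : (3 : ℝ) ≤ n := by exact_mod_cast hn
  have hlog : Real.log 3 ≤ Real.log n := Real.log_le_log (by norm_num) hn'
  have hℓ : c ≤ Real.log (Real.log n) := Real.log_le_log (by linarith) hlog
  have h4 : 4 ≤ 4 / c * Real.log (Real.log n) := by
    calc (4 : ℝ) = 4 / c * c := by field_simp
      _ ≤ _ := by gcongr
  rw [add_mul]
  cases lam with
  | zero => push_cast; linarith
  | succ k =>
    have h2 := Real.log_two_gt_d9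
    have h2' := Real.log_two_lt_d9
    have h5 : ((2 : ℝ) ^ 2 ^ k) ≤ n := by exact_mod_cast (hlam k (by omega)).le
    have h6 : 2 ^ k * Real.log 2 ≤ Real.log n := by
      have := Real.log_le_log (by positivity) h5
      rw [Real.log_pow] at this
      push_cast at this
      exact this
    have h7 : k * Real.log 2 + Real.log (Real.log 2) ≤ Real.log (Real.log n) := by
      have := Real.log_le_log (by positivity) h6
      rwa [Real.log_mul (by positivity) (by positivity), Real.log_pow] at this
    have h8 : -Real.log 2 ≤ Real.log (Real.log 2) := by
      rw [← Real.log_inv]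
      exact Real.log_le_log (by norm_num) (by linarith)
    have h9 : (k : ℝ) * (1 / 2) ≤ k * Real.log 2 := by gcongr; linarith
    push_cast
    linarith

/-- The total time of the program, with a bound `Y` for the length of a row. -/
theorem total_time_le {nb c N₁ N₂ L₁ L₂ T₁ T₂ w R lam n Y : ℕ} (hN : N₁ = N₂ * c) (hc : 0 < c)
    (hN₂ : 0 < N₂) (hn : nb * N₁ ≤ 2 * n) (hn0 : 0 < n)
    (hY : Y = L₁ * ((2 * w + 1) * (L₂ * ((2 * w + 1) * N₂)))) (hY0 : 0 < Y) (hR : R ≤ Y) :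
    lam * 20 + nb * (T₁ + c * (T₂ + N₂ * positionTime L₁ L₂ N₂ w R lam + 50) + 58) +
      nb * N₁ * R * 20 + 76 ≤
    nb * T₁ + nb * c * T₂ + n * (Y * (lam + 1)) * (2 * (81 ^ 5 * 270 + 1000)) := by
  set v := lam + 1 with hv
  have hYv : Y ≤ Y * v := Nat.le_mul_of_pos_right _ (by omega)
  have hvY : v ≤ Y * v := Nat.le_mul_of_pos_left _ hY0
  have hRv : R * v ≤ Y * v := Nat.mul_le_mul_right _ hR
  have hrow : rowTime L₁ L₂ N₂ w lam = 81 ^ 5 * (180 * (Y * v) + 90 * Y) := by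
    rw [rowTime, hY]; ring
  have hpos : positionTime L₁ L₂ N₂ w R lam ≤ (81 ^ 5 * 270 + 728) * (Y * v) := by
    have e : R * (420 * (lam + 1) + 108) = 420 * (R * v) + 108 * R := by rw [hv]; ring
    rw [positionTime, hrow, e]
    omega
  have hnb : nb ≤ nb * N₁ := Nat.le_mul_of_pos_right _ (by rw [hN]; positivity)
  have hnbc : nb * c ≤ nb * N₁ := Nat.mul_le_mul_left _ (by
    rw [hN]; exact Nat.le_mul_of_pos_left _ hN₂)
  have e : nb * (T₁ + c * (T₂ + N₂ * positionTime L₁ L₂ N₂ w R lam + 50) + 58) =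
      nb * T₁ + nb * c * T₂ + nb * N₁ * positionTime L₁ L₂ N₂ w R lam + nb * c * 50 + nb * 58 := by
    rw [hN]; ring
  have h1 : nb * N₁ * positionTime L₁ L₂ N₂ w R lam ≤
      2 * n * ((81 ^ 5 * 270 + 728) * (Y * v)) := Nat.mul_le_mul hn hpos
  have h2 : nb * N₁ * R ≤ 2 * n * (Y * v) := Nat.mul_le_mul hn (hR.trans hYv)
  have h3 : n ≤ n * (Y * v) := Nat.le_mul_of_pos_right _ (by omega)
  have h4 : Y * v ≤ n * (Y * v) := Nat.le_mul_of_pos_left _ hn0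
  have e1 : 2 * n * ((81 ^ 5 * 270 + 728) * (Y * v)) =
      (2 * (81 ^ 5 * 270 + 728)) * (n * (Y * v)) := by ring
  have e2 : 2 * n * (Y * v) = 2 * (n * (Y * v)) := by ring
  rw [e]
  rw [e1] at h1
  rw [e2] at h2
  generalize n * (Y * v) = Z at *
  omega

theorem card_matchingGraph_le {N₁ N₂ : ℕ} {C₁ : InsDelCode N₁} {C₂ : InsDelCode N₂}
    {D₁ : Decoder C₁} {D₂ : Decoder C₂} {w R : ℕ} {S S' : List IndexedSym} (hN₂ : 0 < N₂)
    (hN : N₂ ∣ N₁) (hN₁ : 0 < N₁)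
    (hR : ∀ q, (rowAt (D₁.subroutines D₂) S S' N₁ N₂ w q).length ≤ R) :
    (matchingGraph D₁ D₂ w S S').card ≤ S'.length * R := by
  have hsub : matchingGraph D₁ D₂ w S S' ⊆ (Finset.range S'.length).biUnion fun q =>
      (rowAt (D₁.subroutines D₂) S S' N₁ N₂ w q).toFinset.image fun p => (p, q) := by
    rintro ⟨p, q⟩ he
    obtain ⟨-, h⟩ := (mem_matchingGraph hN₂ hN hN₁).1 he
    simp only [Finset.mem_biUnion, Finset.mem_range, Finset.mem_image, List.mem_toFinset]
    refine ⟨q, ?_, p, h, rfl⟩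
    by_contra hq
    rw [rowAt, if_neg hq] at h
    exact List.not_mem_nil h
  refine (Finset.card_le_card hsub).trans ((Finset.card_biUnion_le_card_mul _ _ R fun q _ =>
    Finset.card_image_le.trans ((List.toFinset_card_le _).trans (hR q))).trans_eq ?_)
  rw [Finset.card_range]

/-- All numbers that occur are bounded by a power of `n * L₁ * L₂`. -/
theorem word_bound {n L₁ L₂ N l l' R V : ℕ} (hn : 3 ≤ n) (h₁ : 0 < L₁) (h₂ : 0 < L₂) (hN : N ≤ n)
    (hl : l ≤ n) (hl' : l' ≤ n) (hR : R ≤ L₁ * (n * (L₂ * (n * n)))) (hV : V ≤ n * n) :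
    l + N < (n * L₁ * L₂) ^ 8 ∧ l' + N < (n * L₁ * L₂) ^ 8 ∧ L₁ < (n * L₁ * L₂) ^ 8 ∧
      L₂ < (n * L₁ * L₂) ^ 8 ∧ (l' + N) * R + R + 1 < (n * L₁ * L₂) ^ 8 ∧
      V * V < (n * L₁ * L₂) ^ 8 := by
  set A := n * L₁ * L₂ with hA
  have hnA : n ≤ A := by
    rw [hA, mul_assoc]; exact Nat.le_mul_of_pos_right _ (by positivity)
  have h₁A : L₁ ≤ A := by
    rw [hA, mul_comm n, mul_assoc]; exact Nat.le_mul_of_pos_right _ (by positivity)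
  have h₂A : L₂ ≤ A := Nat.le_mul_of_pos_left _ (by positivity)
  have hRA : R ≤ A * (A * A) := by
    refine hR.trans ?_
    calc L₁ * (n * (L₂ * (n * n))) = A * (n * n) := by rw [hA]; ring
      _ ≤ A * (A * A) := Nat.mul_le_mul_left _ (Nat.mul_le_mul hnA hnA)
  have hVA : V ≤ A * A := hV.trans (Nat.mul_le_mul hnA hnA)
  have hVV : V * V ≤ A ^ 4 := (Nat.mul_le_mul hVA hVA).trans_eq (by ring)
  have hrec : (l' + N) * R ≤ 2 * A ^ 4 :=
    (Nat.mul_le_mul (show l' + N ≤ 2 * A by omega) hRA).trans_eq (by ring)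
  have hA3 : 3 ≤ A := hn.trans hnA
  have hp1 : A ≤ A ^ 4 := Nat.le_self_pow (by norm_num) A
  have hp3 : A * (A * A) ≤ A ^ 4 := by
    calc A * (A * A) = A ^ 3 := by ring
      _ ≤ A ^ 4 := Nat.pow_le_pow_right (by omega) (by norm_num)
  have hp8 : 5 * A ^ 4 ≤ A ^ 8 := by
    calc 5 * A ^ 4 ≤ 3 ^ 4 * A ^ 4 := Nat.mul_le_mul_right _ (by norm_num)
      _ ≤ A ^ 4 * A ^ 4 := Nat.mul_le_mul_right _ (Nat.pow_le_pow_left hA3 4)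
      _ = A ^ 8 := by ring
  refine ⟨?_, ?_, ?_, ?_, ?_, ?_⟩ <;> omega

theorem mainTheorem11 :
    ∃ (P : Cmd) (c : ℕ) (K : ℝ),
      ∀ (ε : ℝ), 0 < ε → ε < 1 →
      ∀ (N₁ N₂ L₁ L₂ T₁ T₂ : ℕ) (C₁ : InsDelCode N₁) (C₂ : InsDelCode N₂)
        (D₁ : Decoder C₁) (D₂ : Decoder C₂),
        0 < N₂ → 0 < C₂.size → N₁ = N₂ * C₂.size → 0 < L₁ → 0 < L₂ →
        D₁.IsListDecoder ε L₁ → D₂.IsListDecoder ε L₂ →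
        (∀ y : List ℕ, y.length ≤ N₁ → D₁.time y ≤ T₁) →
        (∀ y : List ℕ, y.length ≤ N₂ → D₂.time y ≤ T₂) →
      ∀ (m : List ℕ) (S S' : List IndexedSym) (n : ℕ),
        m.length ≤ (indexString C₁ C₂).length → S = m.zip (indexString C₁ C₂) →
        n = max S.length S'.length → N₁ ≤ n → 3 ≤ n →
        ((matchingGraph D₁ D₂ ⌊1 / ε⌋₊ S S').card : ℝ) ≤ K * (N₂ * L₁ * L₂ / ε ^ 2 * n) ∧
        ∃ (t : ℕ) (s : Store),
          Exec (D₁.subroutines D₂) ((n * L₁ * L₂) ^ c) P (inputStore S S' N₁ N₂ ⌊1 / ε⌋₊) t s ∧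
          IsLargestNonCrossing (matchingGraph D₁ D₂ ⌊1 / ε⌋₊ S S') s.output ∧
          (t : ℝ) ≤ K * ((n : ℝ) / N₁ * T₁ + (n : ℝ) / N₂ * T₂ +
            N₂ * L₁ * L₂ / ε ^ 2 * n * Real.log (Real.log n)) := by
  obtain ⟨K₀, hK₀, hheight⟩ := exists_height_le
  refine ⟨matchingProgram, 8, 9 * (2 * (81 ^ 5 * 270 + 1000)) * K₀, ?_⟩
  intro ε hε hε1 N₁ N₂ L₁ L₂ T₁ T₂ C₁ C₂ D₁ D₂ hN₂ hC₂ hN hL₁ hL₂ hD₁ hD₂ hT₁ hT₂ m S S' n _ _ hn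
    hNn hn3
  set w := ⌊1 / ε⌋₊ with hw
  have hN₁ : 0 < N₁ := by rw [hN]; positivity
  have hdvd : N₂ ∣ N₁ := ⟨_, hN⟩
  have hdiv : N₁ / N₂ = C₂.size := by rw [hN, Nat.mul_div_cancel_left _ hN₂]
  have hN₂₁ : N₂ ≤ N₁ := Nat.le_of_dvd hN₁ hdvd
  have hS : S.length ≤ n := by omega
  have hS' : S'.length ≤ n := by omega
  -- The window `[j - w, j + w]` has at most `2 * w + 1 ≤ 3 / ε` elements, as `1 ≤ w ≤ 1 / ε`.
  have hw1 : 1 ≤ w := Nat.le_floor (by rw [Nat.cast_one, le_div_iff₀ hε]; linarith)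
  have hwε : ((2 * w + 1 : ℕ) : ℝ) ≤ 3 / ε := by
    have h1 : (w : ℝ) ≤ 1 / ε := Nat.floor_le (by positivity)
    have h2 : (1 : ℝ) ≤ w := by exact_mod_cast hw1
    have h3 : 3 / ε = 3 * (1 / ε) := by ring
    push_cast
    linarith
  obtain ⟨Y, hY⟩ : ∃ Y, Y = L₁ * ((2 * w + 1) * (L₂ * ((2 * w + 1) * N₂))) := ⟨_, rfl⟩
  have hY0 : 0 < Y := by rw [hY]; positivity
  have hYε : (Y : ℝ) ≤ 9 * (N₂ * L₁ * L₂ / ε ^ 2) := by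
    have h1 : (Y : ℝ) = N₂ * L₁ * L₂ * (((2 * w + 1 : ℕ) : ℝ) * ((2 * w + 1 : ℕ) : ℝ)) := by
      rw [hY]; push_cast; ring
    calc (Y : ℝ) ≤ N₂ * L₁ * L₂ * (3 / ε * (3 / ε)) := by
          rw [h1]; gcongr
      _ = _ := by field_simp; ring
  have hout₁ : ∀ y, ((D₁.subroutines D₂).out false y).length ≤ L₁ := fun y =>
    (List.length_map Fin.val).trans_le (hD₁ y).1
  have hout₂ : ∀ y, ((D₁.subroutines D₂).out true y).length ≤ L₂ := fun y =>
    (List.length_map Fin.val).trans_le (hD₂ y).1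
  have hnbS := numBlocks_le (l := S.length) hN₁
  have hNdiv := Nat.div_le_self N₁ N₂
  obtain ⟨R, hR⟩ : ∃ R, R = min Y (L₁ * (n * (L₂ * (n * n)))) := ⟨_, rfl⟩
  have hrow : ∀ q, (rowAt (D₁.subroutines D₂) S S' N₁ N₂ w q).length ≤ R := by
    intro q
    rw [rowAt]
    split_ifs
    · rw [hR, hY]
      refine le_min (length_rowList_le (fun j => by omega) (fun j => by omega) (hout₁ _) (hout₂ _))
        ((length_rowList_le (X := n) (Y := n) (fun j => by omega) (fun j => by omega) (hout₁ _)
          (hout₂ _)).trans ?_)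
      have : N₂ ≤ n := hN₂₁.trans hNn
      gcongr
    · exact Nat.zero_le _
  have hRY : R ≤ Y := hR ▸ min_le_left _ _
  have hnb : numBlocks S'.length N₁ * N₁ ≤ 2 * n :=
    (Nat.div_mul_le_self _ _).trans (by omega)
  -- `lam` is the least level whose universe contains the positions of `S`.
  have hex : ∃ l, S.length ≤ vebSize l := ⟨_, (lt_vebSize _).le⟩
  obtain ⟨lam, hlam, hlt⟩ : ∃ lam, S.length ≤ vebSize lam ∧ ∀ j < lam, vebSize j < S.length :=
    ⟨Nat.find hex, Nat.find_spec hex, fun j hj => not_le.1 (Nat.find_min hex hj)⟩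
  have hV : vebSize lam ≤ n * n := by
    cases lam with
    | zero => exact (show vebSize 0 ≤ 3 * 3 by norm_num [vebSize]).trans (Nat.mul_le_mul hn3 hn3)
    | succ k =>
      have := (hlt k (by omega)).le.trans hS
      rw [vebSize_succ]
      exact Nat.mul_le_mul this this
  obtain ⟨b1, b2, b3, b4, b5, b6⟩ := word_bound hn3 hL₁ hL₂ hNn hS hS' (hR ▸ min_le_right _ _) hV
  have hlamv := lt_vebSize lam
  have hB : vebSize lam * (lam + 1) < (n * L₁ * L₂) ^ 8 :=
    (Nat.mul_le_mul_left _ (by omega)).trans_lt b6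
  have hz : Sizes (D₁.subroutines D₂) ((n * L₁ * L₂) ^ 8) lam S S' N₁ N₂ w L₁ L₂ T₁ T₂ R :=
    ⟨hN₁, hN₂, hL₁, hL₂, hout₁, hout₂, hT₁, hT₂, hrow, hlam, b1, b2, b3, b4, b5⟩
  have hn0 : (0 : ℝ) < n := by exact_mod_cast (by omega : 0 < n)
  have hN₁0 : (0 : ℝ) < N₁ := by exact_mod_cast hN₁
  have hN₂0 : (0 : ℝ) < N₂ := by exact_mod_cast hN₂
  have hv := hheight n lam hn3 fun j hj => (hlt j hj).trans_le hS
  obtain ⟨Z, hZ⟩ : ∃ Z : ℝ, Z = N₂ * L₁ * L₂ / ε ^ 2 * n := ⟨_, rfl⟩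
  have hZ0 : 0 ≤ Z := by rw [hZ]; positivity
  rw [← hZ]
  refine ⟨?_, ?_⟩
  · have h1 : ((matchingGraph D₁ D₂ w S S').card : ℝ) ≤ n * Y := by
      exact_mod_cast (card_matchingGraph_le hN₂ hdvd hN₁ hrow).trans (Nat.mul_le_mul hS' hRY)
    calc ((matchingGraph D₁ D₂ w S S').card : ℝ) ≤ n * Y := h1
      _ ≤ n * (9 * (N₂ * L₁ * L₂ / ε ^ 2)) := by gcongr
      _ = 9 * Z := by rw [hZ]; ring
      _ ≤ _ := by
        refine mul_le_mul_of_nonneg_right ?_ hZ0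
        linarith
  obtain ⟨t, s, hexec, ht, hM, hmax⟩ := wp_matchingProgram hz hdvd hlt hB
  have hG : ∀ M, IsNonCrossing (matchingGraph D₁ D₂ w S S') M ↔ NonCrossingIn
      (rowsGraph (D₁.subroutines D₂) S S' N₁ N₂ w (numBlocks S'.length N₁ * N₁)) M := fun M =>
    and_congr_left fun _ => forall₂_congr fun e _ => mem_matchingGraph hN₂ hdvd hN₁
  refine ⟨t, s, hexec, ⟨(hG _).2 hM, fun M' hM' => hmax M' ((hG _).1 hM')⟩, ?_⟩
  rw [hdiv] at ht
  have ht := ht.trans (total_time_le hN hC₂ hN₂ hnb (by omega) hY hY0 hRY)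
  generalize hnb' : numBlocks S'.length N₁ = nb at ht hnb
  have ht' : (t : ℝ) ≤ nb * T₁ + nb * C₂.size * T₂ +
      n * (Y * ((lam + 1 : ℕ) : ℝ)) * (2 * (81 ^ 5 * 270 + 1000)) := by exact_mod_cast ht
  have hnbR : (nb : ℝ) * N₁ ≤ 2 * n := by exact_mod_cast hnb
  have hnb₁ : (nb : ℝ) ≤ 2 * (n / N₁) := by
    rw [← mul_div_assoc, le_div_iff₀ hN₁0]; exact hnbR
  have hnb₂ : (nb : ℝ) * C₂.size ≤ 2 * (n / N₂) := by
    rw [← mul_div_assoc, le_div_iff₀ hN₂0]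
    have : (N₁ : ℝ) = N₂ * C₂.size := by exact_mod_cast hN
    rw [this] at hnbR
    linarith
  have hℓ : 0 ≤ K₀ * Real.log (Real.log n) := le_trans (by positivity) hv
  have hZℓ : (n : ℝ) * (Y * ((lam + 1 : ℕ) : ℝ)) ≤ 9 * K₀ * (Z * Real.log (Real.log n)) := by
    calc (n : ℝ) * (Y * ((lam + 1 : ℕ) : ℝ)) ≤
          n * (9 * (N₂ * L₁ * L₂ / ε ^ 2) * (K₀ * Real.log (Real.log n))) := by gcongr
      _ = _ := by rw [hZ]; ring
  have h1 : (nb : ℝ) * T₁ ≤ 2 * (n / N₁ * T₁) := by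
    calc (nb : ℝ) * T₁ ≤ 2 * (n / N₁) * T₁ := by gcongr
      _ = _ := by ring
  have h2 : (nb : ℝ) * C₂.size * T₂ ≤ 2 * (n / N₂ * T₂) := by
    calc (nb : ℝ) * C₂.size * T₂ ≤ 2 * (n / N₂) * T₂ := by gcongr
      _ = _ := by ring
  have hx₁ : 0 ≤ (n : ℝ) / N₁ * T₁ := by positivity
  have hx₂ : 0 ≤ (n : ℝ) / N₂ * T₂ := by positivity
  have hK2 : 2 ≤ 9 * (2 * (81 ^ 5 * 270 + 1000)) * K₀ := by linarith
  have h3 := mul_le_mul_of_nonneg_right hK2 hx₁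
  have h4 := mul_le_mul_of_nonneg_right hK2 hx₂
  have h5 := mul_le_mul_of_nonneg_right hZℓ (by norm_num : (0 : ℝ) ≤ 2 * (81 ^ 5 * 270 + 1000))
  rw [mul_add, mul_add]
  linarith
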